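/- Let $(M,g)$ be a compact smooth Riemannian manifold (without boundary) of dimension $n$, let $V\in C^\infty(M;\mathbb R)$, and for $t\in\mathbb R$ put $$H(x,\xi)=\tfrac12|\xi|_g^2+V(x),\qquad H_t(x,\xi)=\tfrac12|\xi|_g^2+t^2V(x),\qquad (x,\xi)\in T^*M .$$ For a Hamiltonian $K$ on $T^*M$, $T>0$, $x,y\in M$ and $\mu>0$, let $\Gamma^{K}_{T,x,y}(\mu)$ be the set of integral curves $(q(s),p(s))_{0\le s\le T}$ of the Hamilton vector field of $K$ with $q(0)=y$, $q(T)=x$ and $|p(0)|_g<\mu$. For $\mu,t_0>0$ and $N\subset M\times M$ call $(\mu,t_0,N)$ admissible if $N$ is an open neighbourhood of the diagonal and, for all $(x,y)\in N$, the set $\Gamma^{H}_{t,x,y}(\mu/t)$ has exactly one element for every $t\in(0,t_0)$, and $\Gamma^{H_t}_{1,x,y}(\mu)$ has exactly one element $(q^t_s(x,y),p^t_s(x,y))_{0\le s\le 1}$ for every $t\in(-t_0,t_0)$. For an admissible triple, the scaled action is $$\Phi(t,x,y)=\int_0^1\Big(\tfrac12\Big|\frac{d}{ds}q^t_s(x,y)\Big|_g^2-t^2V(q^t_s(x,y))\Big)\,ds,\qquad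 (t,x,y)\in(-t_0,t_0)\times N .$$ Theorem. There exist $\mu_0>0$ and $t_2>0$ such that for every $\mu\in(0,\mu_0]$ there are $t_0\in(0,t_2]$ and $N$ with $(\mu,t_0,N)$ admissible, and such that for every admissible $(\mu,t_0,N)$ with $\mu\in(0,\mu_0]$ and $t_0\in(0,t_2]$ the following holds. Let $\mathcal V=\{(y,\eta)\in T^*M : |\eta|_g<\mu\}$. For $t\in(-t_0,t_0)$ the time-1 map $\varphi^t_1$ of the Hamiltonian flow of $H_t$ is defined on $\mathcal V$, and: 0. $\Phi$ is smooth on $(-t_0,t_0)\times N$, and $\mathcal V$ is open in $T^*M$; 1. $(t,y,\eta)\mapsto\varphi^t_1(y,\eta)$ is smooth on $(-t_0,t_0)\times\mathcal V$; 2. for each $t\in(-t_0,t_0)$, $\varphi^t_1:\mathcal V\to\varphi^t_1(\mathcal V)$ is a diffeomorphism onto an open subset of $T^*M$; 3. for all $(t,x,y)\in(-t_0,t_0)\times N$, $(y,-d_y\Phi(t,x,y))\in\mathcal V$ and $\varphi^t_1(y,-d_y\Phi(t,x,y))=(x,d_x\Phi(t,x,y))$. -/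

import Mathlib

open Set Bundle MeasureTheory
open scoped Manifold ContDiff Topology Interval

noncomputable section

namespace CotangentDynamics

/-- The model space `ℝⁿ`. -/
abbrev Model (n : ℕ) : Type := EuclideanSpace ℝ (Fin n)

/-- The model space `(ℝⁿ)*` of covectors. -/
abbrev CoModel (n : ℕ) : Type := Model n →L[ℝ] ℝ

/-- The cotangent space `T*ₓM`. -/
abbrev CotangentSpace (n : ℕ) {M : Type*} [TopologicalSpace M] [ChartedSpace (Model n) M]
    (x : M) : Type :=
  TangentSpace (𝓡 n) x →L[ℝ] ℝ

/-- The cotangent bundle `T*M`, with points `⟨x, ξ⟩`. It carries Mathlib's topology and smooth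
structure of the bundle of continuous linear maps from the tangent bundle to the trivial line
bundle. Its charts are the canonical coordinates `(x₁, …, xₙ, ξ₁, …, ξₙ)` induced by the charts
of `M`. -/
abbrev CotangentBundle (n : ℕ) (M : Type*) [TopologicalSpace M] [ChartedSpace (Model n) M] :=
  TotalSpace (CoModel n) (fun x : M => CotangentSpace n x)

/-- The model with corners of `T*M` (no boundary), with model space `ℝⁿ × (ℝⁿ)*`. -/
abbrev cotangentModel (n : ℕ) :
    ModelWithCorners ℝ (Model n × CoModel n) (ModelProd (Model n) (CoModel n)) :=
  (𝓡 n).prod 𝓘(ℝ, CoModel n)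

/-- Smooth Riemannian metrics on `M`. -/
abbrev SmoothMetric (n : ℕ) (M : Type*) [TopologicalSpace M] [ChartedSpace (Model n) M]
    [IsManifold (𝓡 n) ∞ M] :=
  ContMDiffRiemannianMetric (𝓡 n) ∞ (Model n) (fun x : M => TangentSpace (𝓡 n) x)

section Metric

variable {n : ℕ} {M : Type*} [TopologicalSpace M] [ChartedSpace (Model n) M]
  [IsManifold (𝓡 n) ∞ M]

/-- The vector `v_ξ ∈ TₓM` with `g(v_ξ, ·) = ξ` (see `inner_sharp`). -/
def sharp (g : SmoothMetric n M) (x : M) (ξ : CotangentSpace n x) : TangentSpace (𝓡 n) x :=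
  ContinuousLinearMap.inverse (g.inner x) ξ

theorem inner_isInvertible (g : SmoothMetric n M) (x : M) : (g.inner x).IsInvertible := by
  let B : Model n →L[ℝ] CoModel n := g.inner x
  have hB : Function.Injective (B : Model n →ₗ[ℝ] CoModel n) := by
    refine (injective_iff_map_eq_zero _).2 fun v hv => ?_
    by_contra hne
    have h := g.pos x v hne
    have h0 : g.inner x v v = 0 := congrArg (fun L : CoModel n => L v) hv
    exact h.ne' h0
  have hdim : Module.finrank ℝ (Model n) = Module.finrank ℝ (CoModel n) := by
    rw [← (LinearMap.toContinuousLinearMap (𝕜 := ℝ) (E := Model n) (F' := ℝ)).finrank_eq]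
    exact (Subspace.dual_finrank_eq (K := ℝ) (V := Model n)).symm
  exact ⟨(LinearEquiv.ofInjectiveOfFinrankEq (B : Model n →ₗ[ℝ] CoModel n) hB
    hdim).toContinuousLinearEquiv, ContinuousLinearMap.ext fun _ => rfl⟩

theorem inner_sharp (g : SmoothMetric n M) (x : M) (ξ : CotangentSpace n x) :
    g.inner x (sharp g x ξ) = ξ := by
  obtain ⟨e, he⟩ := inner_isInvertible g x
  rw [sharp, ← he, ContinuousLinearMap.inverse_equiv]
  exact e.apply_symm_apply ξ

/-- `|ξ|_g²` for the point `p = (x, ξ)` of `T*M`. -/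
def covectorNormSq (g : SmoothMetric n M) (p : CotangentBundle n M) : ℝ :=
  p.snd (sharp g p.proj p.snd)

/-- `|ξ|_g` for the point `p = (x, ξ)` of `T*M`. -/
def covectorNorm (g : SmoothMetric n M) (p : CotangentBundle n M) : ℝ :=
  Real.sqrt (covectorNormSq g p)

/-- The set `𝒱(M, μ)` of all `(x, ξ) ∈ T*M` with `|ξ|_g < μ`. -/
def lowMomentum (g : SmoothMetric n M) (μ : ℝ) : Set (CotangentBundle n M) :=
  {p | covectorNorm g p < μ}

/-- The Hamilton vector field of `H`: in canonical coordinates its components are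
`(∂H/∂ξ₁, …, ∂H/∂ξₙ, -∂H/∂x₁, …, -∂H/∂xₙ)`. Mathlib's tangent space of `T*M` at `p` is
`ℝⁿ × (ℝⁿ)*`, read in the chart of `T*M` at `p`, i.e. in the canonical coordinates induced by the
chart of `M` at the base point of `p`, and `mfderiv` is the differential in that chart. -/
def hamiltonField (H : CotangentBundle n M → ℝ) (p : CotangentBundle n M) :
    TangentSpace (cotangentModel n) p :=
  let dH : Model n × CoModel n →L[ℝ] ℝ := mfderiv (cotangentModel n) 𝓘(ℝ, ℝ) H p
  ((WithLp.toLp 2 fun j : Fin n => dH (0, EuclideanSpace.proj j),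
    -(dH.comp (ContinuousLinearMap.inl ℝ (Model n) (CoModel n)))) : Model n × CoModel n)

/-- `c` restricted to `[0, T]` is a classical path of the Hamiltonian `H`, i.e. an integral curve
of the Hamilton vector field. -/
def IsClassicalPath (H : CotangentBundle n M → ℝ) (T : ℝ) (c : ℝ → CotangentBundle n M) : Prop :=
  IsMIntegralCurveOn (I := cotangentModel n) c (hamiltonField H) (Icc 0 T)

/-- `Γ^H_{T,x,y}(μ)`: the classical paths on `[0, T]` from `y` to `x` with initial momentum of
norm less than `μ`. Paths are represented by functions on `ℝ`, of which only the restriction to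
`[0, T]` matters. -/
def lowPaths (g : SmoothMetric n M) (H : CotangentBundle n M → ℝ) (T : ℝ) (x y : M) (μ : ℝ) :
    Set (ℝ → CotangentBundle n M) :=
  {c | IsClassicalPath H T c ∧ (c 0).proj = y ∧ (c T).proj = x ∧ covectorNorm g (c 0) < μ}

/-- `Γ^H_{T,x,y}(μ)` has exactly one element (as a set of functions on `[0, T]`). -/
def HasUniqueLowPath (g : SmoothMetric n M) (H : CotangentBundle n M → ℝ) (T : ℝ) (x y : M)
    (μ : ℝ) : Prop :=
  ∃ c ∈ lowPaths g H T x y μ, ∀ c' ∈ lowPaths g H T x y μ, EqOn c' c (Icc 0 T)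

/-- The Hamiltonian `H(x, ξ) = |ξ|_g² / 2 + V(x)`. -/
def hamiltonian (g : SmoothMetric n M) (V : M → ℝ) (p : CotangentBundle n M) : ℝ :=
  covectorNormSq g p / 2 + V p.proj

/-- The scaled Hamiltonian `H_t(x, ξ) = |ξ|_g² / 2 + t² V(x)`, which is `t² H(x, ξ / t)` for
`t ≠ 0`. -/
def scaledHamiltonian (g : SmoothMetric n M) (V : M → ℝ) (t : ℝ) (p : CotangentBundle n M) : ℝ :=
  covectorNormSq g p / 2 + t ^ 2 * V p.proj

/-- The lowest energy path `s ↦ (q^t_s(x, y), p^t_s(x, y))`: the element of `Γ^{H_t}_{1,x,y}(μ)`,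
meaningful when that set has exactly one element. -/
def lowestPath (g : SmoothMetric n M) (V : M → ℝ) (μ t : ℝ) (x y : M) :
    ℝ → CotangentBundle n M :=
  haveI : Nonempty (ℝ → CotangentBundle n M) := ⟨fun _ => ⟨y, 0⟩⟩
  Classical.epsilon fun c => c ∈ lowPaths g (scaledHamiltonian g V t) 1 x y μ

/-- `|dq/ds|_g²` for a curve `q` in `M`. -/
def speedSq (g : SmoothMetric n M) (q : ℝ → M) (s : ℝ) : ℝ :=
  let v : TangentSpace (𝓡 n) (q s) := mfderiv 𝓘(ℝ, ℝ) (𝓡 n) q s (1 : ℝ)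
  g.inner (q s) v v

/-- The scaled action `Φ(t, x, y) = ∫₀¹ (|dq^t_s/ds|_g² / 2 - t² V(q^t_s)) ds` along the lowest
energy path `q^t_s = q^t_s(x, y)`. -/
def scaledAction (g : SmoothMetric n M) (V : M → ℝ) (μ t : ℝ) (x y : M) : ℝ :=
  let q : ℝ → M := fun s => (lowestPath g V μ t x y s).proj
  ∫ s in (0 : ℝ)..1, (speedSq g q s / 2 - t ^ 2 * V (q s))

/-- The triples `(μ, t₀, N)` for which lowest energy paths exist and are unique: `N` is an open
neighbourhood of the diagonal, and for `(x, y) ∈ N` the set `Γ^H_{t,x,y}(μ/t)` has exactly one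
element for `0 < t < t₀`, and so has `Γ^{H_t}_{1,x,y}(μ)` for `-t₀ < t < t₀`. -/
structure IsAdmissible (g : SmoothMetric n M) (V : M → ℝ) (μ t₀ : ℝ) (N : Set (M × M)) :
    Prop where
  isOpen : IsOpen N
  diagonal_subset : diagonal M ⊆ N
  unique : ∀ t ∈ Ioo 0 t₀, ∀ x y : M, (x, y) ∈ N →
    HasUniqueLowPath g (hamiltonian g V) t x y (μ / t)
  unique_scaled : ∀ t ∈ Ioo (-t₀) t₀, ∀ x y : M, (x, y) ∈ N →
    HasUniqueLowPath g (scaledHamiltonian g V t) 1 x y μ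

end Metric

section Phase

variable {n : ℕ}

/-- The point `(x, df(x))` of the cotangent bundle. -/
def differential {X : Type*} [TopologicalSpace X] [ChartedSpace (Model n) X]
    (f : X → ℝ) (x : X) : CotangentBundle n X :=
  ⟨x, (mfderiv (𝓡 n) 𝓘(ℝ, ℝ) f x : TangentSpace (𝓡 n) x →L[ℝ] ℝ)⟩

/-- `φ(t, x, y)` (for `t ∈ I`, `(x, y) ∈ Ω`) is a smooth phase function, and `γ_t : 𝒱 → T*X`
(for `t ∈ I`) is a smooth family of diffeomorphisms onto their images, defined on an open set
`𝒱 ⊆ T*Y`, with `(y, -d_yφ) ∈ 𝒱` and `γ_t(y, -d_yφ) = (x, d_xφ)`. -/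
structure IsPhaseFunctionWith {X Y : Type*}
    [TopologicalSpace X] [ChartedSpace (Model n) X] [IsManifold (𝓡 n) ∞ X]
    [TopologicalSpace Y] [ChartedSpace (Model n) Y] [IsManifold (𝓡 n) ∞ Y]
    (I : Set ℝ) (Ω : Set (X × Y)) (φ : ℝ → X → Y → ℝ)
    (𝒱 : Set (CotangentBundle n Y)) (γ : ℝ → CotangentBundle n Y → CotangentBundle n X) :
    Prop where
  isOpen_domain : IsOpen Ω
  smooth_phase : ContMDiffOn (𝓘(ℝ, ℝ).prod ((𝓡 n).prod (𝓡 n))) 𝓘(ℝ, ℝ) ∞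
    (fun z : ℝ × X × Y => φ z.1 z.2.1 z.2.2) (I ×ˢ Ω)
  isOpen_source : IsOpen 𝒱
  smooth_family : ContMDiffOn (𝓘(ℝ, ℝ).prod (cotangentModel n)) (cotangentModel n) ∞
    (fun z : ℝ × CotangentBundle n Y => γ z.1 z.2) (I ×ˢ 𝒱)
  diffeo : ∀ t ∈ I, ∃ Ψ : PartialDiffeomorph (cotangentModel n) (cotangentModel n)
    (CotangentBundle n Y) (CotangentBundle n X) ∞, Ψ.source = 𝒱 ∧ EqOn Ψ (γ t) 𝒱
  mem_source : ∀ t ∈ I, ∀ x y, (x, y) ∈ Ω → differential (fun y' => -φ t x y') y ∈ 𝒱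
  generates : ∀ t ∈ I, ∀ x y, (x, y) ∈ Ω →
    γ t (differential (fun y' => -φ t x y') y) = differential (fun x' => φ t x' y) x

end Phase

end CotangentDynamics

end

/-! At t = 0 every point of the zero section is an equilibrium of H_0, and the linearized Hamilton
equations there are x' = Bξ, ξ' = 0, with B the inverse metric. This system is nilpotent, hence
solved explicitly on all of [0, 1], and the flows for small t and small momentum are perturbations
of it. Let t be an extra coordinate of zero velocity. The integral equation γ = w + ∫F(γ) is then
inverted in the Banach space of curves on [0, 1]: its linearization is 1 - K with K² = 0, so the
inverse function theorem gives a solution operator that is smooth in (t, y, η) together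
(`exists_smooth_flow`). Two finite-dimensional inversions follow in `exists_isLocalFlow`: of the
time-one map, whose derivative 1 + A is unipotent, and of the endpoint map (t, y, η) ↦ (t, x, y),
whose derivative is invertible because B is.

The generating property is the first variation formula. Along a solution the variation of the
Lagrangian is the s-derivative of ξ·δx, so the differential of the action at fixed t is ξ(1)·δx(1) -
η·δy (`IsLocalFlow.fderiv_action_apply`). Read through the inverse of the endpoint map, d_xΦ is the
final momentum and -d_yΦ the initial one. Canonical coordinates are symplectic
(`symplecticForm_coChartDeriv`), so these computations in one chart describe the Hamilton field on
T*M.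

Compactness makes the picture uniform (`exists_lowMomentum_cover`): below a common radius, all
initial data over a given y belong to one and the same local flow. Two low paths from y to x then
have equal initial momentum, because the local endpoint map is injective, and coincide by uniqueness
for the ODE (`FlowCover.hasUniqueLowPath`). Existence near the diagonal comes from perturbing the
constant paths at t = 0 (`FlowCover.exists_uniform`), and the statement about H itself from
rescaling momentum and time (`HasUniqueLowPath.of_scaled`). For an arbitrary admissible triple the
low path must be the local one, so Φ agrees locally with the smooth action of a local flow. The
time-one map is injective by uniqueness of solutions traced back from their endpoints, and its
smooth local inverses glue (`exists_partialDiffeomorph`). -/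

noncomputable section

namespace CotangentDynamics

/-! ### Smoothness of postcomposition on spaces of continuous curves -/

section CurveSpace

instance instNormedAddCommGroupCurveCLM {X E F : Type*} [TopologicalSpace X] [CompactSpace X]
    [NormedAddCommGroup E] [NormedSpace ℝ E] [NormedAddCommGroup F] [NormedSpace ℝ F] :
    NormedAddCommGroup C(X, E →L[ℝ] F) :=
  ContinuousMap.instNormedAddCommGroup

instance instNormedSpaceCurveCLM {X E F : Type*} [TopologicalSpace X] [CompactSpace X]
    [NormedAddCommGroup E] [NormedSpace ℝ E] [NormedAddCommGroup F] [NormedSpace ℝ F] :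
    NormedSpace ℝ C(X, E →L[ℝ] F) :=
  ContinuousMap.normedSpace

variable {X : Type*} [TopologicalSpace X] [CompactSpace X]

/-- Pointwise application of a curve of linear maps to a curve of vectors. -/
def applyCurve (X : Type*) [TopologicalSpace X] [CompactSpace X] (E F : Type*)
    [NormedAddCommGroup E] [NormedSpace ℝ E] [NormedAddCommGroup F] [NormedSpace ℝ F] :
    C(X, E →L[ℝ] F) →L[ℝ] C(X, E) →L[ℝ] C(X, F) :=
  LinearMap.mkContinuous₂
    (LinearMap.mk₂ ℝ (fun (A : C(X, E →L[ℝ] F)) (γ : C(X, E)) =>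
      (⟨fun x => A x (γ x), A.continuous.clm_apply γ.continuous⟩ : C(X, F)))
      (fun _ _ _ => rfl) (fun _ _ _ => rfl)
      (fun A γ δ => ContinuousMap.ext fun x => (A x).map_add (γ x) (δ x))
      (fun c A γ => ContinuousMap.ext fun x => (A x).map_smul c (γ x))) 1 (by
    intro A γ
    refine (ContinuousMap.norm_le _ (by positivity)).2 fun x => ?_
    rw [one_mul]
    exact ((A x).le_opNorm (γ x)).trans (mul_le_mul (A.norm_coe_le_norm x) (γ.norm_coe_le_norm x)
      (norm_nonneg _) (norm_nonneg _)))

variable {E F : Type*} [NormedAddCommGroup E] [NormedSpace ℝ E] [NormedAddCommGroup F]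
  [NormedSpace ℝ F]

/-- Since δ ↦ f' ∘ δ is continuous in the sup norm, f' varies by at most ε on a ball around γ x
whose radius does not depend on x. The mean value inequality at each x then has a uniform constant,
which gives the little-o in the sup norm. -/
theorem hasFDerivAt_postcomp (f : C(E, F)) (f' : C(E, E →L[ℝ] F))
    (hf : ∀ x, HasFDerivAt f (f' x) x) (γ : C(X, E)) :
    HasFDerivAt (fun δ : C(X, E) => f.comp δ) (applyCurve X E F (f'.comp γ)) γ := by
  rw [hasFDerivAt_iff_isLittleO, Asymptotics.isLittleO_iff]
  intro ε hε
  have hc : ContinuousAt (fun δ : C(X, E) => f'.comp δ) γ :=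
    (ContinuousMap.continuous_postcomp f').continuousAt
  obtain ⟨r, hr, hball⟩ := Metric.continuousAt_iff.1 hc ε hε
  filter_upwards [Metric.ball_mem_nhds γ hr] with δ hδ
  refine (ContinuousMap.norm_le _ (by positivity)).2 fun x => ?_
  have hx : δ x ∈ Metric.ball (γ x) r :=
    (ContinuousMap.dist_apply_le_dist x).trans_lt hδ
  have key := Convex.norm_image_sub_le_of_norm_hasFDerivWithin_le' (s := Metric.ball (γ x) r)
    (f := f) (f' := f') (φ := f' (γ x)) (C := ε) (x := γ x) (y := δ x)
    (fun y _ => (hf y).hasFDerivWithinAt) ?_ (convex_ball _ _) (Metric.mem_ball_self hr) hx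
  · refine key.trans ?_
    gcongr
    exact (δ - γ).norm_coe_le_norm x
  · intro y hy
    -- Closeness is known for curves, not points: the translate of γ that passes through y at x
    -- turns the sup-norm estimate into one for f' at y.
    have hd : dist (γ + ContinuousMap.const X (y - γ x)) γ < r := by
      rw [dist_eq_norm, add_sub_cancel_left]
      refine lt_of_le_of_lt ((ContinuousMap.norm_le _ (norm_nonneg (y - γ x))).2 fun _ => le_rfl) ?_
      rwa [← dist_eq_norm]
    have h1 := (ContinuousMap.dist_apply_le_dist x).trans (hball hd).le
    simpa [dist_eq_norm] using h1

/-- The derivative is again a postcomposition, by f', followed by the bounded linear map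
`applyCurve`, so induction on the order applies with f' in place of f. The induction replaces F by E
→L[ℝ] F, which is why both spaces share a universe. -/
theorem contDiff_postcomp_nat.{u} {X : Type*} [TopologicalSpace X] [CompactSpace X] (k : ℕ)
    {E : Type u} [NormedAddCommGroup E] [NormedSpace ℝ E] :
    ∀ {F : Type u} [NormedAddCommGroup F] [NormedSpace ℝ F] (f : C(E, F)),
      ContDiff ℝ k f → ContDiff ℝ k (fun δ : C(X, E) => f.comp δ) := by
  induction k with
  | zero =>
    intro F _ _ f _
    exact contDiff_zero.2 (ContinuousMap.continuous_postcomp f)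
  | succ k ih =>
    intro F _ _ f hf
    push_cast at hf ⊢
    obtain ⟨f', hf', hd⟩ := contDiff_succ_iff_hasFDerivAt.1 hf
    refine contDiff_succ_iff_hasFDerivAt.2
      ⟨fun γ => applyCurve X E F ((⟨f', hf'.continuous⟩ : C(E, E →L[ℝ] F)).comp γ), ?_, fun γ =>
        hasFDerivAt_postcomp f ⟨f', hf'.continuous⟩ hd γ⟩
    exact (applyCurve X E F).contDiff.comp (ih ⟨f', hf'.continuous⟩ hf')

theorem contDiff_postcomp.{u} {X : Type*} [TopologicalSpace X] [CompactSpace X]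
    {E F : Type u} [NormedAddCommGroup E] [NormedSpace ℝ E] [NormedAddCommGroup F]
    [NormedSpace ℝ F] (f : C(E, F)) (hf : ContDiff ℝ ∞ f) :
    ContDiff ℝ ∞ (fun δ : C(X, E) => f.comp δ) :=
  contDiff_infty.2 fun k => contDiff_postcomp_nat k f (contDiff_infty.1 hf k)

end CurveSpace

/-! ### The integration operator on curves over [0, 1] -/

section Volterra

variable {E F : Type*} [NormedAddCommGroup E] [NormedAddCommGroup F]

/-- The extension of a curve on `[0, 1]` that is constant outside of `[0, 1]`. -/
def extendCurve (γ : C(unitInterval, E)) (s : ℝ) : E := γ (projIcc 0 1 zero_le_one s)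

theorem continuous_extendCurve (γ : C(unitInterval, E)) : Continuous (extendCurve γ) :=
  γ.continuous.comp continuous_projIcc

theorem extendCurve_coe (γ : C(unitInterval, E)) (s : unitInterval) : extendCurve γ s = γ s := by
  rw [extendCurve, projIcc_val]

theorem norm_extendCurve_le (γ : C(unitInterval, E)) (s : ℝ) : ‖extendCurve γ s‖ ≤ ‖γ‖ :=
  γ.norm_coe_le_norm _

variable [NormedSpace ℝ E] [NormedSpace ℝ F]

theorem hasDerivAt_integral_extendCurve [CompleteSpace E] (γ : C(unitInterval, E)) (s : ℝ) :
    HasDerivAt (fun u => ∫ r in (0 : ℝ)..u, extendCurve γ r) (extendCurve γ s) s :=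
  intervalIntegral.integral_hasDerivAt_right
    ((continuous_extendCurve γ).intervalIntegrable _ _)
    ((continuous_extendCurve γ).stronglyMeasurableAtFilter _ _)
    (continuous_extendCurve γ).continuousAt

/-- The primitive of a curve on `[0, 1]` that vanishes at `0`. -/
def primitive (E : Type*) [NormedAddCommGroup E] [NormedSpace ℝ E] [CompleteSpace E] :
    C(unitInterval, E) →L[ℝ] C(unitInterval, E) :=
  LinearMap.mkContinuous
    { toFun := fun γ => ⟨fun s => ∫ r in (0 : ℝ)..s, extendCurve γ r,
        (continuous_iff_continuousAt.2 fun u =>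
          (hasDerivAt_integral_extendCurve γ u).continuousAt).comp continuous_subtype_val⟩
      map_add' := fun γ δ => ContinuousMap.ext fun s =>
        intervalIntegral.integral_add ((continuous_extendCurve γ).intervalIntegrable _ _)
          ((continuous_extendCurve δ).intervalIntegrable _ _)
      map_smul' := fun c γ => ContinuousMap.ext fun s =>
        intervalIntegral.integral_smul c (extendCurve γ) } 1 (by
    intro γ
    refine (ContinuousMap.norm_le _ (by positivity)).2 fun s => ?_
    refine (intervalIntegral.norm_integral_le_of_norm_le_const
      (fun r _ => norm_extendCurve_le γ r)).trans ?_
    rw [one_mul, sub_zero, abs_of_nonneg s.2.1]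
    exact mul_le_of_le_one_right (norm_nonneg _) s.2.2)

variable [CompleteSpace E] [CompleteSpace F]

theorem primitive_apply (γ : C(unitInterval, E)) (s : unitInterval) :
    primitive E γ s = ∫ r in (0 : ℝ)..s, extendCurve γ r := rfl

/-- Lets a linear map pass through the integral, so that A² = 0 makes the Volterra operator with
kernel A square to zero. -/
theorem primitive_comp_clm (A : E →L[ℝ] F) (γ : C(unitInterval, E)) :
    primitive F ((A : C(E, F)).comp γ) = (A : C(E, F)).comp (primitive E γ) := by
  ext s
  exact A.intervalIntegral_comp_comm ((continuous_extendCurve γ).intervalIntegrable _ _)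

end Volterra

/-! ### An inverse function theorem with inverse smooth on its whole domain -/

section InverseFunction

variable {E F : Type*} [NormedAddCommGroup E] [NormedSpace ℝ E] [CompleteSpace E]
  [NormedAddCommGroup F] [NormedSpace ℝ F]

/-- The usual theorem gives smoothness of the inverse at the image of a only. Invertibility of the
derivative is an open condition, so shrinking the source makes the inverse smooth at every point of
the target. -/
theorem exists_openPartialHomeomorph_contDiffOn {f : E → F} {s : Set E} (hs : IsOpen s)
    (hf : ContDiffOn ℝ ∞ f s) {a : E} (ha : a ∈ s) {f' : E ≃L[ℝ] F}
    (hf' : HasFDerivAt f (f' : E →L[ℝ] F) a) :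
    ∃ φ : OpenPartialHomeomorph E F, a ∈ φ.source ∧ φ.source ⊆ s ∧ (∀ x, φ x = f x) ∧
      ContDiffOn ℝ ∞ φ.symm φ.target := by
  have hfa : ContDiffAt ℝ ∞ f a := hf.contDiffAt (hs.mem_nhds ha)
  have hne : (∞ : WithTop ℕ∞) ≠ 0 := by simp
  let φ₀ := hfa.toOpenPartialHomeomorph f hf' hne
  have hφ₀ : ∀ x, φ₀ x = f x := fun x => rfl
  have hcont : ContinuousOn (fderiv ℝ f) s := hf.continuousOn_fderiv_of_isOpen hs (by simp)
  let u : Set E := s ∩ fderiv ℝ f ⁻¹' range ((↑) : (E ≃L[ℝ] F) → E →L[ℝ] F)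
  have hu : IsOpen u := hcont.isOpen_inter_preimage hs ContinuousLinearEquiv.isOpen
  have hau : a ∈ u := ⟨ha, f', hf'.fderiv.symm⟩
  refine ⟨φ₀.restrOpen u hu, ?_, ?_, hφ₀, ?_⟩
  · exact ⟨hfa.mem_toOpenPartialHomeomorph_source hf' hne, hau⟩
  · exact fun x hx => hx.2.1
  · intro y hy
    have hx : (φ₀.restrOpen u hu).symm y ∈ u := ((φ₀.restrOpen u hu).map_target hy).2
    obtain ⟨hxs, e, he⟩ := hx
    have hdf : ContDiffAt ℝ ∞ f ((φ₀.restrOpen u hu).symm y) := hf.contDiffAt (hs.mem_nhds hxs)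
    refine ((φ₀.restrOpen u hu).contDiffAt_symm (f₀' := e) hy ?_ hdf).contDiffWithinAt
    rw [he]
    exact (hdf.differentiableAt hne).hasFDerivAt

end InverseFunction

/-! ### Smooth solution operator near a nilpotent equilibrium -/

section SmoothDependence

variable {W : Type} [NormedAddCommGroup W] [NormedSpace ℝ W] [CompleteSpace W]

/-- Smooth dependence on the initial value of the solutions on `[0, 1]` of `z' = F(z)`, near an
equilibrium at which the linearization of `F` squares to zero. -/
theorem exists_smooth_flow {F : W → W} (hF : ContDiff ℝ ∞ F) {w₀ : W} (hw₀ : F w₀ = 0)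
    {A : W →L[ℝ] W} (hA : HasFDerivAt F A w₀) (hAA : ∀ w, A (A w) = 0) :
    ∃ (Γ : W → C(unitInterval, W)) (D : Set W), IsOpen D ∧ w₀ ∈ D ∧ ContDiffOn ℝ ∞ Γ D ∧
      (∀ w ∈ D, Γ w = ContinuousMap.const _ w +
        primitive W ((⟨F, hF.continuous⟩ : C(W, W)).comp (Γ w))) ∧
      Γ w₀ = ContinuousMap.const _ w₀ ∧
      ∀ w s, fderiv ℝ Γ w₀ w s = w + (s : ℝ) • A w := by
  let Fc : C(W, W) := ⟨F, hF.continuous⟩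
  let cst : W →L[ℝ] C(unitInterval, W) := LinearMap.mkContinuous
    { toFun := fun w => ContinuousMap.const unitInterval w
      map_add' := fun _ _ => rfl
      map_smul' := fun _ _ => rfl } 1 (fun w => by
        rw [one_mul]
        exact (ContinuousMap.norm_le _ (norm_nonneg w)).2 fun _ => le_rfl)
  -- Solutions starting at w are the curves with G γ = const w, so a local inverse of G, restricted
  -- to constant curves, is the solution operator.
  let G : C(unitInterval, W) → C(unitInterval, W) := fun γ => γ - primitive W (Fc.comp γ)
  have hG : ContDiff ℝ ∞ G :=
    contDiff_id.sub ((primitive W).contDiff.comp (contDiff_postcomp Fc hF))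
  let F' : C(W, W →L[ℝ] W) := ⟨fderiv ℝ F, hF.continuous_fderiv (by simp)⟩
  have hF' : ∀ w, HasFDerivAt Fc (F' w) w := fun w =>
    (hF.differentiable (by simp) w).hasFDerivAt
  let K : C(unitInterval, W) →L[ℝ] C(unitInterval, W) :=
    (primitive W).comp (A.compLeftContinuous ℝ unitInterval)
  have hK : ∀ γ, K γ = (A : C(W, W)).comp (primitive W γ) := fun γ => primitive_comp_clm A γ
  have hKK : ∀ γ, K (K γ) = 0 := by
    intro γ
    have : A.compLeftContinuous ℝ unitInterval (K γ) = 0 := by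
      ext s
      rw [hK]
      exact hAA _
    change primitive W (A.compLeftContinuous ℝ unitInterval (K γ)) = 0
    rw [this, map_zero]
  have hG' : HasFDerivAt G (ContinuousLinearMap.id ℝ _ - K) (cst w₀) := by
    refine (hasFDerivAt_id _).sub ?_
    have h := (primitive W).hasFDerivAt.comp (cst w₀) (hasFDerivAt_postcomp Fc F' hF' (cst w₀))
    refine h.congr_fderiv ?_
    ext γ : 1
    refine congrArg (primitive W) (ContinuousMap.ext fun s => ?_)
    change fderiv ℝ F w₀ (γ s) = A (γ s)
    rw [hA.fderiv]
  -- As K² = 0, the Neumann series of (1 - K)⁻¹ stops at 1 + K. Hence no smallness of the time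
  -- interval is needed.
  let e : C(unitInterval, W) ≃L[ℝ] C(unitInterval, W) :=
    ContinuousLinearEquiv.equivOfInverse (ContinuousLinearMap.id ℝ _ - K)
      (ContinuousLinearMap.id ℝ _ + K)
      (fun γ => by simp [hKK]) (fun γ => by simp [hKK])
  have hG'' : HasFDerivAt G (e : C(unitInterval, W) →L[ℝ] C(unitInterval, W)) (cst w₀) := hG'
  obtain ⟨φ, hmem, -, hφ, hsm⟩ := exists_openPartialHomeomorph_contDiffOn isOpen_univ
    hG.contDiffOn (mem_univ (cst w₀)) hG''
  have hG0 : G (cst w₀) = cst w₀ := by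
    have : Fc.comp (cst w₀) = 0 := ContinuousMap.ext fun s => hw₀
    simp [G, this]
  have hmem' : cst w₀ ∈ φ.target := by
    have := φ.map_source hmem
    rwa [hφ, hG0] at this
  have hsymm0 : φ.symm (cst w₀) = cst w₀ := by
    have := φ.left_inv hmem
    rwa [hφ, hG0] at this
  refine ⟨fun w => φ.symm (cst w), cst ⁻¹' φ.target, φ.open_target.preimage cst.continuous, hmem',
    hsm.comp cst.contDiff.contDiffOn fun _ h => h, fun w hw => ?_, hsymm0, fun w s => ?_⟩
  · have := φ.right_inv hw
    rw [hφ] at this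
    exact (sub_eq_iff_eq_add.1 this)
  · have h1 : HasFDerivAt φ.symm (e.symm : C(unitInterval, W) →L[ℝ] C(unitInterval, W))
        (cst w₀) := by
      refine φ.hasFDerivAt_symm hmem' ?_
      rw [hsymm0]
      exact hG''.congr_of_eventuallyEq (Filter.Eventually.of_forall hφ)
    have h2 := h1.comp w₀ cst.hasFDerivAt
    have h3 : fderiv ℝ (fun w => φ.symm (cst w)) w₀ w = cst w + K (cst w) := by
      rw [h2.fderiv (f := fun w => φ.symm (cst w))]
      rfl
    rw [h3, hK]
    have h4 : primitive W (cst w) s = (s : ℝ) • w := by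
      rw [primitive_apply]
      change ∫ r in (0 : ℝ)..s, w = _
      simp
    change w + A (primitive W (cst w) s) = _
    rw [h4, map_smul]

end SmoothDependence

/-! ### Linear symplectic geometry of ℝⁿ × (ℝⁿ)* -/

section PhaseSpace

variable {n : ℕ}

instance instNormedAddCommGroupCoModel : NormedAddCommGroup (CoModel n) :=
  ContinuousLinearMap.toNormedAddCommGroup

instance instNormedSpaceCoModel : NormedSpace ℝ (CoModel n) :=
  ContinuousLinearMap.toNormedSpace

instance instNormedAddCommGroupPhase : NormedAddCommGroup (Model n × CoModel n) :=
  Prod.normedAddCommGroup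

instance instNormedSpacePhase : NormedSpace ℝ (Model n × CoModel n) :=
  Prod.normedSpace

instance instNormedAddCommGroupDualPhase : NormedAddCommGroup (Model n × CoModel n →L[ℝ] ℝ) :=
  ContinuousLinearMap.toNormedAddCommGroup

instance instNormedSpaceDualPhase : NormedSpace ℝ (Model n × CoModel n →L[ℝ] ℝ) :=
  ContinuousLinearMap.toNormedSpace

/-- The Hamiltonian vector `(∂H/∂ξ, -∂H/∂x)` of a linear form `dH` on `ℝⁿ × (ℝⁿ)*`. -/
def symplecticGrad (n : ℕ) : (Model n × CoModel n →L[ℝ] ℝ) →L[ℝ] Model n × CoModel n :=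
  LinearMap.toContinuousLinearMap
    { toFun := fun d => (WithLp.toLp 2 fun j : Fin n => d (0, EuclideanSpace.proj j),
        -(d.comp (ContinuousLinearMap.inl ℝ (Model n) (CoModel n))))
      map_add' := fun d d' => by
        refine Prod.ext rfl ?_
        ext a
        simp [add_comm]
      map_smul' := fun c d => by
        refine Prod.ext rfl ?_
        ext a
        simp }

theorem covector_eq_sum (ξ : CoModel n) :
    ξ = ∑ j : Fin n, ξ (EuclideanSpace.single j 1) • EuclideanSpace.proj (𝕜 := ℝ) j := by
  ext v
  conv_lhs => rw [← (EuclideanSpace.basisFun (Fin n) ℝ).sum_repr v]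
  simp [mul_comm]

theorem apply_symplecticGrad_fst (d : Model n × CoModel n →L[ℝ] ℝ) (ξ : CoModel n) :
    ξ (symplecticGrad n d).1 = d (0, ξ) := by
  have h : d (0, ξ) = d.comp (ContinuousLinearMap.inr ℝ (Model n) (CoModel n)) ξ := rfl
  rw [h]
  conv_rhs => rw [covector_eq_sum ξ, map_sum]
  conv_lhs => rw [covector_eq_sum ξ, sum_apply]
  refine Finset.sum_congr rfl fun j _ => ?_
  rw [map_smul]
  rfl

theorem symplecticGrad_snd_apply (d : Model n × CoModel n →L[ℝ] ℝ) (a : Model n) :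
    (symplecticGrad n d).2 a = -d (a, 0) := rfl

theorem eq_of_forall_covector {v w : Model n} (h : ∀ ξ : CoModel n, ξ v = ξ w) : v = w := by
  ext j
  exact h (EuclideanSpace.proj j)

/-- The canonical symplectic form on `ℝⁿ × (ℝⁿ)*`. -/
def symplecticForm (u v : Model n × CoModel n) : ℝ := u.2 v.1 - v.2 u.1

/-- The coordinate-free description of Hamiltonian vectors. With nondegeneracy, it reduces
identities between such vectors to pairings with the symplectic form. -/
theorem symplecticForm_symplecticGrad (d : Model n × CoModel n →L[ℝ] ℝ) (v : Model n × CoModel n) :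
    symplecticForm (symplecticGrad n d) v = -d v := by
  have h : v = (v.1, 0) + (0, v.2) := by simp
  conv_rhs => rw [h, map_add]
  rw [symplecticForm, apply_symplecticGrad_fst, symplecticGrad_snd_apply]
  ring

theorem eq_of_forall_symplecticForm {u u' : Model n × CoModel n}
    (h : ∀ v, symplecticForm u v = symplecticForm u' v) : u = u' := by
  refine Prod.ext (eq_of_forall_covector fun ξ => ?_) ?_
  · simpa [symplecticForm] using h (0, ξ)
  · ext a
    simpa [symplecticForm] using h (a, 0)

/-- A linear map preserving the symplectic form intertwines Hamiltonian vectors. -/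
theorem apply_symplecticGrad {D : Model n × CoModel n →L[ℝ] Model n × CoModel n}
    (hD : ∀ u v, symplecticForm (D u) (D v) = symplecticForm u v) (hs : Function.Surjective D)
    (d : Model n × CoModel n →L[ℝ] ℝ) :
    D (symplecticGrad n (d.comp D)) = symplecticGrad n d := by
  refine eq_of_forall_symplecticForm fun v => ?_
  obtain ⟨v, rfl⟩ := hs v
  rw [hD, symplecticForm_symplecticGrad, symplecticForm_symplecticGrad]
  rfl

/-- Cotangent lifts of coordinate changes are symplectic. -/
theorem symplecticForm_fderiv_of_lift {φ : Model n → Model n}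
    {K : Model n × CoModel n → Model n × CoModel n} {z : Model n × CoModel n}
    (hφ : ContDiffAt ℝ 2 φ z.1) (hK : DifferentiableAt ℝ K z)
    (h₁ : ∀ᶠ z' in 𝓝 z, (K z').1 = φ z'.1)
    (h₂ : ∀ᶠ z' in 𝓝 z, (K z').2.comp (fderiv ℝ φ z'.1) = z'.2) (u v : Model n × CoModel n) :
    symplecticForm (fderiv ℝ K z u) (fderiv ℝ K z v) = symplecticForm u v := by
  have hφ1 : HasFDerivAt φ (fderiv ℝ φ z.1) z.1 :=
    (hφ.differentiableAt (by norm_num)).hasFDerivAt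
  have hφ2 : HasFDerivAt (fderiv ℝ φ) (fderiv ℝ (fderiv ℝ φ) z.1) z.1 :=
    ((hφ.fderiv_right (m := 1) (by norm_num)).differentiableAt (by norm_num)).hasFDerivAt
  have hsymm : ∀ a b, fderiv ℝ (fderiv ℝ φ) z.1 a b = fderiv ℝ (fderiv ℝ φ) z.1 b a := fun a b =>
    (hφ.isSymmSndFDerivAt (by simp)).eq a b
  have hK' := hK.hasFDerivAt
  have e₁ : ∀ w, (fderiv ℝ K z w).1 = fderiv ℝ φ z.1 w.1 := by
    have ha : HasFDerivAt (fun z' : Model n × CoModel n => φ z'.1)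
        ((fderiv ℝ φ z.1).comp (ContinuousLinearMap.fst ℝ _ _)) z := hφ1.comp z hasFDerivAt_fst
    have hb := (hK'.fst).congr_of_eventuallyEq (h₁.mono fun _ h => h.symm)
    intro w
    exact congrArg (fun L => L w) (hb.unique ha)
  -- Differentiating the lift relation produces a second-derivative term of φ. In the
  -- antisymmetrized form this term cancels by symmetry of second derivatives.
  have e₂ : ∀ w b, (fderiv ℝ K z w).2 (fderiv ℝ φ z.1 b) +
      (K z).2 (fderiv ℝ (fderiv ℝ φ) z.1 w.1 b) = w.2 b := by
    have ha : HasFDerivAt (fun z' : Model n × CoModel n => fderiv ℝ φ z'.1)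
        ((fderiv ℝ (fderiv ℝ φ) z.1).comp (ContinuousLinearMap.fst ℝ _ _)) z :=
      hφ2.comp z hasFDerivAt_fst
    have hb := ((hK'.snd).clm_comp ha).congr_of_eventuallyEq (h₂.mono fun _ h => h.symm)
    intro w b
    have := congrArg (fun L => L w b) (hb.unique hasFDerivAt_snd)
    simpa [add_comm] using this
  have hu := e₂ u v.1
  have hv := e₂ v u.1
  rw [symplecticForm, symplecticForm, e₁, e₁, ← hu, ← hv, hsymm v.1 u.1]
  ring

end PhaseSpace

/-! ### Hamilton's equations in coordinates and the first variation of the action -/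

section LocalFlow

variable {n : ℕ}

/-- The Hamilton vector field of a Hamiltonian `h(t, x, ξ)` depending on a parameter `t`, as a
vector field on the extended phase space. -/
def extendedField (h : ℝ × Model n × CoModel n → ℝ) (w : ℝ × Model n × CoModel n) :
    ℝ × Model n × CoModel n :=
  (0, symplecticGrad n ((fderiv ℝ h w).comp (ContinuousLinearMap.inr ℝ ℝ (Model n × CoModel n))))

theorem contDiff_extendedField {h : ℝ × Model n × CoModel n → ℝ} (hh : ContDiff ℝ ∞ h) :
    ContDiff ℝ ∞ (extendedField h) := by
  have h1 : ContDiff ℝ ∞ (fderiv ℝ h) := hh.fderiv_right (by simp)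
  exact contDiff_const.prodMk ((symplecticGrad n).contDiff.comp (h1.clm_comp contDiff_const))

/-- The Lagrangian `ξ · ∂h/∂ξ - h`. -/
def lagrangian (h : ℝ × Model n × CoModel n → ℝ) (w : ℝ × Model n × CoModel n) : ℝ :=
  w.2.2 (extendedField h w).2.1 - h w

theorem contDiff_lagrangian {h : ℝ × Model n × CoModel n → ℝ} (hh : ContDiff ℝ ∞ h) :
    ContDiff ℝ ∞ (lagrangian h) :=
  (contDiff_snd.snd.clm_apply (contDiff_extendedField hh).snd.fst).sub hh

/-- The terms pairing δξ with ∂h/∂ξ cancel between ξ·∂h/∂ξ and h. What remains is the s-derivative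
of ξ·δx along a solution with variation ζ. -/
theorem fderiv_lagrangian_apply {h : ℝ × Model n × CoModel n → ℝ} (hh : ContDiff ℝ ∞ h)
    (w : ℝ × Model n × CoModel n) (ζ : Model n × CoModel n) :
    fderiv ℝ (lagrangian h) w (0, ζ) =
      w.2.2 (fderiv ℝ (extendedField h) w (0, ζ)).2.1 + (extendedField h w).2.2 ζ.1 := by
  have hF : HasFDerivAt (extendedField h) (fderiv ℝ (extendedField h) w) w :=
    ((contDiff_extendedField hh).differentiable (by simp) w).hasFDerivAt
  have hd : HasFDerivAt h (fderiv ℝ h w) w := (hh.differentiable (by simp) w).hasFDerivAt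
  have hL := ((hasFDerivAt_snd.snd (x := w)).clm_apply hF.snd.fst).sub hd
  have e : fderiv ℝ (lagrangian h) w = _ := hL.fderiv
  have hsplit : ((0 : ℝ), ζ) = (0, (ζ.1, 0)) + (0, ((0 : Model n), ζ.2)) := by simp
  have e1 : fderiv ℝ h w (0, ζ) = -(extendedField h w).2.2 ζ.1 + ζ.2 (extendedField h w).2.1 := by
    rw [hsplit, map_add]
    congr 1
    · rw [extendedField, symplecticGrad_snd_apply, neg_neg]
      rfl
    · rw [extendedField, apply_symplecticGrad_fst]
      rfl
  rw [e]
  simp only [sub_apply, e1]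
  simp

/-- `Γ w`, for `w` in the open set `D`, is a solution on `[0, 1]` of Hamilton's equations starting
at `w`, depending smoothly on `w`. -/
structure IsLocalFlow (h : ℝ × Model n × CoModel n → ℝ) (hh : ContDiff ℝ ∞ h)
    (D : Set (ℝ × Model n × CoModel n))
    (Γ : ℝ × Model n × CoModel n → C(unitInterval, ℝ × Model n × CoModel n)) : Prop where
  isOpen : IsOpen D
  smooth : ContDiffOn ℝ ∞ Γ D
  eq : ∀ w ∈ D, Γ w = ContinuousMap.const _ w + primitive (ℝ × Model n × CoModel n)
    ((⟨extendedField h, (contDiff_extendedField hh).continuous⟩ : C(_, _)).comp (Γ w))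

variable {h : ℝ × Model n × CoModel n → ℝ} {hh : ContDiff ℝ ∞ h}
  {D : Set (ℝ × Model n × CoModel n)}
  {Γ : ℝ × Model n × CoModel n → C(unitInterval, ℝ × Model n × CoModel n)}

namespace IsLocalFlow

theorem mono (hΓ : IsLocalFlow h hh D Γ) {D' : Set (ℝ × Model n × CoModel n)} (hD' : IsOpen D')
    (hsub : D' ⊆ D) : IsLocalFlow h hh D' Γ :=
  ⟨hD', hΓ.smooth.mono hsub, fun w hw => hΓ.eq w (hsub hw)⟩

theorem apply_eq (hΓ : IsLocalFlow h hh D Γ) {w : ℝ × Model n × CoModel n} (hw : w ∈ D)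
    (s : unitInterval) :
    Γ w s = w + ∫ r in (0 : ℝ)..s, extendedField h (extendCurve (Γ w) r) := by
  conv_lhs => rw [hΓ.eq w hw]
  rfl

theorem apply_zero (hΓ : IsLocalFlow h hh D Γ) {w : ℝ × Model n × CoModel n} (hw : w ∈ D) :
    Γ w 0 = w := by
  rw [hΓ.apply_eq hw]
  simp

theorem hasDerivWithinAt (hΓ : IsLocalFlow h hh D Γ) {w : ℝ × Model n × CoModel n} (hw : w ∈ D)
    {s : ℝ} (hs : s ∈ Icc (0 : ℝ) 1) :
    HasDerivWithinAt (extendCurve (Γ w)) (extendedField h (extendCurve (Γ w) s)) (Icc 0 1) s := by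
  have h1 : HasDerivAt (fun u : ℝ => w + ∫ r in (0 : ℝ)..u, extendedField h (extendCurve (Γ w) r))
      (extendedField h (extendCurve (Γ w) s)) s :=
    (hasDerivAt_integral_extendCurve ((⟨extendedField h,
      (contDiff_extendedField hh).continuous⟩ : C(_, _)).comp (Γ w)) s).const_add w
  have key : ∀ u ∈ Icc (0 : ℝ) 1,
      extendCurve (Γ w) u = w + ∫ r in (0 : ℝ)..u, extendedField h (extendCurve (Γ w) r) :=
    fun u hu => by
      rw [← hΓ.apply_eq hw ⟨u, hu⟩]
      exact extendCurve_coe (Γ w) ⟨u, hu⟩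
  exact h1.hasDerivWithinAt.congr key (key s hs)

theorem apply_fst (hΓ : IsLocalFlow h hh D Γ) {w : ℝ × Model n × CoModel n} (hw : w ∈ D)
    (s : unitInterval) : (Γ w s).1 = w.1 := by
  have hc : Continuous fun r => extendedField h (extendCurve (Γ w) r) :=
    (contDiff_extendedField hh).continuous.comp (continuous_extendCurve _)
  have h1 := (ContinuousLinearMap.fst ℝ ℝ (Model n × CoModel n)).intervalIntegral_comp_comm
    (hc.intervalIntegrable (μ := volume) 0 s)
  rw [hΓ.apply_eq hw, Prod.fst_add]
  have h2 : (∫ r in (0 : ℝ)..s, extendedField h (extendCurve (Γ w) r)).1 = 0 := by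
    refine h1.symm.trans ?_
    simp [extendedField]
  rw [h2, add_zero]

/-- Differentiating the integral equation in the initial value shows that the derivative of the flow
solves the linearized equation. -/
theorem variation_eq (hΓ : IsLocalFlow h hh D Γ) {w : ℝ × Model n × CoModel n} (hw : w ∈ D)
    (v : ℝ × Model n × CoModel n) (s : unitInterval) :
    fderiv ℝ Γ w v s = v + ∫ r in (0 : ℝ)..s,
      fderiv ℝ (extendedField h) (extendCurve (Γ w) r) (extendCurve (fderiv ℝ Γ w v) r) := by
  have hFs := contDiff_extendedField hh
  let Fc : C(ℝ × Model n × CoModel n, ℝ × Model n × CoModel n) := ⟨extendedField h, hFs.continuous⟩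
  let F' : C(ℝ × Model n × CoModel n, (ℝ × Model n × CoModel n) →L[ℝ] (ℝ × Model n × CoModel n)) :=
    ⟨fderiv ℝ (extendedField h), hFs.continuous_fderiv (by simp)⟩
  have hF' : ∀ x, HasFDerivAt Fc (F' x) x := fun x =>
    (hFs.differentiable (by simp) x).hasFDerivAt
  have hd : HasFDerivAt Γ (fderiv ℝ Γ w) w :=
    ((hΓ.smooth.contDiffAt (hΓ.isOpen.mem_nhds hw)).differentiableAt (by simp)).hasFDerivAt
  have h1 := (ContinuousMap.evalCLM ℝ s).hasFDerivAt.comp w hd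
  have h2 := (hasFDerivAt_id w).add ((ContinuousMap.evalCLM ℝ s).hasFDerivAt.comp w
    ((primitive _).hasFDerivAt.comp w ((hasFDerivAt_postcomp Fc F' hF' (Γ w)).comp w hd)))
  have h3 := h2.congr_of_eventuallyEq (f₁ := fun w' => Γ w' s) (by
    filter_upwards [hΓ.isOpen.mem_nhds hw] with w' hw'
    exact hΓ.apply_eq hw' s)
  exact congrArg (fun L => L v) (h1.unique h3)

/-- The action `∫₀¹ (ξ · ∂h/∂ξ - h) ds` of the solution starting at `w`. -/
theorem action_smooth (hΓ : IsLocalFlow h hh D Γ) :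
    ContDiffOn ℝ ∞ (fun w => ∫ s in (0 : ℝ)..1, lagrangian h (extendCurve (Γ w) s)) D := by
  let Lc : C(ℝ × Model n × CoModel n, ℝ) := ⟨lagrangian h, (contDiff_lagrangian hh).continuous⟩
  exact ((ContinuousMap.evalCLM ℝ (1 : unitInterval)).contDiff.comp ((primitive ℝ).contDiff.comp
    (contDiff_postcomp Lc (contDiff_lagrangian hh)))).comp_contDiffOn hΓ.smooth

/-- The first variation formula. -/
theorem fderiv_action_apply (hΓ : IsLocalFlow h hh D Γ) {w : ℝ × Model n × CoModel n}
    (hw : w ∈ D) {v : ℝ × Model n × CoModel n} (hv : v.1 = 0) :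
    fderiv ℝ (fun w => ∫ s in (0 : ℝ)..1, lagrangian h (extendCurve (Γ w) s)) w v =
      (Γ w 1).2.2 (fderiv ℝ Γ w v 1).2.1 - w.2.2 v.2.1 := by
  have hLs := contDiff_lagrangian hh
  have hFs := contDiff_extendedField hh
  let Lc : C(ℝ × Model n × CoModel n, ℝ) := ⟨lagrangian h, hLs.continuous⟩
  let L' : C(ℝ × Model n × CoModel n, (ℝ × Model n × CoModel n) →L[ℝ] ℝ) :=
    ⟨fderiv ℝ (lagrangian h), hLs.continuous_fderiv (by simp)⟩
  let F' : C(ℝ × Model n × CoModel n, (ℝ × Model n × CoModel n) →L[ℝ] (ℝ × Model n × CoModel n)) :=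
    ⟨fderiv ℝ (extendedField h), hFs.continuous_fderiv (by simp)⟩
  have hL' : ∀ x, HasFDerivAt Lc (L' x) x := fun x =>
    (hLs.differentiable (by simp) x).hasFDerivAt
  have hd : HasFDerivAt Γ (fderiv ℝ Γ w) w :=
    ((hΓ.smooth.contDiffAt (hΓ.isOpen.mem_nhds hw)).differentiableAt (by simp)).hasFDerivAt
  have h1 := (ContinuousMap.evalCLM ℝ (1 : unitInterval)).hasFDerivAt.comp w
    ((primitive ℝ).hasFDerivAt.comp w ((hasFDerivAt_postcomp Lc L' hL' (Γ w)).comp w hd))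
  set δ := fderiv ℝ Γ w v with hδ
  have h1' : fderiv ℝ (fun w => ∫ s in (0 : ℝ)..1, lagrangian h (extendCurve (Γ w) s)) w v =
      ∫ s in (0 : ℝ)..1, fderiv ℝ (lagrangian h) (extendCurve (Γ w) s) (extendCurve δ s) :=
    congrArg (fun L => L v) h1.fderiv
  rw [h1']
  have hδd : ∀ s ∈ Icc (0 : ℝ) 1, HasDerivWithinAt (extendCurve δ)
      (fderiv ℝ (extendedField h) (extendCurve (Γ w) s) (extendCurve δ s)) (Icc 0 1) s := by
    intro s hs
    have h2 := (hasDerivAt_integral_extendCurve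
      (applyCurve _ _ _ (F'.comp (Γ w)) δ) s).const_add v
    have key : ∀ u ∈ Icc (0 : ℝ) 1, extendCurve δ u = v +
        ∫ r in (0 : ℝ)..u, extendCurve (applyCurve _ _ _ (F'.comp (Γ w)) δ) r :=
      fun u hu => (extendCurve_coe δ ⟨u, hu⟩).trans (hΓ.variation_eq hw v ⟨u, hu⟩)
    exact h2.hasDerivWithinAt.congr key (key s hs)
  -- The parameter t is conserved and v does not move it, so the variation stays in phase space, as
  -- the formula for the Lagrangian requires.
  have hδ1 : ∀ s, (extendCurve δ s).1 = 0 := by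
    intro s
    have h2 := ((ContinuousLinearMap.fst ℝ ℝ (Model n × CoModel n)).comp
      (ContinuousMap.evalCLM ℝ (projIcc 0 1 zero_le_one s))).hasFDerivAt.comp w hd
    have h3 : HasFDerivAt (fun w' => (Γ w' (projIcc 0 1 zero_le_one s)).1)
        (ContinuousLinearMap.fst ℝ ℝ (Model n × CoModel n)) w := by
      refine hasFDerivAt_fst.congr_of_eventuallyEq ?_
      filter_upwards [hΓ.isOpen.mem_nhds hw] with w' hw'
      exact hΓ.apply_fst hw' _
    exact (congrArg (fun L => L v) (h2.unique h3)).trans hv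
  -- The variation of the Lagrangian is exact in s, with primitive ξ·δx; only boundary terms survive
  -- integration.
  have hprod : ∀ s ∈ Icc (0 : ℝ) 1, HasDerivWithinAt
      (fun s => (extendCurve (Γ w) s).2.2 (extendCurve δ s).2.1)
      (fderiv ℝ (lagrangian h) (extendCurve (Γ w) s) (extendCurve δ s)) (Icc 0 1) s := by
    intro s hs
    have h4 : HasDerivWithinAt (fun s => (extendCurve (Γ w) s).2.2)
        (extendedField h (extendCurve (Γ w) s)).2.2 (Icc 0 1) s :=
      ((ContinuousLinearMap.snd ℝ (Model n) (CoModel n)).comp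
        (ContinuousLinearMap.snd ℝ ℝ _)).hasFDerivAt.comp_hasDerivWithinAt s
          (hΓ.hasDerivWithinAt hw hs)
    have h5 : HasDerivWithinAt (fun s => (extendCurve δ s).2.1)
        (fderiv ℝ (extendedField h) (extendCurve (Γ w) s) (extendCurve δ s)).2.1 (Icc 0 1) s :=
      ((ContinuousLinearMap.fst ℝ (Model n) (CoModel n)).comp
        (ContinuousLinearMap.snd ℝ ℝ _)).hasFDerivAt.comp_hasDerivWithinAt s (hδd s hs)
    have h2 := h4.clm_apply h5
    refine h2.congr_deriv ?_
    have h3 : extendCurve δ s = (0, (extendCurve δ s).2) := Prod.ext (hδ1 s) rfl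
    rw [h3, fderiv_lagrangian_apply hh, add_comm]
  have hcont : Continuous fun s =>
      fderiv ℝ (lagrangian h) (extendCurve (Γ w) s) (extendCurve δ s) :=
    continuous_extendCurve (applyCurve _ _ _ (L'.comp (Γ w)) δ)
  have hfin := intervalIntegral.integral_eq_sub_of_hasDeriv_right_of_le zero_le_one
    (fun s hs => (hprod s hs).continuousWithinAt)
    (fun s hs => ((hprod s (Ioo_subset_Icc_self hs)).hasDerivAt
      (Icc_mem_nhds hs.1 hs.2)).hasDerivWithinAt)
    (hcont.intervalIntegrable 0 1)
  rw [hfin]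
  have hδ0 : extendCurve δ 0 = v := by
    refine (extendCurve_coe δ 0).trans ((hΓ.variation_eq hw v 0).trans ?_)
    simp
  have hΓ0 : extendCurve (Γ w) 0 = w := (extendCurve_coe (Γ w) 0).trans (hΓ.apply_zero hw)
  rw [hδ0, hΓ0]
  congr 2
  · exact congrArg (fun x => x.2.2) (extendCurve_coe (Γ w) 1)
  · exact congrArg (fun x => x.2.1) (extendCurve_coe δ 1)

end IsLocalFlow

end LocalFlow

/-! ### Local flows with invertible time-one and endpoint maps -/

section LocalFlowExistence

variable {n : ℕ}

namespace IsLocalFlow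

variable {h : ℝ × Model n × CoModel n → ℝ} {hh : ContDiff ℝ ∞ h}
  {D : Set (ℝ × Model n × CoModel n)}
  {Γ : ℝ × Model n × CoModel n → C(unitInterval, ℝ × Model n × CoModel n)}

/-- The differential of the action as a function of the endpoints `(t, x, y)`. -/
theorem hasFDerivAt_action_endpoints (hΓ : IsLocalFlow h hh D Γ)
    {ψ : OpenPartialHomeomorph (ℝ × Model n × CoModel n) (ℝ × Model n × Model n)}
    (hψD : ψ.source = D) (hψ : ∀ w, ψ w = (w.1, (Γ w 1).2.1, w.2.1))
    (hψs : ContDiffOn ℝ ∞ ψ.symm ψ.target) {w : ℝ × Model n × CoModel n} (hw : w ∈ D) :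
    ∃ T : ℝ × Model n × Model n →L[ℝ] ℝ,
      HasFDerivAt (fun z => ∫ s in (0 : ℝ)..1, lagrangian h (extendCurve (Γ (ψ.symm z)) s)) T
        (ψ w) ∧ ∀ a b, T (0, a, b) = (Γ w 1).2.2 a - w.2.2 b := by
  have hws : w ∈ ψ.source := hψD ▸ hw
  have hzt : ψ w ∈ ψ.target := ψ.map_source hws
  have hinv : ψ.symm (ψ w) = w := ψ.left_inv hws
  let S : ℝ × Model n × CoModel n → ℝ :=
    fun w => ∫ s in (0 : ℝ)..1, lagrangian h (extendCurve (Γ w) s)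
  have hS : HasFDerivAt S (fderiv ℝ S w) (ψ.symm (ψ w)) := by
    rw [hinv]
    exact ((hΓ.action_smooth.contDiffAt (hΓ.isOpen.mem_nhds hw)).differentiableAt
      (by simp)).hasFDerivAt
  have hI : HasFDerivAt ψ.symm (fderiv ℝ ψ.symm (ψ w)) (ψ w) :=
    ((hψs.contDiffAt (ψ.open_target.mem_nhds hzt)).differentiableAt (by simp)).hasFDerivAt
  refine ⟨_, hS.comp (ψ w) hI, fun a b => ?_⟩
  have hd : HasFDerivAt Γ (fderiv ℝ Γ w) (ψ.symm (ψ w)) := by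
    rw [hinv]
    exact ((hΓ.smooth.contDiffAt (hΓ.isOpen.mem_nhds hw)).differentiableAt (by simp)).hasFDerivAt
  have hright : ∀ᶠ z in 𝓝 (ψ w), ψ (ψ.symm z) = z := by
    filter_upwards [ψ.open_target.mem_nhds hzt] with z hz using ψ.right_inv hz
  -- The variation of the initial value that moves the endpoints by (a, b). Differentiating ψ ∘ ψ⁻¹
  -- = id identifies its t-component, its initial displacement and the displacement it causes at
  -- time one.
  set v := fderiv ℝ ψ.symm (ψ w) (0, a, b) with hv
  have c1 : v.1 = 0 := by
    have := (hasFDerivAt_id (𝕜 := ℝ) (ψ w)).fst.congr_of_eventuallyEq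
      (f₁ := fun z => (ψ.symm z).1) (hright.mono fun z hz => by
        rw [hψ] at hz; exact congrArg Prod.fst hz)
    exact congrArg (fun L => L (0, a, b)) (hI.fst.unique this)
  have c2 : v.2.1 = b := by
    have := (hasFDerivAt_id (𝕜 := ℝ) (ψ w)).snd.snd.congr_of_eventuallyEq
      (f₁ := fun z => (ψ.symm z).2.1) (hright.mono fun z hz => by
        rw [hψ] at hz; exact congrArg (fun x => x.2.2) hz)
    exact congrArg (fun L => L (0, a, b)) (hI.snd.fst.unique this)
  have c3 : (fderiv ℝ Γ w v 1).2.1 = a := by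
    have h1 := (((ContinuousLinearMap.fst ℝ (Model n) (CoModel n)).comp
      (ContinuousLinearMap.snd ℝ ℝ _)).comp (ContinuousMap.evalCLM ℝ (1 : unitInterval))
      ).hasFDerivAt.comp (ψ w) (hd.comp (ψ w) hI)
    have := (hasFDerivAt_id (𝕜 := ℝ) (ψ w)).snd.fst.congr_of_eventuallyEq
      (f₁ := fun z => (Γ (ψ.symm z) 1).2.1) (hright.mono fun z hz => by
        rw [hψ] at hz; exact congrArg (fun x => x.2.1) hz)
    exact congrArg (fun L => L (0, a, b)) (h1.unique this)
  change fderiv ℝ S w v = _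
  rw [hΓ.fderiv_action_apply hw c1, c2, c3]

end IsLocalFlow

/-- Near an equilibrium `w₀ = (t₀, x₀, ξ₀)` at which the linearized Hamilton equations are
`x' = B ξ`, `ξ' = 0` with invertible `B`, the time one map and the map
`(t, y, η) ↦ (t, x, y)`, with `x` the position at time one, have smooth local inverses. -/
theorem exists_isLocalFlow {h : ℝ × Model n × CoModel n → ℝ} (hh : ContDiff ℝ ∞ h)
    {w₀ : ℝ × Model n × CoModel n} (hw₀ : extendedField h w₀ = 0)
    (B : CoModel n ≃L[ℝ] Model n)
    {A : (ℝ × Model n × CoModel n) →L[ℝ] (ℝ × Model n × CoModel n)}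
    (hA : HasFDerivAt (extendedField h) A w₀) (hAB : ∀ v, A v = (0, B v.2.2, 0))
    {O : Set (ℝ × Model n × CoModel n)} (hO : IsOpen O) (hwO : w₀ ∈ O) :
    ∃ (D : Set (ℝ × Model n × CoModel n))
      (Γ : ℝ × Model n × CoModel n → C(unitInterval, ℝ × Model n × CoModel n))
      (φ : OpenPartialHomeomorph (ℝ × Model n × CoModel n) (ℝ × Model n × CoModel n))
      (ψ : OpenPartialHomeomorph (ℝ × Model n × CoModel n) (ℝ × Model n × Model n)),
      w₀ ∈ D ∧ IsLocalFlow h hh D Γ ∧ (∀ w ∈ D, ∀ s, Γ w s ∈ O) ∧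
      φ.source = D ∧ (∀ w, φ w = Γ w 1) ∧ ContDiffOn ℝ ∞ φ.symm φ.target ∧
      ψ.source = D ∧ (∀ w, ψ w = (w.1, (Γ w 1).2.1, w.2.1)) ∧
      ContDiffOn ℝ ∞ ψ.symm ψ.target := by
  obtain ⟨Γ, D₀, hD₀, hwD₀, hsm, heq, hΓ₀, hdΓ⟩ := exists_smooth_flow (contDiff_extendedField hh)
    hw₀ hA (fun v => by simp [hAB])
  -- Only initial values whose whole solution stays in O are kept; this set is open because [0, 1]
  -- is compact.
  let D₁ : Set (ℝ × Model n × CoModel n) := D₀ ∩ Γ ⁻¹' {γ | MapsTo γ univ O}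
  have hD₁ : IsOpen D₁ := hsm.continuousOn.isOpen_inter_preimage hD₀
    (ContinuousMap.isOpen_setOfPred_mapsTo isCompact_univ hO)
  have hwD₁ : w₀ ∈ D₁ := ⟨hwD₀, fun s _ => by rw [hΓ₀]; exact hwO⟩
  have hsm₁ : ContDiffOn ℝ ∞ Γ D₁ := hsm.mono inter_subset_left
  have hdw : HasFDerivAt Γ (fderiv ℝ Γ w₀) w₀ :=
    ((hsm.contDiffAt (hD₀.mem_nhds hwD₀)).differentiableAt (by simp)).hasFDerivAt
  have hev : ∀ v, fderiv ℝ Γ w₀ v 1 = v + A v := fun v => by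
    rw [hdΓ]
    simp
  let ev : C(unitInterval, ℝ × Model n × CoModel n) →L[ℝ] (ℝ × Model n × CoModel n) :=
    ContinuousMap.evalCLM ℝ 1
  have hZ : ContDiffOn ℝ ∞ (fun w => Γ w 1) D₁ := ev.contDiff.comp_contDiffOn hsm₁
  have hZd := ev.hasFDerivAt.comp w₀ hdw
  let eZ : (ℝ × Model n × CoModel n) ≃L[ℝ] (ℝ × Model n × CoModel n) :=
    ContinuousLinearEquiv.equivOfInverse (ContinuousLinearMap.id ℝ _ + A)
      (ContinuousLinearMap.id ℝ _ - A) (fun v => by simp [hAB]) (fun v => by simp [hAB])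
  have hZd' : HasFDerivAt (fun w => Γ w 1)
      (eZ : (ℝ × Model n × CoModel n) →L[ℝ] (ℝ × Model n × CoModel n)) w₀ :=
    hZd.congr_fderiv (ContinuousLinearMap.ext hev)
  have hY : ContDiffOn ℝ ∞ (fun w => (w.1, (Γ w 1).2.1, w.2.1)) D₁ :=
    contDiff_fst.contDiffOn.prodMk ((contDiff_fst.comp_contDiffOn
      (contDiff_snd.comp_contDiffOn hZ)).prodMk contDiff_snd.fst.contDiffOn)
  have hYd : HasFDerivAt (fun w => (w.1, (Γ w 1).2.1, w.2.1)) _ w₀ :=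
    hasFDerivAt_fst.prodMk (hZd'.snd.fst.prodMk hasFDerivAt_snd.fst)
  let eYf : (ℝ × Model n × CoModel n) →L[ℝ] (ℝ × Model n × Model n) :=
    (ContinuousLinearMap.fst ℝ _ _).prod
      (((ContinuousLinearMap.fst ℝ _ _).comp (ContinuousLinearMap.snd ℝ _ _) +
        (B : CoModel n →L[ℝ] Model n).comp
          ((ContinuousLinearMap.snd ℝ _ _).comp (ContinuousLinearMap.snd ℝ _ _))).prod
        ((ContinuousLinearMap.fst ℝ _ _).comp (ContinuousLinearMap.snd ℝ _ _)))
  -- For the linearized motion x = y + Bη, the initial momentum with endpoints x and y is B⁻¹(x -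
  -- y).
  let eYi : (ℝ × Model n × Model n) →L[ℝ] (ℝ × Model n × CoModel n) :=
    (ContinuousLinearMap.fst ℝ _ _).prod
      (((ContinuousLinearMap.snd ℝ _ _).comp (ContinuousLinearMap.snd ℝ _ _)).prod
        ((B.symm : Model n →L[ℝ] CoModel n).comp
          ((ContinuousLinearMap.fst ℝ _ _).comp (ContinuousLinearMap.snd ℝ _ _) -
            (ContinuousLinearMap.snd ℝ _ _).comp (ContinuousLinearMap.snd ℝ _ _))))
  let eY : (ℝ × Model n × CoModel n) ≃L[ℝ] (ℝ × Model n × Model n) :=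
    ContinuousLinearEquiv.equivOfInverse eYf eYi (fun v => by simp [eYf, eYi])
      (fun v => by simp [eYf, eYi])
  have hYd' : HasFDerivAt (fun w => (w.1, (Γ w 1).2.1, w.2.1))
      (eY : (ℝ × Model n × CoModel n) →L[ℝ] (ℝ × Model n × Model n)) w₀ := by
    refine hYd.congr_fderiv (ContinuousLinearMap.ext fun v => ?_)
    change (v.1, (v + A v).2.1, v.2.1) = (v.1, v.2.1 + B v.2.2, v.2.1)
    rw [hAB]
    rfl
  obtain ⟨φ, hφw, hφs, hφ, hφi⟩ := exists_openPartialHomeomorph_contDiffOn hD₁ hZ hwD₁ hZd'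
  obtain ⟨ψ, hψw, hψs, hψ, hψi⟩ := exists_openPartialHomeomorph_contDiffOn hD₁ hY hwD₁ hYd'
  -- Both maps are restricted to one common domain, so that each is injective on all of it.
  have hD : IsOpen (φ.source ∩ ψ.source) := φ.open_source.inter ψ.open_source
  have hΓ : IsLocalFlow h hh D₁ Γ := ⟨hD₁, hsm₁, fun w hw => heq w hw.1⟩
  refine ⟨φ.source ∩ ψ.source, Γ, φ.restrOpen ψ.source ψ.open_source,
    ψ.restrOpen φ.source φ.open_source, ⟨hφw, hψw⟩, hΓ.mono hD (inter_subset_left.trans hφs),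
    fun w hw s => (hφs hw.1).2 (mem_univ s), rfl, hφ, hφi.mono ?_, inter_comm _ _, hψ,
    hψi.mono ?_⟩
  · exact fun z hz => hz.1
  · exact fun z hz => hz.1

end LocalFlowExistence

/-! ### Kinetic plus potential Hamiltonians on ℝ × ℝⁿ × (ℝⁿ)* -/

section KineticHamiltonian

variable {n : ℕ}

instance instNormedAddCommGroupCometric : NormedAddCommGroup (CoModel n →L[ℝ] Model n) :=
  ContinuousLinearMap.toNormedAddCommGroup

instance instNormedSpaceCometric : NormedSpace ℝ (CoModel n →L[ℝ] Model n) :=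
  ContinuousLinearMap.toNormedSpace

instance instNormedAddCommGroupDerivCometric :
    NormedAddCommGroup (Model n →L[ℝ] CoModel n →L[ℝ] Model n) :=
  ContinuousLinearMap.toNormedAddCommGroup

instance instNormedSpaceDerivCometric :
    NormedSpace ℝ (Model n →L[ℝ] CoModel n →L[ℝ] Model n) :=
  ContinuousLinearMap.toNormedSpace

/-- The Hamiltonian `ξ · B(x) ξ / 2 + t² U(x)` on `ℝ × ℝⁿ × (ℝⁿ)*`. -/
def kineticHamiltonian (B : Model n → CoModel n →L[ℝ] Model n) (U : Model n → ℝ)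
    (w : ℝ × Model n × CoModel n) : ℝ :=
  2⁻¹ * w.2.2 (B w.2.1 w.2.2) + w.1 ^ 2 * U w.2.1

instance instNormedAddCommGroupDerivCometricFlip :
    NormedAddCommGroup (CoModel n →L[ℝ] Model n →L[ℝ] Model n) :=
  ContinuousLinearMap.toNormedAddCommGroup

instance instNormedSpaceDerivCometricFlip :
    NormedSpace ℝ (CoModel n →L[ℝ] Model n →L[ℝ] Model n) :=
  ContinuousLinearMap.toNormedSpace

variable {B : Model n → CoModel n →L[ℝ] Model n} {U : Model n → ℝ}

theorem contDiff_kineticHamiltonian (hB : ContDiff ℝ ∞ B) (hU : ContDiff ℝ ∞ U) :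
    ContDiff ℝ ∞ (kineticHamiltonian B U) := by
  have hx : ContDiff ℝ ∞ (fun w : ℝ × Model n × CoModel n => w.2.1) := contDiff_snd.fst
  have hξ : ContDiff ℝ ∞ (fun w : ℝ × Model n × CoModel n => w.2.2) := contDiff_snd.snd
  exact (contDiff_const.mul (hξ.clm_apply ((hB.comp hx).clm_apply hξ))).add
    ((contDiff_fst.pow 2).mul (hU.comp hx))

/-- Symmetry of B merges the two ξ-derivatives of ½ ξ·B(x)ξ, so the velocity is B(x)ξ without a
factor. -/
theorem extendedField_kineticHamiltonian (hB : ContDiff ℝ ∞ B) (hU : ContDiff ℝ ∞ U)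
    (hs : ∀ (x : Model n) (ξ η : CoModel n), ξ (B x η) = η (B x ξ)) (w : ℝ × Model n × CoModel n) :
    extendedField (kineticHamiltonian B U) w = (0, B w.2.1 w.2.2,
      -((2 : ℝ)⁻¹ • w.2.2.comp ((fderiv ℝ B w.2.1).flip w.2.2) +
        w.1 ^ 2 • fderiv ℝ U w.2.1)) := by
  have hBd : HasFDerivAt B (fderiv ℝ B w.2.1) w.2.1 :=
    (hB.differentiable (by simp) _).hasFDerivAt
  have hUd : HasFDerivAt U (fderiv ℝ U w.2.1) w.2.1 :=
    (hU.differentiable (by simp) _).hasFDerivAt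
  have hx : HasFDerivAt (fun w : ℝ × Model n × CoModel n => w.2.1)
    ((ContinuousLinearMap.fst ℝ _ _).comp (ContinuousLinearMap.snd ℝ _ _)) w := hasFDerivAt_snd.fst
  have hξ : HasFDerivAt (fun w : ℝ × Model n × CoModel n => w.2.2)
    ((ContinuousLinearMap.snd ℝ _ _).comp (ContinuousLinearMap.snd ℝ _ _)) w := hasFDerivAt_snd.snd
  have hd := ((hξ.clm_apply ((hBd.comp w hx).clm_apply hξ)).const_mul (2 : ℝ)⁻¹).add
    (((hasFDerivAt_fst (𝕜 := ℝ) (p := w)).pow 2).mul (hUd.comp w hx))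
  have key : ∀ v : Model n × CoModel n, fderiv ℝ (kineticHamiltonian B U) w (0, v) =
      v.2 (B w.2.1 w.2.2) + (2 : ℝ)⁻¹ * w.2.2 (fderiv ℝ B w.2.1 v.1 w.2.2) +
        w.1 ^ 2 * fderiv ℝ U w.2.1 v.1 := by
    intro v
    have e : fderiv ℝ (kineticHamiltonian B U) w = _ := hd.fderiv
    rw [e]
    simp [hs w.2.1 w.2.2 v.2]
    ring
  refine Prod.ext rfl (eq_of_forall_symplecticForm fun v => ?_)
  rw [extendedField, symplecticForm_symplecticGrad]
  change -fderiv ℝ (kineticHamiltonian B U) w (0, v) = _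
  rw [key]
  simp [symplecticForm]
  ring

theorem lagrangian_kineticHamiltonian (hB : ContDiff ℝ ∞ B) (hU : ContDiff ℝ ∞ U)
    (hs : ∀ (x : Model n) (ξ η : CoModel n), ξ (B x η) = η (B x ξ)) (w : ℝ × Model n × CoModel n) :
    lagrangian (kineticHamiltonian B U) w =
      2⁻¹ * w.2.2 (B w.2.1 w.2.2) - w.1 ^ 2 * U w.2.1 := by
  rw [lagrangian, extendedField_kineticHamiltonian hB hU hs, kineticHamiltonian]
  ring

theorem extendedField_kineticHamiltonian_zero (hB : ContDiff ℝ ∞ B) (hU : ContDiff ℝ ∞ U)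
    (hs : ∀ (x : Model n) (ξ η : CoModel n), ξ (B x η) = η (B x ξ)) (x : Model n) :
    extendedField (kineticHamiltonian B U) (0, x, 0) = 0 := by
  rw [extendedField_kineticHamiltonian hB hU hs]
  simp

/-- At ξ = 0 and t = 0 the force is quadratic in ξ and in t, hence invisible to first order, and so
is the x-derivative of B(x)ξ. -/
theorem hasFDerivAt_extendedField_kineticHamiltonian (hB : ContDiff ℝ ∞ B)
    (hU : ContDiff ℝ ∞ U) (hs : ∀ (x : Model n) (ξ η : CoModel n), ξ (B x η) = η (B x ξ)) (x : Model n) :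
    ∃ A : (ℝ × Model n × CoModel n) →L[ℝ] (ℝ × Model n × CoModel n),
      HasFDerivAt (extendedField (kineticHamiltonian B U)) A (0, x, 0) ∧
      ∀ v, A v = (0, B x v.2.2, 0) := by
  let w : ℝ × Model n × CoModel n := (0, x, 0)
  have hBd : HasFDerivAt B (fderiv ℝ B w.2.1) w.2.1 :=
    (hB.differentiable (by simp) _).hasFDerivAt
  have hB2 : HasFDerivAt (fderiv ℝ B) (fderiv ℝ (fderiv ℝ B) w.2.1) w.2.1 :=
    ((hB.fderiv_right (m := ∞) (by simp)).differentiable (by simp) _).hasFDerivAt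
  have hU2 : HasFDerivAt (fderiv ℝ U) (fderiv ℝ (fderiv ℝ U) w.2.1) w.2.1 :=
    ((hU.fderiv_right (m := ∞) (by simp)).differentiable (by simp) _).hasFDerivAt
  have hx : HasFDerivAt (fun w : ℝ × Model n × CoModel n => w.2.1)
    ((ContinuousLinearMap.fst ℝ _ _).comp (ContinuousLinearMap.snd ℝ _ _)) w := hasFDerivAt_snd.fst
  have hξ : HasFDerivAt (fun w : ℝ × Model n × CoModel n => w.2.2)
    ((ContinuousLinearMap.snd ℝ _ _).comp (ContinuousLinearMap.snd ℝ _ _)) w := hasFDerivAt_snd.snd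
  have hfl : HasFDerivAt (fun w : ℝ × Model n × CoModel n => (fderiv ℝ B w.2.1).flip) _ w :=
    (ContinuousLinearMap.flipₗᵢ ℝ (Model n) (CoModel n)
      (Model n)).toContinuousLinearEquiv.hasFDerivAt.comp w (hB2.comp w hx)
  have hd := (hasFDerivAt_const (0 : ℝ) w).prodMk (((hBd.comp w hx).clm_apply hξ).prodMk
    (((hξ.clm_comp (hfl.clm_apply hξ)).const_smul (2 : ℝ)⁻¹).add
      (((hasFDerivAt_fst (𝕜 := ℝ) (p := w)).pow 2).smul (hU2.comp w hx))).neg)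
  refine ⟨_, hd.congr_of_eventuallyEq (Filter.Eventually.of_forall fun w' =>
    extendedField_kineticHamiltonian hB hU hs w'), fun v => ?_⟩
  refine Prod.ext rfl (Prod.ext ?_ ?_)
  · simp [w]
  · ext a
    simp [w]

end KineticHamiltonian

/-! ### Canonical coordinates on T*M and the Hamilton field in them -/

section CotangentCharts

variable {n : ℕ} {M : Type*} [TopologicalSpace M] [ChartedSpace (Model n) M]
  [IsManifold (𝓡 n) ∞ M]

/-- The canonical coordinates `(x, ξ)` on `T*M` induced by the preferred chart of `M` at `x₀`. -/
def coChart (n : ℕ) {M : Type*} [TopologicalSpace M] [ChartedSpace (Model n) M]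
    [IsManifold (𝓡 n) ∞ M] (x₀ : M) :
    PartialEquiv (CotangentBundle n M) (Model n × CoModel n) :=
  extChartAt (cotangentModel n) (⟨x₀, 0⟩ : CotangentBundle n M)

/-- The bundle chart depends on the base point alone. Hence the coordinates in which the Hamilton
field is defined at p are the canonical ones at its base point. -/
theorem extChartAt_eq_coChart (p : CotangentBundle n M) :
    extChartAt (cotangentModel n) p = coChart n p.proj := by
  rw [coChart, FiberBundle.extChartAt, FiberBundle.extChartAt]

/-- The differential of the preferred chart at `x₀`. -/
def chartDeriv (n : ℕ) {M : Type*} [TopologicalSpace M] [ChartedSpace (Model n) M]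
    (x₀ y : M) : TangentSpace (𝓡 n) y →L[ℝ] Model n :=
  mfderiv (𝓡 n) 𝓘(ℝ, Model n) (extChartAt (𝓡 n) x₀) y

theorem mem_coChart_source {x₀ : M} {p : CotangentBundle n M} :
    p ∈ (coChart n x₀).source ↔ p.proj ∈ (extChartAt (𝓡 n) x₀).source := by
  rw [coChart, FiberBundle.extChartAt]
  simp only [PartialEquiv.trans_source, mem_inter_iff, mem_preimage, PartialEquiv.prod_source,
    extChartAt_source]
  refine ⟨fun h => h.2.1, fun h => ⟨?_, h, trivial⟩⟩
  simpa using h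

theorem coChart_target (x₀ : M) :
    (coChart n x₀).target = (extChartAt (𝓡 n) x₀).target ×ˢ univ := by
  rw [coChart, FiberBundle.extChartAt_target]
  congr 1
  refine inter_eq_left.2 fun u hu => ?_
  have := (extChartAt (𝓡 n) x₀).map_target hu
  simpa using this

theorem coChart_fst (x₀ : M) (p : CotangentBundle n M) :
    (coChart n x₀ p).1 = extChartAt (𝓡 n) x₀ p.proj := by
  rw [coChart, FiberBundle.extChartAt]
  rfl

theorem coChart_snd (x₀ : M) (p : CotangentBundle n M) :
    (coChart n x₀ p).2 = ContinuousLinearMap.inCoordinates (Model n) (TangentSpace (𝓡 n)) ℝ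
      (Bundle.Trivial M ℝ) x₀ p.proj x₀ p.proj p.snd := by
  rw [coChart, FiberBundle.extChartAt]
  rfl

/-- The working description of fibre coordinates: ξ = Σ ξⱼ dxⱼ. As chart differentials are onto, it
determines the coordinates without unfolding trivializations. -/
theorem coChart_snd_comp {x₀ : M} {p : CotangentBundle n M} (hp : p ∈ (coChart n x₀).source) :
    (coChart n x₀ p).2.comp (chartDeriv n x₀ p.proj) = p.snd := by
  have hx : p.proj ∈ (extChartAt (𝓡 n) x₀).source := mem_coChart_source.1 hp
  have hb : p.proj ∈ (trivializationAt (Model n) (TangentSpace (𝓡 n)) x₀).baseSet := by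
    simpa using hx
  rw [coChart_snd]
  ext v
  have h1 : chartDeriv n x₀ p.proj =
      (trivializationAt (Model n) (TangentSpace (𝓡 n)) x₀).continuousLinearMapAt ℝ p.proj :=
    (TangentBundle.continuousLinearMapAt_trivializationAt (by simpa using hx)).symm
  rw [h1, ContinuousLinearMap.inCoordinates]
  have h2 := (trivializationAt (Model n) (TangentSpace (𝓡 n)) x₀).symmL_continuousLinearMapAt
    (R := ℝ) hb v
  change ((trivializationAt ℝ (Bundle.Trivial M ℝ) x₀).continuousLinearMapAt ℝ p.proj)
    (p.snd _) = _
  erw [h2]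
  simp

theorem isOpen_coChart_source (x₀ : M) : IsOpen (coChart n x₀).source :=
  isOpen_extChartAt_source _

theorem isOpen_coChart_target (x₀ : M) : IsOpen (coChart n x₀).target :=
  isOpen_extChartAt_target _

theorem contMDiffOn_coChart (x₀ : M) :
    ContMDiffOn (cotangentModel n) 𝓘(ℝ, Model n × CoModel n) ∞ (coChart n x₀)
      (coChart n x₀).source := by
  have h := contMDiffOn_extChartAt (I := cotangentModel n) (n := ∞)
    (x := (⟨x₀, 0⟩ : CotangentBundle n M))
  rw [← extChartAt_source (cotangentModel n)] at h
  exact h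

theorem contMDiffOn_coChart_symm (x₀ : M) :
    ContMDiffOn 𝓘(ℝ, Model n × CoModel n) (cotangentModel n) ∞ (coChart n x₀).symm
      (coChart n x₀).target :=
  contMDiffOn_extChartAt_symm _

theorem coChart_symm_proj {x₀ : M} {z : Model n × CoModel n} (hz : z ∈ (coChart n x₀).target) :
    ((coChart n x₀).symm z).proj = (extChartAt (𝓡 n) x₀).symm z.1 := by
  have h1 := mem_coChart_source.1 ((coChart n x₀).map_target hz)
  have h2 := coChart_fst x₀ ((coChart n x₀).symm z)
  rw [(coChart n x₀).right_inv hz] at h2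
  rw [h2, (extChartAt (𝓡 n) x₀).left_inv h1]

theorem hasMFDerivAt_chartDeriv {x₀ y : M} (hy : y ∈ (extChartAt (𝓡 n) x₀).source) :
    HasMFDerivAt (𝓡 n) 𝓘(ℝ, Model n) (extChartAt (𝓡 n) x₀) y (chartDeriv n x₀ y) :=
  (mdifferentiableAt_extChartAt (by simpa using hy)).hasMFDerivAt

theorem isInvertible_chartDeriv {x₀ y : M} (hy : y ∈ (extChartAt (𝓡 n) x₀).source) :
    (chartDeriv n x₀ y).IsInvertible :=
  isInvertible_mfderiv_extChartAt hy

theorem chartDeriv_surjective {x₀ y : M} (hy : y ∈ (extChartAt (𝓡 n) x₀).source) :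
    Function.Surjective (chartDeriv n x₀ y) := by
  obtain ⟨e, he⟩ := isInvertible_chartDeriv hy
  rw [← he]
  exact e.surjective

/-- The change of coordinates between two charts of `M`. -/
def coordChange (n : ℕ) {M : Type*} [TopologicalSpace M] [ChartedSpace (Model n) M] (x₀ x₁ : M) :
    Model n → Model n :=
  extChartAt (𝓡 n) x₁ ∘ (extChartAt (𝓡 n) x₀).symm

theorem contDiffAt_coordChange {x₀ x₁ y : M} (h₀ : y ∈ (extChartAt (𝓡 n) x₀).source)
    (h₁ : y ∈ (extChartAt (𝓡 n) x₁).source) :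
    ContDiffAt ℝ ∞ (coordChange n x₀ x₁) (extChartAt (𝓡 n) x₀ y) := by
  rw [← contMDiffAt_iff_contDiffAt]
  have ht := (extChartAt (𝓡 n) x₀).map_source h₀
  have a : ContMDiffAt (𝓡 n) 𝓘(ℝ, Model n) ∞ (extChartAt (𝓡 n) x₁)
      ((extChartAt (𝓡 n) x₀).symm (extChartAt (𝓡 n) x₀ y)) := by
    rw [(extChartAt (𝓡 n) x₀).left_inv h₀]
    exact contMDiffAt_extChartAt' (by simpa using h₁)
  exact a.comp _ ((contMDiffOn_extChartAt_symm x₀).contMDiffAt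
    ((isOpen_extChartAt_target x₀).mem_nhds ht))

theorem chartDeriv_eq {x₀ x₁ y : M} (h₀ : y ∈ (extChartAt (𝓡 n) x₀).source)
    (h₁ : y ∈ (extChartAt (𝓡 n) x₁).source) :
    chartDeriv n x₁ y = (fderiv ℝ (coordChange n x₀ x₁) (extChartAt (𝓡 n) x₀ y)).comp
      (chartDeriv n x₀ y) := by
  have h2 : HasMFDerivAt 𝓘(ℝ, Model n) 𝓘(ℝ, Model n) (coordChange n x₀ x₁)
      (extChartAt (𝓡 n) x₀ y) (fderiv ℝ (coordChange n x₀ x₁) (extChartAt (𝓡 n) x₀ y)) :=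
    ((contDiffAt_coordChange h₀ h₁).differentiableAt (by simp)).hasFDerivAt.hasMFDerivAt
  have h3 := h2.comp y (hasMFDerivAt_chartDeriv h₀)
  refine hasMFDerivAt_unique (hasMFDerivAt_chartDeriv h₁) (h3.congr_of_eventuallyEq ?_)
  filter_upwards [extChartAt_source_mem_nhds' h₀] with y' hy'
  simp only [coordChange, Function.comp_apply, (extChartAt (𝓡 n) x₀).left_inv hy']

theorem mdifferentiableAt_coChart {x₀ : M} {p : CotangentBundle n M}
    (hp : p ∈ (coChart n x₀).source) :
    MDifferentiableAt (cotangentModel n) 𝓘(ℝ, Model n × CoModel n) (coChart n x₀) p :=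
  ((contMDiffOn_coChart x₀).contMDiffAt
    ((isOpen_coChart_source x₀).mem_nhds hp)).mdifferentiableAt (by simp)

theorem mdifferentiableAt_coChart_symm {x₀ : M} {z : Model n × CoModel n}
    (hz : z ∈ (coChart n x₀).target) :
    MDifferentiableAt 𝓘(ℝ, Model n × CoModel n) (cotangentModel n) (coChart n x₀).symm z :=
  ((contMDiffOn_coChart_symm x₀).contMDiffAt
    ((isOpen_coChart_target x₀).mem_nhds hz)).mdifferentiableAt (by simp)

/-- The differential of the canonical coordinates, as an endomorphism of `ℝⁿ × (ℝⁿ)*`. -/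
def coChartDeriv (n : ℕ) {M : Type*} [TopologicalSpace M] [ChartedSpace (Model n) M]
    [IsManifold (𝓡 n) ∞ M] (x₀ : M) (p : CotangentBundle n M) :
    Model n × CoModel n →L[ℝ] Model n × CoModel n :=
  mfderiv (cotangentModel n) 𝓘(ℝ, Model n × CoModel n) (coChart n x₀) p

theorem hasMFDerivAt_coChart {x₀ : M} {p : CotangentBundle n M}
    (hp : p ∈ (coChart n x₀).source) :
    HasMFDerivAt (cotangentModel n) 𝓘(ℝ, Model n × CoModel n) (coChart n x₀) p
      (coChartDeriv n x₀ p) :=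
  (mdifferentiableAt_coChart hp).hasMFDerivAt

theorem coChartDeriv_eq_fderiv {x₀ : M} {p : CotangentBundle n M}
    (hp : p ∈ (coChart n x₀).source) :
    coChartDeriv n x₀ p =
      fderiv ℝ (coChart n x₀ ∘ (coChart n p.proj).symm) (coChart n p.proj p) := by
  rw [coChartDeriv, (mdifferentiableAt_coChart hp).mfderiv, ← extChartAt_eq_coChart p]
  have : range (cotangentModel n) = univ := ModelWithCorners.Boundaryless.range_eq_univ
  rw [this, fderivWithin_univ]
  rfl

theorem mem_coChart_source_self (p : CotangentBundle n M) : p ∈ (coChart n p.proj).source :=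
  mem_coChart_source.2 (mem_extChartAt_source _)

/-- Canonical coordinates are symplectic. -/
theorem symplecticForm_coChartDeriv {x₀ : M} {p : CotangentBundle n M}
    (hp : p ∈ (coChart n x₀).source) (u v : Model n × CoModel n) :
    symplecticForm (coChartDeriv n x₀ p u) (coChartDeriv n x₀ p v) = symplecticForm u v := by
  have hps := mem_coChart_source_self p
  have hz := (coChart n p.proj).map_source hps
  have hx := mem_coChart_source.1 hp
  have hx' := mem_coChart_source.1 hps
  have hinv := (coChart n p.proj).left_inv hps
  have hK : DifferentiableAt ℝ (coChart n x₀ ∘ (coChart n p.proj).symm) (coChart n p.proj p) := by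
    rw [← mdifferentiableAt_iff_differentiableAt]
    refine MDifferentiableAt.comp _ ?_ (mdifferentiableAt_coChart_symm hz)
    rw [hinv]
    exact mdifferentiableAt_coChart hp
  have hφ : ContDiffAt ℝ 2 (coordChange n p.proj x₀) (coChart n p.proj p).1 := by
    rw [coChart_fst]
    exact (contDiffAt_coordChange hx' hx).of_le ENat.LEInfty.out
  have hev : ∀ᶠ z' in 𝓝 (coChart n p.proj p), z' ∈ (coChart n p.proj).target ∧
      (coChart n p.proj).symm z' ∈ (coChart n x₀).source := by
    refine Filter.Eventually.and ((isOpen_coChart_target _).mem_nhds hz) ?_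
    have hc := (mdifferentiableAt_coChart_symm hz).continuousAt
    refine hc.eventually ((isOpen_coChart_source x₀).mem_nhds ?_)
    rwa [hinv]
  rw [coChartDeriv_eq_fderiv hp]
  refine symplecticForm_fderiv_of_lift hφ hK (hev.mono fun z' hz' => ?_)
    (hev.mono fun z' hz' => ?_) u v
  · simp only [Function.comp_apply, coChart_fst, coordChange]
    rw [coChart_symm_proj hz'.1]
  · set q := (coChart n p.proj).symm z' with hq
    have hqs : q ∈ (coChart n p.proj).source := (coChart n p.proj).map_target hz'.1
    have hqz : coChart n p.proj q = z' := (coChart n p.proj).right_inv hz'.1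
    -- Both coordinate pairs represent the same covector, so the chain rule for the chart
    -- differentials gives the lift relation.
    have e1 := coChart_snd_comp hqs
    have e2 := coChart_snd_comp hz'.2
    have hq1 := mem_coChart_source.1 hqs
    have hq2 := mem_coChart_source.1 hz'.2
    rw [chartDeriv_eq hq1 hq2, ← coChart_fst, hqz] at e2
    rw [hqz] at e1
    ext b
    obtain ⟨v, rfl⟩ := chartDeriv_surjective hq1 b
    exact congrArg (fun L => L v) (e2.trans e1.symm)

theorem coChartDeriv_surjective {x₀ : M} {p : CotangentBundle n M}
    (hp : p ∈ (coChart n x₀).source) : Function.Surjective (coChartDeriv n x₀ p) := by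
  have h := isInvertible_mfderiv_extChartAt (I := cotangentModel n) hp
  obtain ⟨e, he⟩ := h
  intro v
  obtain ⟨u, hu⟩ := e.surjective v
  exact ⟨u, (congrArg (fun L => L u) he.symm).trans hu⟩

/-- A Hamiltonian in canonical coordinates. -/
def localHamiltonian (H : CotangentBundle n M → ℝ) (x₀ : M) : Model n × CoModel n → ℝ :=
  H ∘ (coChart n x₀).symm

theorem differentiableAt_localHamiltonian {H : CotangentBundle n M → ℝ} {x₀ : M}
    {p : CotangentBundle n M} (hp : p ∈ (coChart n x₀).source)
    (hH : MDifferentiableAt (cotangentModel n) 𝓘(ℝ, ℝ) H p) :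
    DifferentiableAt ℝ (localHamiltonian H x₀) (coChart n x₀ p) := by
  rw [← mdifferentiableAt_iff_differentiableAt]
  refine MDifferentiableAt.comp _ ?_
    (mdifferentiableAt_coChart_symm ((coChart n x₀).map_source hp))
  rwa [(coChart n x₀).left_inv hp]

theorem hamiltonField_eq_symplecticGrad {H : CotangentBundle n M → ℝ} {p : CotangentBundle n M}
    {L : Model n × CoModel n →L[ℝ] ℝ} (h : HasMFDerivAt (cotangentModel n) 𝓘(ℝ, ℝ) H p L) :
    (hamiltonField H p : Model n × CoModel n) = symplecticGrad n L :=
  congrArg (symplecticGrad n) h.mfderiv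

/-- The Hamilton vector field in canonical coordinates. -/
theorem coChartDeriv_hamiltonField {H : CotangentBundle n M → ℝ} {x₀ : M}
    {p : CotangentBundle n M} (hp : p ∈ (coChart n x₀).source)
    (hH : MDifferentiableAt (cotangentModel n) 𝓘(ℝ, ℝ) H p) :
    coChartDeriv n x₀ p (hamiltonField H p) =
      symplecticGrad n (fderiv ℝ (localHamiltonian H x₀) (coChart n x₀ p)) := by
  have h1 : HasMFDerivAt 𝓘(ℝ, Model n × CoModel n) 𝓘(ℝ, ℝ) (localHamiltonian H x₀)
      (coChart n x₀ p) (fderiv ℝ (localHamiltonian H x₀) (coChart n x₀ p)) :=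
    (differentiableAt_localHamiltonian hp hH).hasFDerivAt.hasMFDerivAt
  have h2 := h1.comp p (hasMFDerivAt_coChart hp)
  have h3 : HasMFDerivAt (cotangentModel n) 𝓘(ℝ, ℝ) H p
      ((fderiv ℝ (localHamiltonian H x₀) (coChart n x₀ p)).comp (coChartDeriv n x₀ p)) := by
    refine h2.congr_of_eventuallyEq ?_
    filter_upwards [(isOpen_coChart_source x₀).mem_nhds hp] with q hq
    simp [localHamiltonian, (coChart n x₀).left_inv hq]
  exact (congrArg (coChartDeriv n x₀ p) (hamiltonField_eq_symplecticGrad h3)).trans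
    (apply_symplecticGrad (symplecticForm_coChartDeriv hp) (coChartDeriv_surjective hp) _)

/-- Turns integral curves on T*M into solutions of an ODE in any canonical chart, not just the one
at the moving point. The companion below goes back from the ODE to the manifold. -/
theorem hasDerivWithinAt_coChart_comp {H : CotangentBundle n M → ℝ} {x₀ : M}
    {c : ℝ → CotangentBundle n M} {S : Set ℝ} {r : ℝ} (hp : c r ∈ (coChart n x₀).source)
    (hH : MDifferentiableAt (cotangentModel n) 𝓘(ℝ, ℝ) H (c r))
    (hc : HasMFDerivWithinAt 𝓘(ℝ, ℝ) (cotangentModel n) c S r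
      ((1 : ℝ →L[ℝ] ℝ).smulRight (hamiltonField H (c r)))) :
    HasDerivWithinAt (coChart n x₀ ∘ c)
      (symplecticGrad n (fderiv ℝ (localHamiltonian H x₀) (coChart n x₀ (c r)))) S r := by
  have h1 : HasFDerivWithinAt (coChart n x₀ ∘ c) ((coChartDeriv n x₀ (c r)).comp
      ((1 : ℝ →L[ℝ] ℝ).smulRight (hamiltonField H (c r) : Model n × CoModel n))) S r :=
    ((hasMFDerivAt_coChart hp).comp_hasMFDerivWithinAt r hc).hasFDerivWithinAt
  refine h1.hasDerivWithinAt.congr_deriv ?_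
  rw [← coChartDeriv_hamiltonField hp hH]
  exact congrArg (coChartDeriv n x₀ (c r)) (one_smul ℝ (hamiltonField H (c r) : Model n × CoModel n))

theorem hasMFDerivWithinAt_coChart_symm_comp {H : CotangentBundle n M → ℝ} {x₀ : M}
    {z : ℝ → Model n × CoModel n} {S : Set ℝ} {r : ℝ} (hz : z r ∈ (coChart n x₀).target)
    (hH : MDifferentiableAt (cotangentModel n) 𝓘(ℝ, ℝ) H ((coChart n x₀).symm (z r)))
    (hd : HasDerivWithinAt z (symplecticGrad n (fderiv ℝ (localHamiltonian H x₀) (z r))) S r) :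
    HasMFDerivWithinAt 𝓘(ℝ, ℝ) (cotangentModel n) ((coChart n x₀).symm ∘ z) S r
      ((1 : ℝ →L[ℝ] ℝ).smulRight (hamiltonField H ((coChart n x₀).symm (z r)))) := by
  set p := (coChart n x₀).symm (z r) with hp
  have hps : p ∈ (coChart n x₀).source := (coChart n x₀).map_target hz
  have hpz : coChart n x₀ p = z r := (coChart n x₀).right_inv hz
  let L : Model n × CoModel n →L[ℝ] Model n × CoModel n :=
    mfderiv 𝓘(ℝ, Model n × CoModel n) (cotangentModel n) (coChart n x₀).symm (z r)
  have h1 : HasMFDerivAt 𝓘(ℝ, Model n × CoModel n) (cotangentModel n) (coChart n x₀).symm (z r) L :=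
    (mdifferentiableAt_coChart_symm hz).hasMFDerivAt
  have h2 := h1.comp_hasMFDerivWithinAt r hd.hasFDerivWithinAt.hasMFDerivWithinAt
  rw [← hpz] at h1
  have h3 := h1.comp p (hasMFDerivAt_coChart hps)
  have h4 := (hasMFDerivAt_id (I := cotangentModel n) p).congr_of_eventuallyEq
    (f₁ := (coChart n x₀).symm ∘ coChart n x₀) (by
      filter_upwards [(isOpen_coChart_source x₀).mem_nhds hps] with q hq
      exact (coChart n x₀).left_inv hq)
  -- The differentials of the chart and of its inverse cancel, so L sends the Hamiltonian vector in
  -- coordinates back to the field at p.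
  have h5 : L.comp (coChartDeriv n x₀ p) = ContinuousLinearMap.id ℝ (Model n × CoModel n) :=
    hasMFDerivAt_unique h3 h4
  have h6 : L (symplecticGrad n (fderiv ℝ (localHamiltonian H x₀) (z r))) = hamiltonField H p := by
    rw [← hpz, ← coChartDeriv_hamiltonField hps hH]
    exact congrArg (fun L => L (hamiltonField H p : Model n × CoModel n)) h5
  have h7 : L.comp (ContinuousLinearMap.toSpanSingleton ℝ
      (symplecticGrad n (fderiv ℝ (localHamiltonian H x₀) (z r)))) =
      (1 : ℝ →L[ℝ] ℝ).smulRight (hamiltonField H p : Model n × CoModel n) := by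
    ext1
    exact (congrArg L (one_smul ℝ _)).trans
      (h6.trans (one_smul ℝ (hamiltonField H p : Model n × CoModel n)).symm)
  exact h2.congr_mfderiv h7

end CotangentCharts

/-! ### The metric, its inverse and the covector norm in coordinates -/

section MetricInCoordinates

variable {n : ℕ} {M : Type*} [TopologicalSpace M] [ChartedSpace (Model n) M]
  [IsManifold (𝓡 n) ∞ M]

instance instNormedAddCommGroupMetric : NormedAddCommGroup (Model n →L[ℝ] CoModel n) :=
  ContinuousLinearMap.toNormedAddCommGroup

instance instNormedSpaceMetric : NormedSpace ℝ (Model n →L[ℝ] CoModel n) :=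
  ContinuousLinearMap.toNormedSpace

/-- The metric tensor at `y` in the coordinates given by the chart at `x₀`. -/
def metricCoord (g : SmoothMetric n M) (x₀ y : M) : Model n →L[ℝ] CoModel n :=
  ContinuousLinearMap.inCoordinates (Model n) (TangentSpace (𝓡 n)) (CoModel n)
    (fun x : M => CotangentSpace n x) x₀ y x₀ y (g.inner y)

set_option synthInstance.maxHeartbeats 200000 in
theorem contMDiffOn_metricCoord (g : SmoothMetric n M) (x₀ : M) :
    ContMDiffOn (𝓡 n) 𝓘(ℝ, Model n →L[ℝ] CoModel n) ∞ (metricCoord g x₀)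
      (extChartAt (𝓡 n) x₀).source := by
  intro y hy
  have hb : y ∈ (trivializationAt (Model n →L[ℝ] CoModel n)
      (fun x : M => TangentSpace (𝓡 n) x →L[ℝ] CotangentSpace n x) x₀).baseSet := by
    simpa using hy
  exact ((Trivialization.contMDiffAt_section_iff _ hb).1
    g.contMDiff.contMDiffAt).contMDiffWithinAt

theorem metricCoord_chartDeriv (g : SmoothMetric n M) {x₀ y : M}
    (hy : y ∈ (extChartAt (𝓡 n) x₀).source) (v w : TangentSpace (𝓡 n) y) :
    metricCoord g x₀ y (chartDeriv n x₀ y v) (chartDeriv n x₀ y w) = g.inner y v w := by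
  have hb : y ∈ (trivializationAt (Model n) (TangentSpace (𝓡 n)) x₀).baseSet := by
    simpa using hy
  have h1 : chartDeriv n x₀ y =
      (trivializationAt (Model n) (TangentSpace (𝓡 n)) x₀).continuousLinearMapAt ℝ y :=
    (TangentBundle.continuousLinearMapAt_trivializationAt (by simpa using hy)).symm
  have h2 : ∀ v, (trivializationAt (Model n) (TangentSpace (𝓡 n)) x₀).symm y
      (chartDeriv n x₀ y v) = v := fun v => by
    rw [h1, ← Trivialization.symmL_apply (R := ℝ) _ hb]
    exact (trivializationAt (Model n) (TangentSpace (𝓡 n)) x₀).symmL_continuousLinearMapAt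
      (R := ℝ) hb v
  refine (inCoordinates_apply_eq₂ (E₃ := Bundle.Trivial M ℝ) hb hb (by simp)).trans ?_
  erw [h2, h2]
  simp

theorem metricCoord_symm (g : SmoothMetric n M) {x₀ y : M}
    (hy : y ∈ (extChartAt (𝓡 n) x₀).source) (a b : Model n) :
    metricCoord g x₀ y a b = metricCoord g x₀ y b a := by
  obtain ⟨v, rfl⟩ := chartDeriv_surjective hy a
  obtain ⟨w, rfl⟩ := chartDeriv_surjective hy b
  rw [metricCoord_chartDeriv g hy, metricCoord_chartDeriv g hy, g.symm]

theorem isInvertible_metricCoord (g : SmoothMetric n M) {x₀ y : M}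
    (hy : y ∈ (extChartAt (𝓡 n) x₀).source) : (metricCoord g x₀ y).IsInvertible := by
  have hB : Function.Injective (metricCoord g x₀ y : Model n →ₗ[ℝ] CoModel n) := by
    refine (injective_iff_map_eq_zero _).2 fun a ha => ?_
    obtain ⟨v, rfl⟩ := chartDeriv_surjective hy a
    by_contra hne
    have hv : v ≠ 0 := fun h => hne (by rw [h, map_zero])
    have h := g.pos y v hv
    rw [← metricCoord_chartDeriv g hy] at h
    have h0 : metricCoord g x₀ y (chartDeriv n x₀ y v) = 0 := ha
    rw [h0] at h
    exact lt_irrefl _ h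
  have hdim : Module.finrank ℝ (Model n) = Module.finrank ℝ (CoModel n) := by
    rw [← (LinearMap.toContinuousLinearMap (𝕜 := ℝ) (E := Model n) (F' := ℝ)).finrank_eq]
    exact (Subspace.dual_finrank_eq (K := ℝ) (V := Model n)).symm
  exact ⟨(LinearEquiv.ofInjectiveOfFinrankEq (metricCoord g x₀ y : Model n →ₗ[ℝ] CoModel n) hB
    hdim).toContinuousLinearEquiv, ContinuousLinearMap.ext fun _ => rfl⟩

/-- The inverse metric tensor in the coordinates given by the chart at `x₀`. -/
def cometric (g : SmoothMetric n M) (x₀ : M) (u : Model n) : CoModel n →L[ℝ] Model n :=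
  (metricCoord g x₀ ((extChartAt (𝓡 n) x₀).symm u)).inverse

theorem contDiffOn_cometric (g : SmoothMetric n M) (x₀ : M) :
    ContDiffOn ℝ ∞ (cometric g x₀) (extChartAt (𝓡 n) x₀).target := by
  intro u hu
  have hy := (extChartAt (𝓡 n) x₀).map_target hu
  obtain ⟨e, he⟩ := isInvertible_metricCoord g hy
  have h1 : ContDiffOn ℝ ∞ (metricCoord g x₀ ∘ (extChartAt (𝓡 n) x₀).symm)
      (extChartAt (𝓡 n) x₀).target := by
    rw [← contMDiffOn_iff_contDiffOn]
    exact (contMDiffOn_metricCoord g x₀).comp (contMDiffOn_extChartAt_symm x₀)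
      fun u hu => (extChartAt (𝓡 n) x₀).map_target hu
  have h2 : ContDiffAt ℝ ∞ ContinuousLinearMap.inverse
      ((metricCoord g x₀ ∘ (extChartAt (𝓡 n) x₀).symm) u) := by
    rw [Function.comp_apply, ← he]
    exact contDiffAt_map_inverse e
  exact h2.comp_contDiffWithinAt u (h1 u hu)

theorem metricCoord_cometric (g : SmoothMetric n M) {x₀ : M} {u : Model n}
    (hu : u ∈ (extChartAt (𝓡 n) x₀).target) (ξ : CoModel n) :
    metricCoord g x₀ ((extChartAt (𝓡 n) x₀).symm u) (cometric g x₀ u ξ) = ξ := by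
  obtain ⟨e, he⟩ := isInvertible_metricCoord g ((extChartAt (𝓡 n) x₀).map_target hu)
  rw [cometric, ← he, ContinuousLinearMap.inverse_equiv]
  exact e.apply_symm_apply ξ

theorem cometric_metricCoord (g : SmoothMetric n M) {x₀ y : M}
    (hy : y ∈ (extChartAt (𝓡 n) x₀).source) (a : Model n) :
    cometric g x₀ (extChartAt (𝓡 n) x₀ y) (metricCoord g x₀ y a) = a := by
  obtain ⟨e, he⟩ := isInvertible_metricCoord g hy
  rw [cometric, (extChartAt (𝓡 n) x₀).left_inv hy, ← he, ContinuousLinearMap.inverse_equiv]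
  exact e.symm_apply_apply a

theorem cometric_symm (g : SmoothMetric n M) {x₀ : M} {u : Model n}
    (hu : u ∈ (extChartAt (𝓡 n) x₀).target) (ξ η : CoModel n) :
    ξ (cometric g x₀ u η) = η (cometric g x₀ u ξ) := by
  have h1 := metricCoord_cometric g hu ξ
  have h2 := metricCoord_cometric g hu η
  conv_lhs => rw [← h1]
  conv_rhs => rw [← h2]
  exact metricCoord_symm g ((extChartAt (𝓡 n) x₀).map_target hu) _ _

theorem cometric_pos (g : SmoothMetric n M) {x₀ : M} {u : Model n}
    (hu : u ∈ (extChartAt (𝓡 n) x₀).target) {ξ : CoModel n} (hξ : ξ ≠ 0) :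
    0 < ξ (cometric g x₀ u ξ) := by
  have h1 := metricCoord_cometric g hu ξ
  have hy := (extChartAt (𝓡 n) x₀).map_target hu
  obtain ⟨v, hv⟩ := chartDeriv_surjective hy (cometric g x₀ u ξ)
  have hv0 : v ≠ 0 := by
    rintro rfl
    rw [map_zero] at hv
    rw [← hv, map_zero] at h1
    exact hξ h1.symm
  have := g.pos _ v hv0
  rw [← metricCoord_chartDeriv g hy, hv, h1] at this
  exact this

/-- Applying the metric tensor to both sides yields the same covector, and that tensor is injective.
Raising an index thus becomes the inverse metric tensor in coordinates. -/
theorem chartDeriv_sharp (g : SmoothMetric n M) {x₀ : M} {p : CotangentBundle n M}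
    (hp : p ∈ (coChart n x₀).source) :
    chartDeriv n x₀ p.proj (sharp g p.proj p.snd) =
      cometric g x₀ (coChart n x₀ p).1 (coChart n x₀ p).2 := by
  have hy := mem_coChart_source.1 hp
  rw [coChart_fst, ← cometric_metricCoord g hy (chartDeriv n x₀ p.proj (sharp g p.proj p.snd))]
  congr 1
  ext a
  obtain ⟨w, rfl⟩ := chartDeriv_surjective hy a
  rw [metricCoord_chartDeriv g hy, inner_sharp]
  exact congrArg (fun L => L w) (coChart_snd_comp hp).symm

theorem covectorNormSq_eq (g : SmoothMetric n M) {x₀ : M} {p : CotangentBundle n M}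
    (hp : p ∈ (coChart n x₀).source) :
    covectorNormSq g p = (coChart n x₀ p).2
      (cometric g x₀ (coChart n x₀ p).1 (coChart n x₀ p).2) := by
  rw [← chartDeriv_sharp g hp, covectorNormSq]
  exact congrArg (fun L => L (sharp g p.proj p.snd)) (coChart_snd_comp hp).symm

theorem contMDiff_covectorNormSq (g : SmoothMetric n M) :
    ContMDiff (cotangentModel n) 𝓘(ℝ, ℝ) ∞ (covectorNormSq g) := by
  intro p
  have hp := mem_coChart_source_self p
  have h1 : ContDiffOn ℝ ∞ (fun z : Model n × CoModel n => z.2 (cometric g p.proj z.1 z.2))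
      (coChart n p.proj).target := by
    have h2 : ContDiffOn ℝ ∞ (fun z : Model n × CoModel n => cometric g p.proj z.1)
        (coChart n p.proj).target :=
      (contDiffOn_cometric g p.proj).comp contDiff_fst.contDiffOn fun z hz => by
        rw [coChart_target] at hz
        exact hz.1
    exact contDiff_snd.contDiffOn.clm_apply (h2.clm_apply contDiff_snd.contDiffOn)
  have h3 : ContMDiffOn (cotangentModel n) 𝓘(ℝ, ℝ) ∞ _ (coChart n p.proj).source :=
    h1.contMDiffOn.comp (contMDiffOn_coChart p.proj) fun q hq => (coChart n p.proj).map_source hq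
  refine ((h3.congr fun q hq => ?_) p hp).contMDiffAt
    ((isOpen_coChart_source p.proj).mem_nhds hp)
  exact covectorNormSq_eq g hq

theorem continuous_covectorNorm (g : SmoothMetric n M) : Continuous (covectorNorm g) :=
  Real.continuous_sqrt.comp (contMDiff_covectorNormSq g).continuous

theorem isOpen_lowMomentum (g : SmoothMetric n M) (μ : ℝ) : IsOpen (lowMomentum g μ) :=
  isOpen_lt (continuous_covectorNorm g) continuous_const

theorem contMDiff_scaledHamiltonian (g : SmoothMetric n M) {V : M → ℝ}
    (hV : ContMDiff (𝓡 n) 𝓘(ℝ, ℝ) ∞ V) (t : ℝ) :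
    ContMDiff (cotangentModel n) 𝓘(ℝ, ℝ) ∞ (scaledHamiltonian g V t) := by
  have h1 : ContMDiff (cotangentModel n) 𝓘(ℝ, ℝ) ∞
      (fun p : CotangentBundle n M => V p.proj) := hV.comp (contMDiff_proj _)
  have h2 : ContDiff ℝ ∞ (fun z : ℝ × ℝ => z.1 / 2 + t ^ 2 * z.2) :=
    (contDiff_fst.div_const 2).add (contDiff_const.mul contDiff_snd)
  exact h2.contMDiff.comp ((contMDiff_covectorNormSq g).prodMk_space h1)

theorem contMDiff_hamiltonian (g : SmoothMetric n M) {V : M → ℝ}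
    (hV : ContMDiff (𝓡 n) 𝓘(ℝ, ℝ) ∞ V) :
    ContMDiff (cotangentModel n) 𝓘(ℝ, ℝ) ∞ (hamiltonian g V) := by
  have h := contMDiff_scaledHamiltonian g hV 1
  have : scaledHamiltonian g V 1 = hamiltonian g V := by
    ext p
    simp [scaledHamiltonian, hamiltonian]
  rwa [this] at h

end MetricInCoordinates

/-! ### Smooth cutoffs -/

section Cutoff

variable {E F : Type*} [NormedAddCommGroup E] [NormedSpace ℝ E] [FiniteDimensional ℝ E]
  [NormedAddCommGroup F] [NormedSpace ℝ F]

theorem exists_contDiff_cutoff {s : Set E} (hs : IsOpen s) {a : E} (ha : a ∈ s) :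
    ∃ χ : E → ℝ, ContDiff ℝ ∞ χ ∧ χ =ᶠ[𝓝 a] 1 ∧ tsupport χ ⊆ s := by
  obtain ⟨r, hr, hrs⟩ := Metric.isOpen_iff.1 hs a ha
  let χ : ContDiffBump a := ⟨r / 4, r / 2, by positivity, by linarith⟩
  refine ⟨χ, χ.contDiff, χ.eventuallyEq_one, ?_⟩
  rw [χ.tsupport_eq]
  exact (Metric.closedBall_subset_ball (by change r / 2 < r; linarith)).trans hrs

omit [FiniteDimensional ℝ E] in
theorem contDiff_cutoff_smul {s : Set E} (hs : IsOpen s) {χ : E → ℝ} (hχ : ContDiff ℝ ∞ χ)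
    (hsupp : tsupport χ ⊆ s) {f : E → F} (hf : ContDiffOn ℝ ∞ f s) :
    ContDiff ℝ ∞ (fun x => χ x • f x) := by
  refine contDiff_iff_contDiffAt.2 fun x => ?_
  by_cases hx : x ∈ tsupport χ
  · exact hχ.contDiffAt.smul (hf.contDiffAt (hs.mem_nhds (hsupp hx)))
  · refine (contDiffAt_const (c := (0 : F))).congr_of_eventuallyEq ?_
    filter_upwards [(isClosed_tsupport χ).isOpen_compl.mem_nhds hx] with y hy
    rw [image_eq_zero_of_notMem_tsupport hy, zero_smul]

end Cutoff

/-! ### Global extension of the Hamiltonian read in one chart -/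

section LocalHamiltonian

variable {n : ℕ} {M : Type*} [TopologicalSpace M] [ChartedSpace (Model n) M]
  [IsManifold (𝓡 n) ∞ M]

/-- Near `x₀`, the scaled Hamiltonian in canonical coordinates agrees with a globally defined
smooth Hamiltonian. -/
theorem exists_kineticHamiltonian (g : SmoothMetric n M) {V : M → ℝ}
    (hV : ContMDiff (𝓡 n) 𝓘(ℝ, ℝ) ∞ V) (x₀ : M) :
    ∃ (B : Model n → CoModel n →L[ℝ] Model n) (U : Model n → ℝ) (O : Set (Model n)),
      ContDiff ℝ ∞ B ∧ ContDiff ℝ ∞ U ∧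
      (∀ (x : Model n) (ξ η : CoModel n), ξ (B x η) = η (B x ξ)) ∧
      IsOpen O ∧ extChartAt (𝓡 n) x₀ x₀ ∈ O ∧ O ⊆ (extChartAt (𝓡 n) x₀).target ∧
      (∀ x ∈ O, B x = cometric g x₀ x) ∧
      ∀ x ∈ O, U x = V ((extChartAt (𝓡 n) x₀).symm x) := by
  have ho := isOpen_extChartAt_target (I := 𝓡 n) x₀
  obtain ⟨χ, hχ, hχ1, hsupp⟩ := exists_contDiff_cutoff ho (mem_extChartAt_target (I := 𝓡 n) x₀)
  have hVc : ContDiffOn ℝ ∞ (V ∘ (extChartAt (𝓡 n) x₀).symm) (extChartAt (𝓡 n) x₀).target := by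
    rw [← contMDiffOn_iff_contDiffOn]
    exact hV.comp_contMDiffOn (contMDiffOn_extChartAt_symm x₀)
  obtain ⟨O, hO1, hO, hxO⟩ := mem_nhds_iff.1 hχ1
  refine ⟨_, _, O ∩ (extChartAt (𝓡 n) x₀).target,
    contDiff_cutoff_smul ho hχ hsupp (contDiffOn_cometric g x₀),
    contDiff_cutoff_smul ho hχ hsupp hVc, fun x ξ η => ?_, hO.inter ho,
    ⟨hxO, mem_extChartAt_target x₀⟩, inter_subset_right, fun x hx => ?_, fun x hx => ?_⟩
  -- Multiplying by the cutoff keeps symmetry, and off the chart the product vanishes, so symmetry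
  -- holds on all of ℝⁿ.
  · by_cases hx : x ∈ (extChartAt (𝓡 n) x₀).target
    · simp [cometric_symm g hx ξ η]
    · have : χ x = 0 := image_eq_zero_of_notMem_tsupport fun h => hx (hsupp h)
      simp [this]
  · have : χ x = 1 := hO1 hx.1
    simp [this]
  · have : χ x = 1 := hO1 hx.1
    simp [this]

theorem localHamiltonian_scaledHamiltonian (g : SmoothMetric n M) (V : M → ℝ) {x₀ : M}
    {B : Model n → CoModel n →L[ℝ] Model n} {U : Model n → ℝ} (t : ℝ) {z : Model n × CoModel n}
    (hz : z.1 ∈ (extChartAt (𝓡 n) x₀).target) (hB : B z.1 = cometric g x₀ z.1)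
    (hU : U z.1 = V ((extChartAt (𝓡 n) x₀).symm z.1)) :
    localHamiltonian (scaledHamiltonian g V t) x₀ z = kineticHamiltonian B U (t, z) := by
  have hzt : z ∈ (coChart n x₀).target := by
    rw [coChart_target]
    exact ⟨hz, trivial⟩
  rw [localHamiltonian, Function.comp_apply, scaledHamiltonian,
    covectorNormSq_eq g ((coChart n x₀).map_target hzt), (coChart n x₀).right_inv hzt,
    coChart_symm_proj hzt, kineticHamiltonian, hB, hU]
  ring

/-- The two Hamiltonians agree on an open set, so their differentials, and with them their
Hamiltonian vectors, agree there. -/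
theorem symplecticGrad_localHamiltonian (g : SmoothMetric n M) (V : M → ℝ) {x₀ : M}
    {B : Model n → CoModel n →L[ℝ] Model n} {U : Model n → ℝ} (hBs : ContDiff ℝ ∞ B)
    (hUs : ContDiff ℝ ∞ U) {O : Set (Model n)} (hO : IsOpen O)
    (hOt : O ⊆ (extChartAt (𝓡 n) x₀).target) (hB : ∀ x ∈ O, B x = cometric g x₀ x)
    (hU : ∀ x ∈ O, U x = V ((extChartAt (𝓡 n) x₀).symm x)) (t : ℝ) {z : Model n × CoModel n}
    (hz : z.1 ∈ O) :
    symplecticGrad n (fderiv ℝ (localHamiltonian (scaledHamiltonian g V t) x₀) z) =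
      (extendedField (kineticHamiltonian B U) (t, z)).2 := by
  have hk : HasFDerivAt (kineticHamiltonian B U) (fderiv ℝ (kineticHamiltonian B U) (t, z))
      (t, z) :=
    ((contDiff_kineticHamiltonian hBs hUs).differentiable (by simp) _).hasFDerivAt
  have h1 := hk.comp z (hasFDerivAt_prodMk_right t z)
  have h2 := h1.congr_of_eventuallyEq (f₁ := localHamiltonian (scaledHamiltonian g V t) x₀) (by
    filter_upwards [(hO.preimage continuous_fst).mem_nhds hz] with z' hz'
    exact localHamiltonian_scaledHamiltonian g V t (hOt hz') (hB _ hz') (hU _ hz'))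
  rw [h2.fderiv]
  rfl

end LocalHamiltonian

/-! ### Uniqueness of classical paths -/

section Uniqueness

variable {n : ℕ} {M : Type*} [TopologicalSpace M] [ChartedSpace (Model n) M]
  [IsManifold (𝓡 n) ∞ M]

theorem t2Space_cotangentBundle [T2Space M] : T2Space (CotangentBundle n M) := by
  refine ⟨fun p q hpq => ?_⟩
  by_cases h : p.proj = q.proj
  · have hp := mem_coChart_source_self p
    have hq : q ∈ (coChart n p.proj).source := by
      rw [h]
      exact mem_coChart_source_self q
    have hne : coChart n p.proj p ≠ coChart n p.proj q := fun e =>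
      hpq ((coChart n p.proj).injOn hp hq e)
    have hc := (contMDiffOn_coChart (n := n) p.proj).continuousOn
    have ho := isOpen_coChart_source (n := n) p.proj
    obtain ⟨u, v, hu, hv, hpu, hqv, huv⟩ := t2_separation hne
    exact ⟨_, _, hc.isOpen_inter_preimage ho hu, hc.isOpen_inter_preimage ho hv, ⟨hp, hpu⟩,
      ⟨hq, hqv⟩, (huv.preimage _).mono inter_subset_right inter_subset_right⟩
  · obtain ⟨u, v, hu, hv, hpu, hqv, huv⟩ := t2_separation h
    have hc : Continuous (fun p : CotangentBundle n M => p.proj) :=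
      FiberBundle.continuous_proj (CoModel n) (fun x : M => CotangentSpace n x)
    exact ⟨_, _, hu.preimage hc, hv.preimage hc, hpu, hqv, huv.preimage _⟩

theorem contDiffOn_symplecticGrad_localHamiltonian {H : CotangentBundle n M → ℝ}
    (hH : ContMDiff (cotangentModel n) 𝓘(ℝ, ℝ) ∞ H) (x₀ : M) :
    ContDiffOn ℝ ∞ (fun z => symplecticGrad n (fderiv ℝ (localHamiltonian H x₀) z))
      (coChart n x₀).target := by
  have h1 : ContDiffOn ℝ ∞ (localHamiltonian H x₀) (coChart n x₀).target := by
    rw [← contMDiffOn_iff_contDiffOn]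
    exact hH.comp_contMDiffOn (contMDiffOn_coChart_symm x₀)
  exact (symplecticGrad n).contDiff.comp_contDiffOn
    (h1.fderiv_of_isOpen (isOpen_coChart_target x₀) (by simp))

/-- Two classical paths that agree at `r` agree near `r`. -/
theorem IsClassicalPath.eventuallyEq {H : CotangentBundle n M → ℝ}
    (hH : ContMDiff (cotangentModel n) 𝓘(ℝ, ℝ) ∞ H) {T : ℝ} {c c' : ℝ → CotangentBundle n M}
    (hc : IsClassicalPath H T c) (hc' : IsClassicalPath H T c') {r : ℝ} (hr : r ∈ Icc 0 T)
    (h : c r = c' r) : ∀ᶠ s in 𝓝[Icc 0 T] r, c s = c' s := by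
  set x₀ := (c r).proj with hx₀
  have hs₀ : c r ∈ (coChart n x₀).source := mem_coChart_source_self _
  have hz₀ := (coChart n x₀).map_source hs₀
  have hX : ContDiffAt ℝ 1 (fun z => symplecticGrad n (fderiv ℝ (localHamiltonian H x₀) z))
      (coChart n x₀ (c r)) :=
    ((contDiffOn_symplecticGrad_localHamiltonian hH x₀).contDiffAt
      ((isOpen_coChart_target x₀).mem_nhds hz₀)).of_le ENat.LEInfty.out
  obtain ⟨K, S, hS, hK⟩ := hX.exists_lipschitzOnWith
  have hSc : coChart n x₀ ⁻¹' S ∩ (coChart n x₀).source ∈ 𝓝 (c r) :=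
    Filter.inter_mem ((mdifferentiableAt_coChart hs₀).continuousAt.preimage_mem_nhds hS)
      ((isOpen_coChart_source x₀).mem_nhds hs₀)
  have e1 : ∀ᶠ s in 𝓝[Icc 0 T] r, c s ∈ coChart n x₀ ⁻¹' S ∩ (coChart n x₀).source :=
    (hc r hr).continuousWithinAt hSc
  have e2 : ∀ᶠ s in 𝓝[Icc 0 T] r, c' s ∈ coChart n x₀ ⁻¹' S ∩ (coChart n x₀).source :=
    (hc' r hr).continuousWithinAt (h ▸ hSc)
  obtain ⟨δ, hδ, hball⟩ := Metric.mem_nhdsWithin_iff.1 (e1.and e2)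
  have hder : ∀ {c : ℝ → CotangentBundle n M}, IsClassicalPath H T c → ∀ s ∈ Icc 0 T,
      c s ∈ (coChart n x₀).source → HasDerivWithinAt (coChart n x₀ ∘ c)
        (symplecticGrad n (fderiv ℝ (localHamiltonian H x₀) ((coChart n x₀ ∘ c) s)))
        (Icc 0 T) s := fun hc s hs hcs =>
    hasDerivWithinAt_coChart_comp hcs (hH.mdifferentiable (by simp) _) (hc s hs)
  refine Metric.mem_nhdsWithin_iff.2 ⟨δ, hδ, fun s hs => ?_⟩
  -- Order-connectedness keeps the whole segment from r to s in the times where both paths stay in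
  -- the chart and in the Lipschitz region S.
  have hmem : ∀ s' ∈ uIcc r s, s' ∈ Metric.ball r δ ∩ Icc 0 T := fun s' hs' =>
    ((convex_ball r δ).ordConnected.inter ordConnected_Icc).uIcc_subset
      ⟨Metric.mem_ball_self hδ, hr⟩ hs hs'
  have hcont : ∀ {c : ℝ → CotangentBundle n M}, IsClassicalPath H T c →
      (∀ s' ∈ uIcc r s, c s' ∈ (coChart n x₀).source) →
      ContinuousOn (coChart n x₀ ∘ c) (uIcc r s) := fun hc hcs s' hs' =>
    ((hder hc s' (hmem s' hs').2 (hcs s' hs')).mono fun u hu => (hmem u hu).2).continuousWithinAt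
  have hm := fun s' hs' => hball (hmem s' hs')
  have heq : EqOn (coChart n x₀ ∘ c) (coChart n x₀ ∘ c') (uIcc r s) := by
    have hf := hcont hc fun s' hs' => (hm s' hs').1.2
    have hg := hcont hc' fun s' hs' => (hm s' hs').2.2
    -- The agreement time r is arbitrary, so both directions of time are needed; backward uniqueness
    -- later gives injectivity of the time-one map.
    rcases le_total r s with hrs | hrs
    · rw [uIcc_of_le hrs] at hm hf hg ⊢
      have hnb : ∀ s' ∈ Ico r s, Icc 0 T ∈ 𝓝[Ici s'] s' := fun s' hs' =>
        Icc_mem_nhdsGE_of_mem ⟨hr.1.trans hs'.1, hs'.2.trans_le hs.2.2⟩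
      have hI : ∀ s' ∈ Ico r s, s' ∈ Icc 0 T := fun s' hs' =>
        ⟨hr.1.trans hs'.1, hs'.2.le.trans hs.2.2⟩
      refine ODE_solution_unique_of_mem_Icc_right (s := fun _ => S) (K := K)
        (v := fun _ z => symplecticGrad n (fderiv ℝ (localHamiltonian H x₀) z))
        (fun _ _ => hK) hf (fun s' hs' => ?_) (fun s' hs' => (hm s' (Ico_subset_Icc_self hs')).1.1)
        hg (fun s' hs' => ?_) (fun s' hs' => (hm s' (Ico_subset_Icc_self hs')).2.1)
        (congrArg (coChart n x₀) h)
      · exact (hder hc s' (hI s' hs') (hm s' (Ico_subset_Icc_self hs')).1.2).mono_of_mem_nhdsWithin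
          (hnb s' hs')
      · exact (hder hc' s' (hI s' hs') (hm s' (Ico_subset_Icc_self hs')).2.2).mono_of_mem_nhdsWithin
          (hnb s' hs')
    · rw [uIcc_of_ge hrs] at hm hf hg ⊢
      have hnb : ∀ s' ∈ Ioc s r, Icc 0 T ∈ 𝓝[Iic s'] s' := fun s' hs' =>
        Icc_mem_nhdsLE_of_mem ⟨hs.2.1.trans_lt hs'.1, hs'.2.trans hr.2⟩
      have hI : ∀ s' ∈ Ioc s r, s' ∈ Icc 0 T := fun s' hs' =>
        ⟨hs.2.1.trans hs'.1.le, hs'.2.trans hr.2⟩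
      refine ODE_solution_unique_of_mem_Icc_left (s := fun _ => S) (K := K)
        (v := fun _ z => symplecticGrad n (fderiv ℝ (localHamiltonian H x₀) z))
        (fun _ _ => hK) hf (fun s' hs' => ?_) (fun s' hs' => (hm s' (Ioc_subset_Icc_self hs')).1.1)
        hg (fun s' hs' => ?_) (fun s' hs' => (hm s' (Ioc_subset_Icc_self hs')).2.1)
        (congrArg (coChart n x₀) h)
      · exact (hder hc s' (hI s' hs') (hm s' (Ioc_subset_Icc_self hs')).1.2).mono_of_mem_nhdsWithin
          (hnb s' hs')
      · exact (hder hc' s' (hI s' hs') (hm s' (Ioc_subset_Icc_self hs')).2.2).mono_of_mem_nhdsWithin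
          (hnb s' hs')
  exact (coChart n x₀).injOn (hball hs).1.2 (hball hs).2.2 (heq right_mem_uIcc)

/-- The agreement set is open by local uniqueness and closed because T*M is Hausdorff, and the
interval is connected. -/
theorem IsClassicalPath.eqOn [T2Space M] {H : CotangentBundle n M → ℝ}
    (hH : ContMDiff (cotangentModel n) 𝓘(ℝ, ℝ) ∞ H) {T : ℝ} {c c' : ℝ → CotangentBundle n M}
    (hc : IsClassicalPath H T c) (hc' : IsClassicalPath H T c') {r : ℝ} (hr : r ∈ Icc 0 T)
    (h : c r = c' r) : EqOn c c' (Icc 0 T) := by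
  have : T2Space (CotangentBundle n M) := t2Space_cotangentBundle
  have : PreconnectedSpace (Icc 0 T) := isPreconnected_iff_preconnectedSpace.1 isPreconnected_Icc
  have hcc : Continuous fun s : Icc 0 T => c s :=
    continuousOn_iff_continuous_domRestrict.1 fun s hs => (hc s hs).continuousWithinAt
  have hcc' : Continuous fun s : Icc 0 T => c' s :=
    continuousOn_iff_continuous_domRestrict.1 fun s hs => (hc' s hs).continuousWithinAt
  have hclopen : IsClopen {s : Icc 0 T | c s = c' s} := by
    refine ⟨isClosed_eq hcc hcc', isOpen_iff_mem_nhds.2 fun s hs => ?_⟩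
    exact mem_nhds_subtype_iff_nhdsWithin.2 (by
      have := hc.eventuallyEq hH hc' s.2 hs
      filter_upwards [this, self_mem_nhdsWithin] with u hu huT using ⟨⟨u, huT⟩, hu, rfl⟩)
  have huniv := hclopen.eq_univ ⟨⟨r, hr⟩, h⟩
  intro s hs
  have : (⟨s, hs⟩ : Icc 0 T) ∈ {s : Icc 0 T | c s = c' s} := huniv ▸ mem_univ _
  exact this

end Uniqueness

/-! ### Scaling of momentum and time -/

section Dilation

variable {n : ℕ} {M : Type*} [TopologicalSpace M] [ChartedSpace (Model n) M]
  [IsManifold (𝓡 n) ∞ M]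

/-- The dilation `(x, ξ) ↦ (x, a ξ)` of `T*M`. -/
def dilation (a : ℝ) (p : CotangentBundle n M) : CotangentBundle n M := ⟨p.proj, a • p.snd⟩

/-- The dilation `(x, ξ) ↦ (x, a ξ)` of `ℝⁿ × (ℝⁿ)*`. -/
def dilationCLM (n : ℕ) (a : ℝ) : Model n × CoModel n →L[ℝ] Model n × CoModel n :=
  (ContinuousLinearMap.fst ℝ _ _).prod (a • ContinuousLinearMap.snd ℝ _ _)

theorem dilation_mem_source {x₀ : M} {p : CotangentBundle n M} (hp : p ∈ (coChart n x₀).source)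
    (a : ℝ) : dilation a p ∈ (coChart n x₀).source := by
  rw [mem_coChart_source] at hp ⊢
  exact hp

theorem coChart_dilation {x₀ : M} {p : CotangentBundle n M} (hp : p ∈ (coChart n x₀).source)
    (a : ℝ) : coChart n x₀ (dilation a p) = dilationCLM n a (coChart n x₀ p) := by
  have hp' := dilation_mem_source hp a
  refine Prod.ext ?_ ?_
  · rw [coChart_fst]
    exact (coChart_fst x₀ p).symm
  · have h1 := coChart_snd_comp hp'
    have h2 := coChart_snd_comp hp
    have h3 : (coChart n x₀ (dilation a p)).2.comp (chartDeriv n x₀ p.proj) =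
        (a • (coChart n x₀ p).2).comp (chartDeriv n x₀ p.proj) := by
      rw [ContinuousLinearMap.smul_comp, h2]
      exact h1
    ext b
    obtain ⟨v, rfl⟩ := chartDeriv_surjective (mem_coChart_source.1 hp) b
    exact congrArg (fun L => L v) h3

theorem covectorNormSq_dilation (g : SmoothMetric n M) (a : ℝ) (p : CotangentBundle n M) :
    covectorNormSq g (dilation a p) = a ^ 2 * covectorNormSq g p := by
  have h1 : sharp g p.proj (a • p.snd) = a • sharp g p.proj p.snd :=
    (ContinuousLinearMap.inverse (g.inner p.proj)).map_smul a p.snd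
  change (a • p.snd) (sharp g p.proj (a • p.snd)) = _
  rw [h1, map_smul]
  change a * (a * covectorNormSq g p) = _
  ring

theorem covectorNorm_dilation (g : SmoothMetric n M) {a : ℝ} (ha : 0 ≤ a)
    (p : CotangentBundle n M) : covectorNorm g (dilation a p) = a * covectorNorm g p := by
  rw [covectorNorm, covectorNormSq_dilation, Real.sqrt_mul (sq_nonneg a), Real.sqrt_sq ha,
    covectorNorm]

/-- Dilation by a multiplies the symplectic form by a and the Hamiltonian by a². The quotient is the
factor a by which time must be rescaled. -/
theorem symplecticGrad_dilation {a : ℝ} (ha : a ≠ 0) {d d' : Model n × CoModel n →L[ℝ] ℝ}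
    (h : d'.comp (dilationCLM n a) = a ^ 2 • d) :
    symplecticGrad n d' = dilationCLM n a (a • symplecticGrad n d) := by
  refine eq_of_forall_symplecticForm fun v => ?_
  obtain ⟨v, rfl⟩ : ∃ v', dilationCLM n a v' = v :=
    ⟨(v.1, a⁻¹ • v.2), by simp [dilationCLM, smul_smul, ha]⟩
  rw [symplecticForm_symplecticGrad]
  have h1 : symplecticForm (dilationCLM n a (a • symplecticGrad n d)) (dilationCLM n a v) =
      a ^ 2 * symplecticForm (symplecticGrad n d) v := by
    simp [symplecticForm, dilationCLM]
    ring
  have h2 : d' (dilationCLM n a v) = a ^ 2 * d v := congrArg (fun L => L v) h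
  rw [h1, h2, symplecticForm_symplecticGrad]
  ring

theorem fderiv_localHamiltonian_dilation {H H' : CotangentBundle n M → ℝ}
    (hH : ContMDiff (cotangentModel n) 𝓘(ℝ, ℝ) ∞ H)
    (hH' : ContMDiff (cotangentModel n) 𝓘(ℝ, ℝ) ∞ H') {a : ℝ}
    (h : ∀ p, H' (dilation a p) = a ^ 2 * H p) {x₀ : M} {p : CotangentBundle n M}
    (hp : p ∈ (coChart n x₀).source) :
    (fderiv ℝ (localHamiltonian H' x₀) (dilationCLM n a (coChart n x₀ p))).comp
      (dilationCLM n a) = a ^ 2 • fderiv ℝ (localHamiltonian H x₀) (coChart n x₀ p) := by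
  have hp' := dilation_mem_source hp a
  have h1 := (differentiableAt_localHamiltonian hp'
    (hH'.mdifferentiable (by simp) _)).hasFDerivAt
  have h2 := (differentiableAt_localHamiltonian hp
    (hH.mdifferentiable (by simp) _)).hasFDerivAt
  rw [coChart_dilation hp] at h1
  have h3 := h1.comp (coChart n x₀ p) (dilationCLM n a).hasFDerivAt
  have h4 := (h2.const_smul (a ^ 2)).congr_of_eventuallyEq
    (f₁ := localHamiltonian H' x₀ ∘ dilationCLM n a) (by
      filter_upwards [(isOpen_coChart_target x₀).mem_nhds ((coChart n x₀).map_source hp)]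
        with z hz
      have hq := (coChart n x₀).map_target hz
      have h5 := h ((coChart n x₀).symm z)
      have h6 := coChart_dilation hq a
      rw [(coChart n x₀).right_inv hz] at h6
      simp only [localHamiltonian, Function.comp_apply, Pi.smul_apply, smul_eq_mul]
      rw [← h5, ← h6, (coChart n x₀).left_inv (dilation_mem_source hq a)])
  exact h3.unique h4

/-- Rescaling of time and momentum. -/
theorem IsClassicalPath.rescale {H H' : CotangentBundle n M → ℝ}
    (hH : ContMDiff (cotangentModel n) 𝓘(ℝ, ℝ) ∞ H)
    (hH' : ContMDiff (cotangentModel n) 𝓘(ℝ, ℝ) ∞ H') {a : ℝ} (ha : 0 < a)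
    (h : ∀ p, H' (dilation a p) = a ^ 2 * H p) {T T' : ℝ} (hT : T = a * T')
    {c : ℝ → CotangentBundle n M} (hc : IsClassicalPath H T c) :
    IsClassicalPath H' T' (fun s => dilation a (c (a * s))) := by
  intro s hs
  have hmap : MapsTo (fun s => a * s) (Icc 0 T') (Icc 0 T) := fun s hs =>
    ⟨mul_nonneg ha.le hs.1, hT ▸ mul_le_mul_of_nonneg_left hs.2 ha.le⟩
  set x₀ := (c (a * s)).proj with hx₀
  have hs₀ : c (a * s) ∈ (coChart n x₀).source := mem_coChart_source_self _
  have hs₁ := dilation_mem_source hs₀ a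
  have hd := hasDerivWithinAt_coChart_comp hs₀ (hH.mdifferentiable (by simp) _)
    (hc (a * s) (hmap hs))
  have hd1 : HasDerivWithinAt (fun s => (coChart n x₀ ∘ c) (a * s))
      (a • symplecticGrad n (fderiv ℝ (localHamiltonian H x₀) (coChart n x₀ (c (a * s)))))
      (Icc 0 T') s := by
    have := hd.scomp s (((hasDerivAt_id s).const_mul a).hasDerivWithinAt (s := Icc 0 T')) hmap
    rw [mul_one] at this
    exact this
  have hd2 := (dilationCLM n a).hasFDerivAt.comp_hasDerivWithinAt s hd1
  have hz : dilationCLM n a ((coChart n x₀ ∘ c) (a * s)) ∈ (coChart n x₀).target := by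
    rw [Function.comp_apply, ← coChart_dilation hs₀]
    exact (coChart n x₀).map_source hs₁
  have hloc := fderiv_localHamiltonian_dilation hH hH' h hs₀
  have hd3 := hasMFDerivWithinAt_coChart_symm_comp (H := H') (x₀ := x₀) (S := Icc 0 T') (r := s)
    (z := fun s => dilationCLM n a ((coChart n x₀ ∘ c) (a * s)))
    hz (hH'.mdifferentiable (by simp) _)
    (hd2.congr_deriv (symplecticGrad_dilation ha.ne' hloc).symm)
  have hval : ∀ u, c (a * u) ∈ (coChart n x₀).source →
      dilation a (c (a * u)) =
      (coChart n x₀).symm (dilationCLM n a ((coChart n x₀ ∘ c) (a * u))) := fun u hu => by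
    rw [Function.comp_apply, ← coChart_dilation hu,
      (coChart n x₀).left_inv (dilation_mem_source hu a)]
  rw [← hval s hs₀] at hd3
  refine hd3.congr_of_eventuallyEq ?_ (hval s hs₀)
  have hcont : ContinuousWithinAt (fun u => c (a * u)) (Icc 0 T') s :=
    ContinuousWithinAt.comp (t := Icc 0 T) (hc (a * s) (hmap hs)).continuousWithinAt
      (by fun_prop) hmap
  filter_upwards [hcont ((isOpen_coChart_source x₀).mem_nhds hs₀)] with u hu
  exact hval u hu

/-- Since H_t(x, tξ) = t² H(x, ξ), dilation by t with time rescaled by t carries H-paths on [0, t]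
with initial norm below μ/t to H_t-paths on [0, 1] with initial norm below μ. The inverse dilation
goes back, with endpoints preserved. -/
theorem HasUniqueLowPath.of_scaled (g : SmoothMetric n M) {V : M → ℝ}
    (hV : ContMDiff (𝓡 n) 𝓘(ℝ, ℝ) ∞ V) {t : ℝ} (ht : 0 < t) {x y : M} {μ : ℝ}
    (h : HasUniqueLowPath g (scaledHamiltonian g V t) 1 x y μ) :
    HasUniqueLowPath g (hamiltonian g V) t x y (μ / t) := by
  have hH := contMDiff_hamiltonian g hV
  have hHt := contMDiff_scaledHamiltonian g hV t
  have e1 : ∀ p, scaledHamiltonian g V t (dilation t p) = t ^ 2 * hamiltonian g V p := fun p => by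
    rw [scaledHamiltonian, covectorNormSq_dilation, hamiltonian]
    change _ + t ^ 2 * V p.proj = _
    ring
  have e2 : ∀ p, hamiltonian g V (dilation t⁻¹ p) = t⁻¹ ^ 2 * scaledHamiltonian g V t p :=
    fun p => by
    rw [scaledHamiltonian, hamiltonian, covectorNormSq_dilation]
    change _ + V p.proj = _
    field_simp
  have e3 : ∀ p : CotangentBundle n M, dilation t⁻¹ (dilation t p) = p := fun p => by
    have : t⁻¹ • t • p.snd = p.snd := inv_smul_smul₀ ht.ne' p.snd
    rw [dilation, dilation, this]
  obtain ⟨c, ⟨hc, hcy, hcx, hcμ⟩, huniq⟩ := h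
  refine ⟨fun s => dilation t⁻¹ (c (t⁻¹ * s)), ⟨?_, ?_, ?_, ?_⟩, ?_⟩
  · exact hc.rescale hHt hH (inv_pos.2 ht) e2 (inv_mul_cancel₀ ht.ne').symm
  · simpa [dilation] using hcy
  · simpa [dilation, inv_mul_cancel₀ ht.ne'] using hcx
  · rw [covectorNorm_dilation g (inv_pos.2 ht).le, mul_zero, div_eq_inv_mul]
    exact mul_lt_mul_of_pos_left hcμ (inv_pos.2 ht)
  · rintro c' ⟨hc', hcy', hcx', hcμ'⟩ s hs
    have h1 := huniq (fun s => dilation t (c' (t * s)))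
      ⟨hc'.rescale hH hHt ht e1 (mul_one t).symm, by simpa [dilation] using hcy',
        by simpa [dilation] using hcx', by
        rw [covectorNorm_dilation g ht.le, mul_zero]
        rwa [lt_div_iff₀' ht] at hcμ'⟩
    have h2 := h1 (x := t⁻¹ * s) ⟨mul_nonneg (inv_pos.2 ht).le hs.1, by
      rw [inv_mul_le_iff₀ ht, mul_one]; exact hs.2⟩
    simp only [mul_inv_cancel_left₀ ht.ne'] at h2
    change c' s = dilation t⁻¹ (c (t⁻¹ * s))
    rw [← h2, e3]

end Dilation

/-! ### Local flows and their actions transported to the manifold -/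

section FlowInChart

variable {n : ℕ} {M : Type*} [TopologicalSpace M] [ChartedSpace (Model n) M]
  [IsManifold (𝓡 n) ∞ M]

/-- The solutions on `[0, 1]` of Hamilton's equations for the scaled Hamiltonians near the point
`x₀` of the zero section, in the canonical coordinates at `x₀`, together with the inverses of the
time one map and of the map sending an initial value to its endpoints. -/
structure ChartFlow (g : SmoothMetric n M) (V : M → ℝ) (x₀ : M) where
  B : Model n → CoModel n →L[ℝ] Model n
  U : Model n → ℝ
  O : Set (Model n)
  D : Set (ℝ × Model n × CoModel n)
  Γ : ℝ × Model n × CoModel n → C(unitInterval, ℝ × Model n × CoModel n)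
  φ : OpenPartialHomeomorph (ℝ × Model n × CoModel n) (ℝ × Model n × CoModel n)
  ψ : OpenPartialHomeomorph (ℝ × Model n × CoModel n) (ℝ × Model n × Model n)
  contDiff_B : ContDiff ℝ ∞ B
  contDiff_U : ContDiff ℝ ∞ U
  B_symm : ∀ (x : Model n) (ξ η : CoModel n), ξ (B x η) = η (B x ξ)
  isOpen_O : IsOpen O
  O_subset : O ⊆ (extChartAt (𝓡 n) x₀).target
  B_eq : ∀ x ∈ O, B x = cometric g x₀ x
  U_eq : ∀ x ∈ O, U x = V ((extChartAt (𝓡 n) x₀).symm x)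
  mem_D : (0, extChartAt (𝓡 n) x₀ x₀, 0) ∈ D
  flow : IsLocalFlow (kineticHamiltonian B U) (contDiff_kineticHamiltonian contDiff_B contDiff_U) D Γ
  mem_O : ∀ w ∈ D, ∀ s, (Γ w s).2.1 ∈ O
  φ_source : φ.source = D
  φ_apply : ∀ w, φ w = Γ w 1
  φ_symm_smooth : ContDiffOn ℝ ∞ φ.symm φ.target
  ψ_source : ψ.source = D
  ψ_apply : ∀ w, ψ w = (w.1, (Γ w 1).2.1, w.2.1)
  ψ_symm_smooth : ContDiffOn ℝ ∞ ψ.symm ψ.target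

theorem nonempty_chartFlow (g : SmoothMetric n M) {V : M → ℝ}
    (hV : ContMDiff (𝓡 n) 𝓘(ℝ, ℝ) ∞ V) (x₀ : M) : Nonempty (ChartFlow g V x₀) := by
  obtain ⟨B, U, O, hB, hU, hs, hO, hxO, hOt, hBO, hUO⟩ := exists_kineticHamiltonian g hV x₀
  obtain ⟨A, hA, hAB⟩ := hasFDerivAt_extendedField_kineticHamiltonian hB hU hs
    (extChartAt (𝓡 n) x₀ x₀)
  obtain ⟨e, he⟩ := isInvertible_metricCoord g (mem_extChartAt_source (I := 𝓡 n) x₀)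
  have hBe : B (extChartAt (𝓡 n) x₀ x₀) = e.symm := by
    rw [hBO _ hxO, cometric, extChartAt_to_inv, ← he, ContinuousLinearMap.inverse_equiv]
  obtain ⟨D, Γ, φ, ψ, hmem, hflow, hrange, hφs, hφ, hφi, hψs, hψ, hψi⟩ :=
    exists_isLocalFlow (contDiff_kineticHamiltonian hB hU)
      (extendedField_kineticHamiltonian_zero hB hU hs _) e.symm hA
      (fun v => by rw [hAB, hBe]; rfl) (O := {w | w.2.1 ∈ O})
      (hO.preimage continuous_snd.fst) hxO
  exact ⟨⟨B, U, O, D, Γ, φ, ψ, hB, hU, hs, hO, hOt, hBO, hUO, hmem, hflow, hrange, hφs, hφ, hφi,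
    hψs, hψ, hψi⟩⟩

/-- The Lagrangian action of a path in `T*M`. -/
def pathAction (g : SmoothMetric n M) (V : M → ℝ) (t : ℝ) (c : ℝ → CotangentBundle n M) : ℝ :=
  ∫ s in (0 : ℝ)..1, (covectorNormSq g (c s) / 2 - t ^ 2 * V (c s).proj)

theorem eq_mk_coChart_snd {x₀ : M} {p : CotangentBundle n M} (hp : p ∈ (coChart n x₀).source) :
    p = ⟨p.proj, (coChart n x₀ p).2.comp (chartDeriv n x₀ p.proj)⟩ := by
  rw [coChart_snd_comp hp]

theorem coChart_zero {x₀ y : M} (hy : y ∈ (extChartAt (𝓡 n) x₀).source) :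
    coChart n x₀ ⟨y, 0⟩ = (extChartAt (𝓡 n) x₀ y, 0) := by
  have hs : (⟨y, 0⟩ : CotangentBundle n M) ∈ (coChart n x₀).source := mem_coChart_source.2 hy
  refine Prod.ext (coChart_fst _ _) ?_
  ext b
  obtain ⟨v, rfl⟩ := chartDeriv_surjective hy b
  exact congrArg (fun L => L v) (coChart_snd_comp hs)

/-- Covectors are compared through their coordinates: a function whose differential pulls back from
the momentum coordinate of p has p as its differential. -/
theorem differential_eq {x₀ : M} {p : CotangentBundle n M} (hp : p ∈ (coChart n x₀).source)
    {x : M} (hx : p.proj = x) {f : M → ℝ}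
    (hf : HasMFDerivAt (𝓡 n) 𝓘(ℝ, ℝ) f x ((coChart n x₀ p).2.comp (chartDeriv n x₀ x))) :
    differential f x = p := by
  subst hx
  conv_rhs => rw [eq_mk_coChart_snd hp]
  exact congrArg (fun L => (⟨p.proj, L⟩ : CotangentBundle n M)) hf.mfderiv

theorem differential_eq_of_coord {x₀ : M} {p : CotangentBundle n M}
    (hp : p ∈ (coChart n x₀).source) {x : M} (hx : p.proj = x) {f : M → ℝ} {S : Model n → ℝ}
    (hS : HasFDerivAt S (coChart n x₀ p).2 (extChartAt (𝓡 n) x₀ x))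
    (hf : ∀ᶠ y in 𝓝 x, f y = S (extChartAt (𝓡 n) x₀ y)) : differential f x = p := by
  have hxs : x ∈ (extChartAt (𝓡 n) x₀).source := hx ▸ mem_coChart_source.1 hp
  exact differential_eq hp hx
    ((hS.hasMFDerivAt.comp x (hasMFDerivAt_chartDeriv hxs)).congr_of_eventuallyEq hf)

section Partial

variable {E : Type*} [NormedAddCommGroup E] [NormedSpace ℝ E] {S : ℝ × E × E → ℝ}
  {T : ℝ × E × E →L[ℝ] ℝ} {t : ℝ} {u v : E} {α : E →L[ℝ] ℝ}

theorem hasFDerivAt_partial_fst (h : HasFDerivAt S T (t, u, v)) (hα : ∀ a, T (0, a, 0) = α a) :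
    HasFDerivAt (fun a => S (t, a, v)) α u := by
  have h1 : HasFDerivAt (fun a : E => ((t, a, v) : ℝ × E × E))
      ((0 : E →L[ℝ] ℝ).prod ((ContinuousLinearMap.id ℝ E).prod (0 : E →L[ℝ] E))) u :=
    (hasFDerivAt_const t u).prodMk ((hasFDerivAt_id u).prodMk (hasFDerivAt_const v u))
  exact (HasFDerivAt.comp u h h1).congr_fderiv (ContinuousLinearMap.ext hα)

theorem hasFDerivAt_partial_snd (h : HasFDerivAt S T (t, u, v)) (hα : ∀ b, T (0, 0, b) = α b) :
    HasFDerivAt (fun b => S (t, u, b)) α v := by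
  have h1 : HasFDerivAt (fun b : E => ((t, u, b) : ℝ × E × E))
      ((0 : E →L[ℝ] ℝ).prod ((0 : E →L[ℝ] E).prod (ContinuousLinearMap.id ℝ E))) v :=
    (hasFDerivAt_const t v).prodMk ((hasFDerivAt_const u v).prodMk (hasFDerivAt_id v))
  exact (HasFDerivAt.comp v h h1).congr_fderiv (ContinuousLinearMap.ext hα)

end Partial

namespace ChartFlow

variable {g : SmoothMetric n M} {V : M → ℝ} {x₀ : M} (F : ChartFlow g V x₀)

/-- The coordinates `(t, x, ξ)` of a point of `ℝ × T*M`. -/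
def coord (_ : ChartFlow g V x₀) (z : ℝ × CotangentBundle n M) : ℝ × Model n × CoModel n :=
  (z.1, coChart n x₀ z.2)

/-- The domain of the local flow. -/
def dom : Set (ℝ × CotangentBundle n M) := {z | z.2 ∈ (coChart n x₀).source ∧ F.coord z ∈ F.D}

/-- The domain of the inverse of the time one map. -/
def codom : Set (ℝ × CotangentBundle n M) :=
  {z | z.2 ∈ (coChart n x₀).source ∧ F.coord z ∈ F.φ.target}

/-- The coordinates of a point of `ℝ × M × M`. -/
def endCoord (_ : ChartFlow g V x₀) (z : ℝ × M × M) : ℝ × Model n × Model n :=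
  (z.1, extChartAt (𝓡 n) x₀ z.2.1, extChartAt (𝓡 n) x₀ z.2.2)

/-- The set of all `(t, x, y)` for which `x` and `y` are the endpoints of a local path. -/
def ends : Set (ℝ × M × M) :=
  {z | (z.2.1 ∈ (extChartAt (𝓡 n) x₀).source ∧ z.2.2 ∈ (extChartAt (𝓡 n) x₀).source) ∧
    F.endCoord z ∈ F.ψ.target}

/-- The solution with the given initial value. -/
def path (z : ℝ × CotangentBundle n M) (s : ℝ) : CotangentBundle n M :=
  (coChart n x₀).symm (extendCurve (F.Γ (F.coord z)) s).2

/-- The initial value of the path that ends at the given point. -/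
def start (z : ℝ × CotangentBundle n M) : CotangentBundle n M :=
  (coChart n x₀).symm (F.φ.symm (F.coord z)).2

/-- The initial value of the path with the given endpoints. -/
def initial (z : ℝ × M × M) : CotangentBundle n M :=
  (coChart n x₀).symm (F.ψ.symm (F.endCoord z)).2

theorem contMDiffOn_coord : ContMDiffOn (𝓘(ℝ, ℝ).prod (cotangentModel n))
    𝓘(ℝ, ℝ × Model n × CoModel n) ∞ F.coord (univ ×ˢ (coChart n x₀).source) :=
  contMDiffOn_fst.prodMk_space
    ((contMDiffOn_coChart x₀).comp contMDiffOn_snd fun _ hz => hz.2)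

theorem contMDiffOn_endCoord : ContMDiffOn (𝓘(ℝ, ℝ).prod ((𝓡 n).prod (𝓡 n)))
    𝓘(ℝ, ℝ × Model n × Model n) ∞ F.endCoord
    (univ ×ˢ ((extChartAt (𝓡 n) x₀).source ×ˢ (extChartAt (𝓡 n) x₀).source)) := by
  have h : ContMDiffOn (𝓡 n) 𝓘(ℝ, Model n) ∞ (extChartAt (𝓡 n) x₀)
      (extChartAt (𝓡 n) x₀).source := by
    rw [extChartAt_source]
    exact contMDiffOn_extChartAt
  exact contMDiffOn_fst.prodMk_space
    ((h.comp (contMDiff_fst.comp contMDiff_snd).contMDiffOn fun _ hz => hz.2.1).prodMk_space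
      (h.comp (contMDiff_snd.comp contMDiff_snd).contMDiffOn fun _ hz => hz.2.2))

theorem isOpen_dom : IsOpen F.dom := by
  have := F.contMDiffOn_coord.continuousOn.isOpen_inter_preimage
    (isOpen_univ.prod (isOpen_coChart_source x₀)) F.flow.isOpen
  convert this using 1
  ext z
  simp [dom]

theorem isOpen_codom : IsOpen F.codom := by
  have := F.contMDiffOn_coord.continuousOn.isOpen_inter_preimage
    (isOpen_univ.prod (isOpen_coChart_source x₀)) F.φ.open_target
  convert this using 1
  ext z
  simp [codom]

theorem isOpen_ends : IsOpen F.ends := by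
  have := F.contMDiffOn_endCoord.continuousOn.isOpen_inter_preimage
    (isOpen_univ.prod ((isOpen_extChartAt_source x₀).prod (isOpen_extChartAt_source x₀)))
    F.ψ.open_target
  convert this using 1
  ext z
  simp [ends]

theorem mem_dom : ((0 : ℝ), (⟨x₀, 0⟩ : CotangentBundle n M)) ∈ F.dom := by
  refine ⟨mem_coChart_source_self (⟨x₀, 0⟩ : CotangentBundle n M), ?_⟩
  rw [coord, coChart_zero (mem_extChartAt_source x₀)]
  exact F.mem_D

theorem fst_mem_O {w : ℝ × Model n × CoModel n} (hw : w ∈ F.D) : w.2.1 ∈ F.O := by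
  have := F.mem_O w hw 0
  rwa [F.flow.apply_zero hw] at this

theorem snd_mem_target {w : ℝ × Model n × CoModel n} (hw : w.2.1 ∈ F.O) :
    w.2 ∈ (coChart n x₀).target := by
  rw [coChart_target]
  exact ⟨F.O_subset hw, trivial⟩

theorem extendCurve_mem_O {w : ℝ × Model n × CoModel n} (hw : w ∈ F.D) (s : ℝ) :
    (extendCurve (F.Γ w) s).2.1 ∈ F.O := F.mem_O w hw _

theorem extendCurve_fst {w : ℝ × Model n × CoModel n} (hw : w ∈ F.D) (s : ℝ) :
    (extendCurve (F.Γ w) s).1 = w.1 := F.flow.apply_fst hw _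

theorem path_mem_source {z : ℝ × CotangentBundle n M} (hz : z ∈ F.dom) (s : ℝ) :
    F.path z s ∈ (coChart n x₀).source :=
  (coChart n x₀).map_target (F.snd_mem_target (F.extendCurve_mem_O hz.2 s))

theorem coChart_path {z : ℝ × CotangentBundle n M} (hz : z ∈ F.dom) (s : ℝ) :
    coChart n x₀ (F.path z s) = (extendCurve (F.Γ (F.coord z)) s).2 :=
  (coChart n x₀).right_inv (F.snd_mem_target (F.extendCurve_mem_O hz.2 s))

theorem coord_path {z : ℝ × CotangentBundle n M} (hz : z ∈ F.dom) (s : ℝ) :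
    F.coord (z.1, F.path z s) = extendCurve (F.Γ (F.coord z)) s := by
  rw [coord, F.coChart_path hz]
  exact Prod.ext (F.extendCurve_fst hz.2 s).symm rfl

theorem isClassicalPath_path (hV : ContMDiff (𝓡 n) 𝓘(ℝ, ℝ) ∞ V)
    {z : ℝ × CotangentBundle n M} (hz : z ∈ F.dom) :
    IsClassicalPath (scaledHamiltonian g V z.1) 1 (F.path z) := by
  intro s hs
  have hO := F.extendCurve_mem_O hz.2 s
  have h1 := F.flow.hasDerivWithinAt hz.2 hs
  have h2 : HasDerivWithinAt (fun s => (extendCurve (F.Γ (F.coord z)) s).2)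
      (extendedField (kineticHamiltonian F.B F.U) (extendCurve (F.Γ (F.coord z)) s)).2
      (Icc 0 1) s :=
    (ContinuousLinearMap.snd ℝ ℝ (Model n × CoModel n)).hasFDerivAt.comp_hasDerivWithinAt s h1
  refine hasMFDerivWithinAt_coChart_symm_comp (F.snd_mem_target hO)
    ((contMDiff_scaledHamiltonian g hV z.1).mdifferentiable (by simp) _) (h2.congr_deriv ?_)
  rw [symplecticGrad_localHamiltonian g V F.contDiff_B F.contDiff_U F.isOpen_O F.O_subset F.B_eq
    F.U_eq z.1 hO]
  have h3 : (z.1, (extendCurve (F.Γ (F.coord z)) s).2) = extendCurve (F.Γ (F.coord z)) s :=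
    Prod.ext (F.extendCurve_fst hz.2 s).symm rfl
  rw [h3]

theorem path_zero {z : ℝ × CotangentBundle n M} (hz : z ∈ F.dom) : F.path z 0 = z.2 := by
  have h : extendCurve (F.Γ (F.coord z)) 0 = F.coord z :=
    (extendCurve_coe _ 0).trans (F.flow.apply_zero hz.2)
  rw [path, h]
  exact (coChart n x₀).left_inv hz.1

theorem extendCurve_one (w : ℝ × Model n × CoModel n) : extendCurve (F.Γ w) 1 = F.φ w :=
  (extendCurve_coe _ 1).trans (F.φ_apply w).symm

theorem contMDiffOn_symm_snd {E H N : Type*} [NormedAddCommGroup E] [NormedSpace ℝ E]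
    [TopologicalSpace H] {I : ModelWithCorners ℝ E H} [TopologicalSpace N] [ChartedSpace H N]
    {f : N → ℝ × Model n × CoModel n} {S : Set N}
    (hf : ContMDiffOn I 𝓘(ℝ, ℝ × Model n × CoModel n) ∞ f S) (hO : ∀ z ∈ S, (f z).2.1 ∈ F.O) :
    ContMDiffOn I (cotangentModel n) ∞ (fun z => (coChart n x₀).symm (f z).2) S :=
  (contMDiffOn_coChart_symm x₀).comp
    ((contDiff_snd (𝕜 := ℝ) (n := ∞)).contMDiff.comp_contMDiffOn hf)
    fun z hz => F.snd_mem_target (hO z hz)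

theorem contMDiffOn_path_one : ContMDiffOn (𝓘(ℝ, ℝ).prod (cotangentModel n)) (cotangentModel n) ∞
    (fun z => F.path z 1) F.dom := by
  let ev : C(unitInterval, ℝ × Model n × CoModel n) →L[ℝ] (ℝ × Model n × CoModel n) :=
    ContinuousMap.evalCLM ℝ (projIcc 0 1 zero_le_one 1)
  have h1 : ContDiffOn ℝ ∞ (fun w => extendCurve (F.Γ w) 1) F.D :=
    ev.contDiff.comp_contDiffOn F.flow.smooth
  exact F.contMDiffOn_symm_snd (h1.contMDiffOn.comp
    (F.contMDiffOn_coord.mono fun _ hz => ⟨trivial, hz.1⟩) fun _ hz => hz.2)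
    fun z hz => F.extendCurve_mem_O hz.2 1

theorem symm_mem_D {w : ℝ × Model n × CoModel n} (hw : w ∈ F.φ.target) : F.φ.symm w ∈ F.D := by
  rw [← F.φ_source]
  exact F.φ.map_target hw

theorem symm_fst {w : ℝ × Model n × CoModel n} (hw : w ∈ F.φ.target) :
    (F.φ.symm w).1 = w.1 := by
  have h := F.φ.right_inv hw
  rw [F.φ_apply] at h
  rw [← F.flow.apply_fst (F.symm_mem_D hw) 1, h]

theorem contMDiffOn_start : ContMDiffOn (𝓘(ℝ, ℝ).prod (cotangentModel n)) (cotangentModel n) ∞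
    F.start F.codom :=
  F.contMDiffOn_symm_snd (F.φ_symm_smooth.contMDiffOn.comp
    (F.contMDiffOn_coord.mono fun _ hz => ⟨trivial, hz.1⟩) fun _ hz => hz.2)
    fun _ hz => F.fst_mem_O (F.symm_mem_D hz.2)

theorem path_one_mem_codom {z : ℝ × CotangentBundle n M} (hz : z ∈ F.dom) :
    (z.1, F.path z 1) ∈ F.codom ∧ F.start (z.1, F.path z 1) = z.2 := by
  have h1 : F.coord (z.1, F.path z 1) = F.φ (F.coord z) := by
    rw [F.coord_path hz, F.extendCurve_one]
  have h2 : F.coord z ∈ F.φ.source := by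
    rw [F.φ_source]
    exact hz.2
  refine ⟨⟨F.path_mem_source hz 1, ?_⟩, ?_⟩
  · rw [h1]
    exact F.φ.map_source h2
  · rw [start, h1, F.φ.left_inv h2]
    exact (coChart n x₀).left_inv hz.1

/-- Makes `start` a right inverse of the local time-one map on an open set; this supplies the local
inverses of the global map. -/
theorem start_mem_dom {z : ℝ × CotangentBundle n M} (hz : z ∈ F.codom) :
    (z.1, F.start z) ∈ F.dom ∧ F.path (z.1, F.start z) 1 = z.2 := by
  have hD := F.symm_mem_D hz.2
  have ht := F.snd_mem_target (F.fst_mem_O hD)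
  have h1 : F.coord (z.1, F.start z) = F.φ.symm (F.coord z) := by
    rw [coord, start, (coChart n x₀).right_inv ht]
    exact Prod.ext (F.symm_fst hz.2).symm rfl
  refine ⟨⟨(coChart n x₀).map_target ht, by rw [h1]; exact hD⟩, ?_⟩
  rw [path, h1, F.extendCurve_one, F.φ.right_inv hz.2]
  exact (coChart n x₀).left_inv hz.1

theorem ψ_symm_mem_D {w : ℝ × Model n × Model n} (hw : w ∈ F.ψ.target) : F.ψ.symm w ∈ F.D := by
  rw [← F.ψ_source]
  exact F.ψ.map_target hw

theorem ψ_symm_eq {w : ℝ × Model n × Model n} (hw : w ∈ F.ψ.target) :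
    (F.ψ.symm w).1 = w.1 ∧ (F.Γ (F.ψ.symm w) 1).2.1 = w.2.1 ∧ (F.ψ.symm w).2.1 = w.2.2 := by
  have h := F.ψ.right_inv hw
  rw [F.ψ_apply] at h
  exact ⟨congrArg Prod.fst h, congrArg (fun u => u.2.1) h, congrArg (fun u => u.2.2) h⟩

theorem contMDiffOn_initial : ContMDiffOn (𝓘(ℝ, ℝ).prod ((𝓡 n).prod (𝓡 n))) (cotangentModel n) ∞
    F.initial F.ends :=
  F.contMDiffOn_symm_snd (F.ψ_symm_smooth.contMDiffOn.comp
    (F.contMDiffOn_endCoord.mono fun _ hz => ⟨trivial, hz.1⟩) fun _ hz => hz.2)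
    fun _ hz => F.fst_mem_O (F.ψ_symm_mem_D hz.2)

/-- Injectivity of the endpoint map in usable form: inside one local flow, t and the two endpoints
recover the initial covector. -/
theorem endpoints_mem_ends {z : ℝ × CotangentBundle n M} (hz : z ∈ F.dom) :
    (z.1, (F.path z 1).proj, z.2.proj) ∈ F.ends ∧
      F.initial (z.1, (F.path z 1).proj, z.2.proj) = z.2 := by
  have h2 : F.coord z ∈ F.ψ.source := by
    rw [F.ψ_source]
    exact hz.2
  have h1 : F.endCoord (z.1, (F.path z 1).proj, z.2.proj) = F.ψ (F.coord z) := by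
    rw [endCoord, F.ψ_apply, ← coChart_fst, ← coChart_fst, F.coChart_path hz, F.extendCurve_one,
      F.φ_apply]
    rfl
  refine ⟨⟨⟨mem_coChart_source.1 (F.path_mem_source hz 1), mem_coChart_source.1 hz.1⟩, ?_⟩, ?_⟩
  · rw [h1]
    exact F.ψ.map_source h2
  · rw [initial, h1, F.ψ.left_inv h2]
    exact (coChart n x₀).left_inv hz.1

theorem coord_initial {z : ℝ × M × M} (hz : z ∈ F.ends) :
    F.coord (z.1, F.initial z) = F.ψ.symm (F.endCoord z) := by
  have ht := F.snd_mem_target (F.fst_mem_O (F.ψ_symm_mem_D hz.2))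
  rw [coord, initial, (coChart n x₀).right_inv ht]
  exact Prod.ext (F.ψ_symm_eq hz.2).1.symm rfl

theorem initial_mem_dom {z : ℝ × M × M} (hz : z ∈ F.ends) : (z.1, F.initial z) ∈ F.dom := by
  have hD := F.ψ_symm_mem_D hz.2
  exact ⟨(coChart n x₀).map_target (F.snd_mem_target (F.fst_mem_O hD)), by
    rw [F.coord_initial hz]; exact hD⟩

theorem initial_proj {z : ℝ × M × M} (hz : z ∈ F.ends) : (F.initial z).proj = z.2.2 := by
  rw [initial, coChart_symm_proj (F.snd_mem_target (F.fst_mem_O (F.ψ_symm_mem_D hz.2))),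
    (F.ψ_symm_eq hz.2).2.2]
  exact (extChartAt (𝓡 n) x₀).left_inv hz.1.2

theorem path_initial_one_proj {z : ℝ × M × M} (hz : z ∈ F.ends) :
    (F.path (z.1, F.initial z) 1).proj = z.2.1 := by
  have hO := F.extendCurve_mem_O (F.ψ_symm_mem_D hz.2) 1
  rw [path, F.coord_initial hz, coChart_symm_proj (F.snd_mem_target hO), F.extendCurve_one,
    F.φ_apply, (F.ψ_symm_eq hz.2).2.1]
  exact (extChartAt (𝓡 n) x₀).left_inv hz.1.1

/-- The action of the path with the given endpoints. -/
def endAction (z : ℝ × M × M) : ℝ := pathAction g V z.1 (F.path (z.1, F.initial z))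

/-- The action in coordinates. -/
def coordAction (w : ℝ × Model n × Model n) : ℝ :=
  ∫ s in (0 : ℝ)..1, lagrangian (kineticHamiltonian F.B F.U) (extendCurve (F.Γ (F.ψ.symm w)) s)

/-- The path never leaves the region where the extended B and U are the true inverse metric and
potential, so the two Lagrangians agree along it. -/
theorem endAction_eq {z : ℝ × M × M} (hz : z ∈ F.ends) :
    F.endAction z = F.coordAction (F.endCoord z) := by
  have hd := F.initial_mem_dom hz
  refine intervalIntegral.integral_congr fun s _ => ?_
  have hO := F.extendCurve_mem_O hd.2 s
  change covectorNormSq g (F.path (z.1, F.initial z) s) / 2 -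
    z.1 ^ 2 * V (F.path (z.1, F.initial z) s).proj = _
  rw [covectorNormSq_eq g (F.path_mem_source hd s), F.coChart_path hd,
    lagrangian_kineticHamiltonian F.contDiff_B F.contDiff_U F.B_symm, ← F.coord_initial hz,
    F.B_eq _ hO, F.U_eq _ hO, F.extendCurve_fst hd.2, path,
    coChart_symm_proj (F.snd_mem_target hO)]
  change _ = _ - z.1 ^ 2 * _
  ring

theorem contMDiffOn_endAction : ContMDiffOn (𝓘(ℝ, ℝ).prod ((𝓡 n).prod (𝓡 n))) 𝓘(ℝ, ℝ) ∞
    F.endAction F.ends := by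
  have h1 : ContDiffOn ℝ ∞ F.coordAction F.ψ.target :=
    F.flow.action_smooth.comp F.ψ_symm_smooth fun w hw => F.ψ_symm_mem_D hw
  exact (h1.contMDiffOn.comp (F.contMDiffOn_endCoord.mono fun z hz => ⟨trivial, hz.1⟩)
    fun z hz => hz.2).congr fun z hz => F.endAction_eq hz

theorem hasFDerivAt_coordAction {z : ℝ × M × M} (hz : z ∈ F.ends) :
    ∃ T : ℝ × Model n × Model n →L[ℝ] ℝ, HasFDerivAt F.coordAction T (F.endCoord z) ∧
      ∀ a b, T (0, a, b) = (coChart n x₀ (F.path (z.1, F.initial z) 1)).2 a -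
        (coChart n x₀ (F.initial z)).2 b := by
  have hd := F.initial_mem_dom hz
  obtain ⟨T, hT, hTe⟩ := F.flow.hasFDerivAt_action_endpoints F.ψ_source F.ψ_apply F.ψ_symm_smooth
    (F.ψ_symm_mem_D hz.2)
  rw [F.ψ.right_inv hz.2] at hT
  refine ⟨T, hT, fun a b => ?_⟩
  rw [hTe, F.coChart_path hd, F.extendCurve_one, F.φ_apply, ← F.coord_initial hz]
  rfl

theorem hasFDerivAt_source {t : ℝ} {x y : M} (hz : (t, x, y) ∈ F.ends) :
    HasFDerivAt (fun b => -F.coordAction (t, extChartAt (𝓡 n) x₀ x, b))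
      (coChart n x₀ (F.initial (t, x, y))).2 (extChartAt (𝓡 n) x₀ y) := by
  obtain ⟨T, hT, hTe⟩ := F.hasFDerivAt_coordAction hz
  have h1 : HasFDerivAt (fun b => F.coordAction (t, extChartAt (𝓡 n) x₀ x, b))
      (-(coChart n x₀ (F.initial (t, x, y))).2) (extChartAt (𝓡 n) x₀ y) := by
    refine hasFDerivAt_partial_snd hT fun b => ?_
    rw [hTe, map_zero, zero_sub]
    rfl
  have h2 := h1.fun_neg
  rwa [neg_neg] at h2

theorem differential_source {t : ℝ} {x y : M} (hz : (t, x, y) ∈ F.ends) :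
    differential (fun b => -F.endAction (t, x, b)) y = F.initial (t, x, y) := by
  refine differential_eq_of_coord (F.initial_mem_dom hz).1 (F.initial_proj hz)
    (F.hasFDerivAt_source hz) ?_
  have hc : Continuous fun y : M => (t, x, y) := by fun_prop
  filter_upwards [hc.continuousAt.preimage_mem_nhds (F.isOpen_ends.mem_nhds hz)] with y hy
  exact congrArg (fun r => -r) (F.endAction_eq hy)

theorem hasFDerivAt_target {t : ℝ} {x y : M} (hz : (t, x, y) ∈ F.ends) :
    HasFDerivAt (fun a => F.coordAction (t, a, extChartAt (𝓡 n) x₀ y))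
      (coChart n x₀ (F.path (t, F.initial (t, x, y)) 1)).2 (extChartAt (𝓡 n) x₀ x) := by
  obtain ⟨T, hT, hTe⟩ := F.hasFDerivAt_coordAction hz
  refine hasFDerivAt_partial_fst hT fun a => ?_
  rw [hTe, map_zero, sub_zero]

theorem differential_target {t : ℝ} {x y : M} (hz : (t, x, y) ∈ F.ends) :
    differential (fun a => F.endAction (t, a, y)) x = F.path (t, F.initial (t, x, y)) 1 := by
  refine differential_eq_of_coord (F.path_mem_source (F.initial_mem_dom hz) 1)
    (F.path_initial_one_proj hz) (F.hasFDerivAt_target hz) ?_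
  have hc : Continuous fun x : M => (t, x, y) := by fun_prop
  filter_upwards [hc.continuousAt.preimage_mem_nhds (F.isOpen_ends.mem_nhds hz)] with x hx
  exact F.endAction_eq hx

end ChartFlow

end FlowInChart

/-! ### Uniformity over the compact base -/

section LowMomentum

variable {n : ℕ} {M : Type*} [TopologicalSpace M] [ChartedSpace (Model n) M]
  [IsManifold (𝓡 n) ∞ M]

/-- Positivity on the compact unit sphere gives a lower bound locally uniform in the base point;
homogeneity extends it to all covectors. -/
theorem exists_norm_le_covectorNorm (g : SmoothMetric n M) (x₀ : M) :
    ∃ a > (0 : ℝ), ∀ᶠ u in 𝓝 (extChartAt (𝓡 n) x₀ x₀), ∀ ξ : CoModel n,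
      a * ‖ξ‖ ≤ Real.sqrt (ξ (cometric g x₀ u ξ)) := by
  set u₀ := extChartAt (𝓡 n) x₀ x₀
  have ho := isOpen_extChartAt_target (I := 𝓡 n) x₀
  have hu₀ : u₀ ∈ (extChartAt (𝓡 n) x₀).target := mem_extChartAt_target x₀
  -- The candidate for a is a second variable near 0, where the inequality is plain positivity.
  -- Compactness yields one neighbourhood for all unit covectors, and a is then any positive number
  -- in it.
  have h1 : ∀ᶠ w : Model n × ℝ in 𝓝 (u₀, 0), ∀ ξ ∈ Metric.sphere (0 : CoModel n) 1,
      w.2 ^ 2 < ξ (cometric g x₀ w.1 ξ) := by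
    refine (isCompact_sphere (0 : CoModel n) 1).eventually_forall_of_forall_eventually
      fun ξ hξ => ?_
    have h2 : ContinuousAt (cometric g x₀) u₀ :=
      (contDiffOn_cometric g x₀).continuousOn.continuousAt (ho.mem_nhds hu₀)
    have hc : Continuous fun w : (Model n × ℝ) × CoModel n => w.1.1 := by fun_prop
    have h3 : ContinuousAt (fun w : (Model n × ℝ) × CoModel n => cometric g x₀ w.1.1)
        ((u₀, 0), ξ) := h2.tendsto.comp (hc.tendsto ((u₀, 0), ξ))
    have h4 : ContinuousAt (fun w : (Model n × ℝ) × CoModel n => w.2 (cometric g x₀ w.1.1 w.2))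
        ((u₀, 0), ξ) := continuousAt_snd.clm_apply (h3.clm_apply continuousAt_snd)
    have h5 : ContinuousAt (fun w : (Model n × ℝ) × CoModel n => w.1.2 ^ 2) ((u₀, 0), ξ) := by
      fun_prop
    refine h5.eventually_lt h4 ?_
    have hξ0 : ξ ≠ 0 := by
      rintro rfl
      simp at hξ
    simpa using cometric_pos g hu₀ hξ0
  rw [nhds_prod_eq] at h1
  obtain ⟨P, hP, R, hR, hPR⟩ := Filter.eventually_prod_iff.1 h1
  obtain ⟨a, ha, ha0⟩ := ((hR.filter_mono (nhdsWithin_le_nhds (s := Ioi 0))).and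
    self_mem_nhdsWithin).exists
  refine ⟨a, ha0, ?_⟩
  filter_upwards [hP] with u hu ξ
  rcases eq_or_ne ξ 0 with rfl | hξ
  · simp
  have hn : ‖ξ‖ ≠ 0 := norm_ne_zero_iff.2 hξ
  have h2 := hPR hu ha (‖ξ‖⁻¹ • ξ) (by simp [norm_smul, hn])
  refine Real.le_sqrt_of_sq_le ?_
  have h3 : (‖ξ‖⁻¹ • ξ) (cometric g x₀ u (‖ξ‖⁻¹ • ξ)) =
      (‖ξ‖ ^ 2)⁻¹ * ξ (cometric g x₀ u ξ) := by
    rw [map_smul]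
    simp only [smul_apply, map_smul, smul_eq_mul]
    field_simp
  rw [h3] at h2
  have h4 : 0 < ‖ξ‖ ^ 2 := by positivity
  rw [inv_mul_eq_div, lt_div_iff₀ h4] at h2
  rw [mul_pow]
  exact h2.le

/-- The norm bound makes small g-norm imply small fibre coordinates. A neighbourhood of the zero
covector at x₀ therefore contains the whole small ball of each fibre over base points near x₀. -/
theorem eventually_lowMomentum_mem (g : SmoothMetric n M) (x₀ : M)
    {W : Set (ℝ × CotangentBundle n M)} (hW : W ∈ 𝓝 ((0 : ℝ), (⟨x₀, 0⟩ : CotangentBundle n M))) :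
    ∃ ε > (0 : ℝ), ∀ᶠ y in 𝓝 x₀, ∀ (t : ℝ) (p : CotangentBundle n M), |t| < ε → p.proj = y →
      covectorNorm g p < ε → (t, p) ∈ W := by
  obtain ⟨a, ha, hu⟩ := exists_norm_le_covectorNorm g x₀
  have hs : (⟨x₀, 0⟩ : CotangentBundle n M) ∈ (coChart n x₀).source :=
    mem_coChart_source_self (⟨x₀, 0⟩ : CotangentBundle n M)
  have hk := coChart_zero (n := n) (mem_extChartAt_source (I := 𝓡 n) x₀)
  have h1 : ContinuousAt (fun w : ℝ × Model n × CoModel n => (w.1, (coChart n x₀).symm w.2))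
      (0, extChartAt (𝓡 n) x₀ x₀, 0) := by
    have h2 : ContinuousAt (coChart n x₀).symm (extChartAt (𝓡 n) x₀ x₀, (0 : CoModel n)) := by
      refine (contMDiffOn_coChart_symm x₀).continuousOn.continuousAt
        ((isOpen_coChart_target x₀).mem_nhds ?_)
      rw [← hk]
      exact (coChart n x₀).map_source hs
    exact continuousAt_fst.prodMk (ContinuousAt.comp (f := fun w : ℝ × Model n × CoModel n => w.2)
      h2 continuousAt_snd)
  have h2 : ∀ᶠ w : ℝ × Model n × CoModel n in 𝓝 (0, extChartAt (𝓡 n) x₀ x₀, 0),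
      (w.1, (coChart n x₀).symm w.2) ∈ W := by
    refine h1 ?_
    rw [← hk]
    change W ∈ 𝓝 ((0 : ℝ), (coChart n x₀).symm (coChart n x₀ ⟨x₀, 0⟩))
    rwa [(coChart n x₀).left_inv hs]
  rw [nhds_prod_eq, nhds_prod_eq] at h2
  obtain ⟨P, hP, R, hR, hPR⟩ := Filter.eventually_prod_iff.1 h2
  obtain ⟨P', hP', R', hR', hPR'⟩ := Filter.eventually_prod_iff.1 hR
  obtain ⟨δ, hδ, hδP⟩ := Metric.eventually_nhds_iff.1 hP
  obtain ⟨δ', hδ', hδR⟩ := Metric.eventually_nhds_iff.1 hR'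
  refine ⟨min δ (a * δ'), lt_min hδ (by positivity), ?_⟩
  have hc : ContinuousAt (extChartAt (𝓡 n) x₀) x₀ := continuousAt_extChartAt x₀
  filter_upwards [hc hu, hc hP', extChartAt_source_mem_nhds (I := 𝓡 n) x₀] with y hy hyP hys t p
    ht hpy hp
  subst hpy
  have hps : p ∈ (coChart n x₀).source := mem_coChart_source.2 hys
  have h3 : (t, (coChart n x₀).symm (coChart n x₀ p)) ∈ W := by
    refine hPR (y := coChart n x₀ p) (hδP ?_) ?_
    · simpa using ht.trans_le (min_le_left _ _)
    · refine hPR' (x := (coChart n x₀ p).1) (y := (coChart n x₀ p).2) ?_ (hδR ?_)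
      · rw [coChart_fst]
        exact hyP
      · have h4 := hy (coChart n x₀ p).2
        rw [← coChart_fst, ← covectorNormSq_eq g hps] at h4
        rw [dist_zero_right]
        exact lt_of_mul_lt_mul_left ((h4.trans_lt hp).trans_le (min_le_right _ _)) ha.le
  rwa [(coChart n x₀).left_inv hps] at h3

/-- On a compact manifold, covectors of small norm are uniformly close to the zero section. -/
theorem exists_lowMomentum_cover [CompactSpace M] (g : SmoothMetric n M)
    (W : M → Set (ℝ × CotangentBundle n M))
    (hW : ∀ y, W y ∈ 𝓝 ((0 : ℝ), (⟨y, 0⟩ : CotangentBundle n M))) :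
    ∃ ε > (0 : ℝ), ∀ y, ∃ y₀, ∀ (t : ℝ) (p : CotangentBundle n M), |t| < ε → p.proj = y →
      covectorNorm g p < ε → (t, p) ∈ W y₀ := by
  -- The index y₀ depends on y but not on t or p. This keeps competing low paths from the same y in
  -- one chart.
  have h := (isCompact_univ (X := M)).induction_on (p := fun S => ∃ ε > (0 : ℝ), ∀ y ∈ S, ∃ y₀,
    ∀ (t : ℝ) (p : CotangentBundle n M), |t| < ε → p.proj = y → covectorNorm g p < ε →
      (t, p) ∈ W y₀) ⟨1, one_pos, by simp⟩
    (fun S S' hS ⟨ε, hε, h⟩ => ⟨ε, hε, fun y hy => h y (hS hy)⟩) ?_ ?_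
  · obtain ⟨ε, hε, h⟩ := h
    exact ⟨ε, hε, fun y => h y trivial⟩
  · rintro S S' ⟨ε, hε, h⟩ ⟨ε', hε', h'⟩
    refine ⟨min ε ε', lt_min hε hε', ?_⟩
    rintro y (hy | hy)
    · obtain ⟨y₀, hy₀⟩ := h y hy
      exact ⟨y₀, fun t p ht hp hn => hy₀ t p (ht.trans_le (min_le_left _ _)) hp
        (hn.trans_le (min_le_left _ _))⟩
    · obtain ⟨y₀, hy₀⟩ := h' y hy
      exact ⟨y₀, fun t p ht hp hn => hy₀ t p (ht.trans_le (min_le_right _ _)) hp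
        (hn.trans_le (min_le_right _ _))⟩
  · intro x₀ _
    obtain ⟨ε, hε, h⟩ := eventually_lowMomentum_mem g x₀ (hW x₀)
    exact ⟨_, mem_nhdsWithin_of_mem_nhds h, ε, hε, fun y hy => ⟨x₀, hy⟩⟩

end LowMomentum

/-! ### Velocity, momentum and the action of low paths -/

section Paths

variable {n : ℕ} {M : Type*} [TopologicalSpace M] [ChartedSpace (Model n) M]
  [IsManifold (𝓡 n) ∞ M] {g : SmoothMetric n M} {V : M → ℝ}

theorem isClassicalPath_zero (hV : ContMDiff (𝓡 n) 𝓘(ℝ, ℝ) ∞ V) (y : M) :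
    IsClassicalPath (scaledHamiltonian g V 0) 1 (fun _ => (⟨y, 0⟩ : CotangentBundle n M)) := by
  obtain ⟨B, U, O, hB, hU, hs, hO, hyO, hOt, hBO, hUO⟩ := exists_kineticHamiltonian g hV y
  have h1 : symplecticGrad n (fderiv ℝ (localHamiltonian (scaledHamiltonian g V 0) y)
      (extChartAt (𝓡 n) y y, 0)) = 0 := by
    rw [symplecticGrad_localHamiltonian g V hB hU hO hOt hBO hUO 0 hyO,
      extendedField_kineticHamiltonian_zero hB hU hs]
    rfl
  have hz := coChart_zero (n := n) (mem_extChartAt_source (I := 𝓡 n) y)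
  have hsrc : (⟨y, 0⟩ : CotangentBundle n M) ∈ (coChart n y).source :=
    mem_coChart_source_self (⟨y, 0⟩ : CotangentBundle n M)
  have ht : (extChartAt (𝓡 n) y y, (0 : CoModel n)) ∈ (coChart n y).target := by
    rw [← hz]
    exact (coChart n y).map_source hsrc
  have h2 : (coChart n y).symm (extChartAt (𝓡 n) y y, (0 : CoModel n)) = ⟨y, 0⟩ := by
    rw [← hz]
    exact (coChart n y).left_inv hsrc
  intro s _
  have h3 := hasMFDerivWithinAt_coChart_symm_comp (x₀ := y) (S := Icc 0 1) (r := s)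
    (H := scaledHamiltonian g V 0) (z := fun _ : ℝ => (extChartAt (𝓡 n) y y, (0 : CoModel n)))
    ht ((contMDiff_scaledHamiltonian g hV 0).mdifferentiable (by simp) _)
    (by rw [h1]; exact hasDerivWithinAt_const _ _ _)
  have h4 : (fun _ : ℝ => (⟨y, 0⟩ : CotangentBundle n M)) =
    fun _ => (coChart n y).symm (extChartAt (𝓡 n) y y, (0 : CoModel n)) := by rw [h2]
  rw [h4]
  exact h3

theorem chartDeriv_injective {x₀ y : M} (hy : y ∈ (extChartAt (𝓡 n) x₀).source) :
    Function.Injective (chartDeriv n x₀ y) := by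
  obtain ⟨e, he⟩ := isInvertible_chartDeriv hy
  rw [← he]
  exact e.injective

theorem hasFDerivAt_apply_one {E : Type*} [NormedAddCommGroup E] [NormedSpace ℝ E] {f : ℝ → E}
    {L : ℝ →L[ℝ] E} {v : E} {s : ℝ} (h : HasFDerivAt f L s) (h' : HasDerivAt f v s) : L 1 = v :=
  h.hasDerivAt.unique h'

/-- Hamilton's first equation: the velocity of a classical path is dual to its momentum. -/
theorem IsClassicalPath.mfderiv_proj (hV : ContMDiff (𝓡 n) 𝓘(ℝ, ℝ) ∞ V) {t T : ℝ}
    {c : ℝ → CotangentBundle n M} (hc : IsClassicalPath (scaledHamiltonian g V t) T c) {s : ℝ}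
    (hs : s ∈ Ioo 0 T) :
    mfderiv 𝓘(ℝ, ℝ) (𝓡 n) (fun s => (c s).proj) s (1 : ℝ) = sharp g (c s).proj (c s).snd := by
  set x₀ := (c s).proj with hx₀
  have hsrc : c s ∈ (coChart n x₀).source := mem_coChart_source_self _
  have hx : (c s).proj ∈ (extChartAt (𝓡 n) x₀).source := mem_coChart_source.1 hsrc
  have hcs := hc s (Ioo_subset_Icc_self hs)
  have h1 := hasDerivWithinAt_coChart_comp hsrc
    ((contMDiff_scaledHamiltonian g hV t).mdifferentiable (by simp) _) hcs
  obtain ⟨B, U, O, hB, hU, hsym, hO, hyO, hOt, hBO, hUO⟩ := exists_kineticHamiltonian g hV x₀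
  have hzO : (coChart n x₀ (c s)).1 ∈ O := by
    rw [coChart_fst]
    exact hyO
  rw [symplecticGrad_localHamiltonian g V hB hU hO hOt hBO hUO t hzO,
    extendedField_kineticHamiltonian hB hU hsym] at h1
  have hI := Icc_mem_nhds hs.1 hs.2
  have h2 : HasDerivAt (fun s => extChartAt (𝓡 n) x₀ (c s).proj)
      (B (coChart n x₀ (c s)).1 (coChart n x₀ (c s)).2) s := by
    have := (ContinuousLinearMap.fst ℝ (Model n) (CoModel n)).hasFDerivAt.comp_hasDerivAt s
      (h1.hasDerivAt hI)
    refine this.congr_of_eventuallyEq (Filter.Eventually.of_forall fun r => ?_)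
    exact (coChart_fst x₀ (c r)).symm
  rw [hBO _ hzO, ← chartDeriv_sharp g hsrc] at h2
  have hq : MDifferentiableAt 𝓘(ℝ, ℝ) (𝓡 n) (fun s => (c s).proj) s :=
    MDifferentiableAt.comp (I' := cotangentModel n) s
      ((Bundle.contMDiff_proj (n := ∞) (IB := 𝓡 n) (F := CoModel n)
        (fun x : M => CotangentSpace n x)).mdifferentiable (by simp) (c s))
      (hcs.hasMFDerivAt hI).mdifferentiableAt
  have h3 : HasMFDerivAt 𝓘(ℝ, ℝ) 𝓘(ℝ, Model n) (fun s => extChartAt (𝓡 n) x₀ (c s).proj) s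
      ((chartDeriv n x₀ (c s).proj).comp (mfderiv 𝓘(ℝ, ℝ) (𝓡 n) (fun s => (c s).proj) s)) :=
    (hasMFDerivAt_chartDeriv hx).comp s hq.hasMFDerivAt
  refine chartDeriv_injective hx ?_
  exact hasFDerivAt_apply_one (E := Model n) h3.hasFDerivAt h2

/-- Kinetic energy becomes a function of the momentum, so the action can be written without
derivatives of the path. -/
theorem IsClassicalPath.speedSq_eq (hV : ContMDiff (𝓡 n) 𝓘(ℝ, ℝ) ∞ V) {t T : ℝ}
    {c : ℝ → CotangentBundle n M} (hc : IsClassicalPath (scaledHamiltonian g V t) T c) {s : ℝ}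
    (hs : s ∈ Ioo 0 T) : speedSq g (fun s => (c s).proj) s = covectorNormSq g (c s) := by
  have h := hc.mfderiv_proj hV hs
  rw [speedSq]
  change g.inner (c s).proj (mfderiv 𝓘(ℝ, ℝ) (𝓡 n) (fun s => (c s).proj) s (1 : ℝ))
    (mfderiv 𝓘(ℝ, ℝ) (𝓡 n) (fun s => (c s).proj) s (1 : ℝ)) = _
  rw [h, inner_sharp]
  rfl

/-- The scaled action is the action of any low path, if that path is unique. -/
theorem HasUniqueLowPath.scaledAction_eq (hV : ContMDiff (𝓡 n) 𝓘(ℝ, ℝ) ∞ V) {μ t : ℝ} {x y : M}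
    (h : HasUniqueLowPath g (scaledHamiltonian g V t) 1 x y μ) {c : ℝ → CotangentBundle n M}
    (hc : c ∈ lowPaths g (scaledHamiltonian g V t) 1 x y μ) :
    scaledAction g V μ t x y = pathAction g V t c := by
  have hl : lowestPath g V μ t x y ∈ lowPaths g (scaledHamiltonian g V t) 1 x y μ :=
    haveI : Nonempty (ℝ → CotangentBundle n M) := ⟨c⟩
    Classical.epsilon_spec (p := fun c => c ∈ lowPaths g (scaledHamiltonian g V t) 1 x y μ) ⟨c, hc⟩
  obtain ⟨c₀, -, hc₀⟩ := h
  have he : EqOn (lowestPath g V μ t x y) c (Icc 0 1) := fun s hs =>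
    (hc₀ _ hl hs).trans (hc₀ _ hc hs).symm
  rw [scaledAction, pathAction]
  refine intervalIntegral.integral_congr_ae ?_
  -- The speed is a two-sided derivative, while paths are controlled on [0, 1] only, so the endpoint
  -- s = 1 is discarded as a null set.
  filter_upwards [compl_mem_ae_iff.2 (measure_singleton (μ := volume) (1 : ℝ))] with s hs1 hs
  rw [uIoc_of_le zero_le_one] at hs
  have hs' : s ∈ Ioo (0 : ℝ) 1 := ⟨hs.1, lt_of_le_of_ne hs.2 hs1⟩
  rw [hl.1.speedSq_eq hV hs', he (Ioo_subset_Icc_self hs')]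

end Paths

/-! ### From local inverses to a diffeomorphism onto the image -/

section LocalInverse

/-- An injective map with local right inverses that are smooth is a diffeomorphism onto its
image. -/
theorem exists_partialDiffeomorph {𝕜 E H N : Type*} [NontriviallyNormedField 𝕜]
    [NormedAddCommGroup E] [NormedSpace 𝕜 E] [TopologicalSpace H] {I : ModelWithCorners 𝕜 E H}
    [TopologicalSpace N] [ChartedSpace H N] {k : WithTop ℕ∞} {f : N → N} {s : Set N}
    (hs : IsOpen s) (hf : ContMDiffOn I I k f s) (hinj : InjOn f s)
    (hinv : ∀ p ∈ s, ∃ u : Set N, IsOpen u ∧ f p ∈ u ∧ ∃ h : N → N, ContMDiffOn I I k h u ∧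
      ∀ q ∈ u, h q ∈ s ∧ f (h q) = q) :
    ∃ Ψ : PartialDiffeomorph I I N N k, Ψ.source = s ∧ EqOn Ψ f s := by
  -- A set-theoretic inverse, with junk value q off the image. By injectivity it agrees with each
  -- smooth local inverse, and it inherits smoothness from them.
  have hr : ∀ q : N, ∃ r, q ∈ f '' s → r ∈ s ∧ f r = q := fun q => by
    by_cases h : q ∈ f '' s
    · obtain ⟨r, hr⟩ := h
      exact ⟨r, fun _ => hr⟩
    · exact ⟨q, fun h' => absurd h' h⟩
  choose r hr using hr
  refine ⟨{ toFun := f, invFun := r, source := s, target := f '' s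
            map_source' := fun p hp => mem_image_of_mem f hp
            map_target' := fun q hq => (hr q hq).1
            left_inv' := fun p hp => hinj (hr _ (mem_image_of_mem f hp)).1 hp
              (hr _ (mem_image_of_mem f hp)).2
            right_inv' := fun q hq => (hr q hq).2
            open_source := hs
            open_target := isOpen_iff_forall_mem_open.2 ?_
            contMDiffOn_toFun := hf
            contMDiffOn_invFun := ?_ }, rfl, fun _ _ => rfl⟩
  · rintro _ ⟨p, hp, rfl⟩
    obtain ⟨u, hu, hpu, h, -, hh⟩ := hinv p hp
    exact ⟨u, fun q hq => ⟨h q, hh q hq⟩, hu, hpu⟩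
  · rintro _ ⟨p, hp, rfl⟩
    obtain ⟨u, hu, hpu, h, hs, hh⟩ := hinv p hp
    refine ((hs.contMDiffAt (hu.mem_nhds hpu)).congr_of_eventuallyEq ?_).contMDiffWithinAt
    filter_upwards [hu.mem_nhds hpu] with q hq
    have hq' := hr q ⟨h q, hh q hq⟩
    exact hinj hq'.1 (hh q hq).1 (hq'.2.trans (hh q hq).2.symm)

end LocalInverse

/-! ### Gluing the local flows over the compact manifold -/

section Global

variable {n : ℕ} {M : Type*} [TopologicalSpace M] [ChartedSpace (Model n) M]
  [IsManifold (𝓡 n) ∞ M]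

omit [IsManifold (𝓡 n) ∞ M] in
theorem differential_congr {f f' : M → ℝ} {x : M} (h : f =ᶠ[𝓝 x] f') :
    differential (n := n) f x = differential f' x :=
  congrArg (fun L : CoModel n => (⟨x, L⟩ : CotangentBundle n M)) h.mfderiv_eq

/-- A choice of local flows such that, for small times, all paths that start at a given point with
small momentum belong to the same local flow. -/
structure FlowCover (g : SmoothMetric n M) (V : M → ℝ) where
  center : M → M
  flow : ∀ y, ChartFlow g V (center y)
  radius : ℝ
  radius_pos : 0 < radius
  mem_dom : ∀ (t : ℝ) (p : CotangentBundle n M), |t| < radius → covectorNorm g p < radius →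
    (t, p) ∈ (flow p.proj).dom

theorem nonempty_flowCover [CompactSpace M] (g : SmoothMetric n M) {V : M → ℝ}
    (hV : ContMDiff (𝓡 n) 𝓘(ℝ, ℝ) ∞ V) : Nonempty (FlowCover g V) := by
  have F : ∀ y, ChartFlow g V y := fun y => (nonempty_chartFlow g hV y).some
  obtain ⟨ε, hε, h⟩ := exists_lowMomentum_cover g (fun y => (F y).dom)
    fun y => (F y).isOpen_dom.mem_nhds (F y).mem_dom
  choose c hc using h
  exact ⟨⟨c, fun y => F (c y), ε, hε, fun t p ht hp => hc p.proj t p ht rfl hp⟩⟩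

variable {g : SmoothMetric n M} {V : M → ℝ}

namespace ChartFlow

variable {x₀ : M} (F : ChartFlow g V x₀)

theorem eqOn_path [T2Space M] (hV : ContMDiff (𝓡 n) 𝓘(ℝ, ℝ) ∞ V) {t : ℝ}
    {c : ℝ → CotangentBundle n M} (hc : IsClassicalPath (scaledHamiltonian g V t) 1 c)
    (h : (t, c 0) ∈ F.dom) : EqOn c (F.path (t, c 0)) (Icc 0 1) :=
  hc.eqOn (contMDiff_scaledHamiltonian g hV t) (F.isClassicalPath_path hV h)
    (left_mem_Icc.2 zero_le_one) (F.path_zero h).symm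

/-- The endpoints of the local paths with low initial momentum. -/
def lowEnds (μ : ℝ) : Set (ℝ × M × M) := F.ends ∩ F.initial ⁻¹' lowMomentum g μ

theorem isOpen_lowEnds (μ : ℝ) : IsOpen (F.lowEnds μ) :=
  F.contMDiffOn_initial.continuousOn.isOpen_inter_preimage F.isOpen_ends (isOpen_lowMomentum g μ)

theorem path_mem_lowPaths (hV : ContMDiff (𝓡 n) 𝓘(ℝ, ℝ) ∞ V) {μ t : ℝ} {x y : M}
    (hz : (t, x, y) ∈ F.lowEnds μ) : F.path (t, F.initial (t, x, y)) ∈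
      lowPaths g (scaledHamiltonian g V t) 1 x y μ := by
  have hd := F.initial_mem_dom hz.1
  refine ⟨F.isClassicalPath_path hV hd, ?_, F.path_initial_one_proj hz.1, ?_⟩
  · rw [F.path_zero hd]
    exact F.initial_proj hz.1
  · rw [F.path_zero hd]
    exact hz.2

/-- ODE uniqueness identifies the path with the local solution through c 0. The endpoint map then
recovers c 0 from t, x and y alone. -/
theorem mem_lowEnds_of_mem_lowPaths [T2Space M] (hV : ContMDiff (𝓡 n) 𝓘(ℝ, ℝ) ∞ V) {μ t : ℝ}
    {x y : M} {c : ℝ → CotangentBundle n M}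
    (hc : c ∈ lowPaths g (scaledHamiltonian g V t) 1 x y μ) (h : (t, c 0) ∈ F.dom) :
    (t, x, y) ∈ F.lowEnds μ ∧ F.initial (t, x, y) = c 0 := by
  obtain ⟨hcl, rfl, rfl, hμ⟩ := hc
  obtain ⟨h1, h2⟩ := F.endpoints_mem_ends h
  rw [← F.eqOn_path hV hcl h (right_mem_Icc.2 zero_le_one)] at h1 h2
  refine ⟨⟨h1, ?_⟩, h2⟩
  rw [mem_preimage, h2]
  exact hμ

theorem scaledAction_eq (hV : ContMDiff (𝓡 n) 𝓘(ℝ, ℝ) ∞ V) {μ t : ℝ} {x y : M}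
    (h : HasUniqueLowPath g (scaledHamiltonian g V t) 1 x y μ) (hz : (t, x, y) ∈ F.lowEnds μ) :
    scaledAction g V μ t x y = F.endAction (t, x, y) :=
  h.scaledAction_eq hV (F.path_mem_lowPaths hV hz)

end ChartFlow

theorem mem_lowMomentum_zero (g : SmoothMetric n M) {μ : ℝ} (hμ : 0 < μ) (y : M) :
    (⟨y, 0⟩ : CotangentBundle n M) ∈ lowMomentum g μ := by
  have : covectorNorm g (⟨y, 0⟩ : CotangentBundle n M) = 0 := Real.sqrt_zero
  rw [lowMomentum, mem_ofPred_eq, this]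
  exact hμ

namespace FlowCover

variable (C : FlowCover g V)

/-- The time one map. -/
def timeOne (t : ℝ) (p : CotangentBundle n M) : CotangentBundle n M :=
  (C.flow p.proj).path (t, p) 1

theorem mem_flow_dom {μ t : ℝ} (hμ : μ ≤ C.radius) (ht : |t| < C.radius)
    {p : CotangentBundle n M} (hp : p ∈ lowMomentum g μ) : (t, p) ∈ (C.flow p.proj).dom :=
  C.mem_dom t p ht (lt_of_lt_of_le hp hμ)

theorem exists_isClassicalPath (hV : ContMDiff (𝓡 n) 𝓘(ℝ, ℝ) ∞ V) {μ t : ℝ}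
    (hμ : μ ≤ C.radius) (ht : |t| < C.radius) {p : CotangentBundle n M}
    (hp : p ∈ lowMomentum g μ) : ∃ c : ℝ → CotangentBundle n M,
      IsClassicalPath (scaledHamiltonian g V t) 1 c ∧ c 0 = p ∧ c 1 = C.timeOne t p := by
  have hd := C.mem_flow_dom hμ ht hp
  refine ⟨(C.flow p.proj).path (t, p), ?_, ?_, ?_⟩
  · exact (C.flow p.proj).isClassicalPath_path hV (z := (t, p)) hd
  · exact (C.flow p.proj).path_zero (z := (t, p)) hd
  · rfl

variable [T2Space M]

theorem mem_lowEnds (hV : ContMDiff (𝓡 n) 𝓘(ℝ, ℝ) ∞ V) {μ t : ℝ}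
    (hμ : μ ≤ C.radius) (ht : |t| < C.radius) {x y : M} {c : ℝ → CotangentBundle n M}
    (hc : c ∈ lowPaths g (scaledHamiltonian g V t) 1 x y μ) :
    (t, x, y) ∈ (C.flow y).lowEnds μ ∧ (C.flow y).initial (t, x, y) = c 0 := by
  refine (C.flow y).mem_lowEnds_of_mem_lowPaths hV hc ?_
  have h := C.mem_flow_dom hμ ht (p := c 0) hc.2.2.2
  rwa [hc.2.1] at h

/-- All low paths from y lie in the local flow attached to y, so each starts at its `initial`
covector for (t, x, y). Existence thus implies uniqueness. -/
theorem hasUniqueLowPath (hV : ContMDiff (𝓡 n) 𝓘(ℝ, ℝ) ∞ V) {μ t : ℝ}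
    (hμ : μ ≤ C.radius) (ht : |t| < C.radius) {x y : M} {c : ℝ → CotangentBundle n M}
    (hc : c ∈ lowPaths g (scaledHamiltonian g V t) 1 x y μ) :
    HasUniqueLowPath g (scaledHamiltonian g V t) 1 x y μ :=
  ⟨c, hc, fun _ hc' => hc'.1.eqOn (contMDiff_scaledHamiltonian g hV t) hc.1
    (left_mem_Icc.2 zero_le_one)
    ((C.mem_lowEnds hV hμ ht hc').2.symm.trans (C.mem_lowEnds hV hμ ht hc).2)⟩

/-- Witnessed by the constant path at t = 0. The local flow attached to y need not be centred at y,
so this is not immediate from `ChartFlow.mem_dom`. -/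
theorem zero_mem_lowEnds (hV : ContMDiff (𝓡 n) 𝓘(ℝ, ℝ) ∞ V) {μ : ℝ} (hμ0 : 0 < μ)
    (hμ : μ ≤ C.radius) (y : M) : ((0 : ℝ), y, y) ∈ (C.flow y).lowEnds μ :=
  (C.mem_lowEnds hV hμ (by simpa using C.radius_pos) (c := fun _ => ⟨y, 0⟩)
    ⟨isClassicalPath_zero hV y, rfl, rfl, mem_lowMomentum_zero g hμ0 y⟩).1

/-- The set of local low endpoints is open and contains (0, y, y), so low paths persist for small t
and nearby endpoints. A finite subcover of the diagonal leaves a single t₀. -/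
theorem exists_uniform [CompactSpace M] (hV : ContMDiff (𝓡 n) 𝓘(ℝ, ℝ) ∞ V) {μ : ℝ}
    (hμ0 : 0 < μ) (hμ : μ ≤ C.radius) : ∃ t₀ > (0 : ℝ), ∃ N : Set (M × M), IsOpen N ∧
      (∀ y, (y, y) ∈ N) ∧ ∀ t : ℝ, |t| < t₀ → ∀ x y, (x, y) ∈ N →
        ∃ c, c ∈ lowPaths g (scaledHamiltonian g V t) 1 x y μ := by
  have h := (isCompact_univ (X := M)).induction_on (p := fun S => ∃ t₀ > (0 : ℝ),
    ∃ N : Set (M × M), IsOpen N ∧ (∀ y ∈ S, (y, y) ∈ N) ∧ ∀ t : ℝ, |t| < t₀ → ∀ x y,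
      (x, y) ∈ N → ∃ c, c ∈ lowPaths g (scaledHamiltonian g V t) 1 x y μ)
    ⟨1, one_pos, ∅, isOpen_empty, by simp, by simp⟩
    (fun S S' hS ⟨t₀, ht₀, N, hN, hd, h⟩ => ⟨t₀, ht₀, N, hN, fun y hy => hd y (hS hy), h⟩) ?_ ?_
  · obtain ⟨t₀, ht₀, N, hN, hd, h⟩ := h
    exact ⟨t₀, ht₀, N, hN, fun y => hd y trivial, h⟩
  · rintro S S' ⟨t₀, ht₀, N, hN, hd, h⟩ ⟨t₀', ht₀', N', hN', hd', h'⟩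
    refine ⟨min t₀ t₀', lt_min ht₀ ht₀', N ∪ N', hN.union hN', ?_, ?_⟩
    · rintro y (hy | hy)
      · exact Or.inl (hd y hy)
      · exact Or.inr (hd' y hy)
    · rintro t ht x y (hxy | hxy)
      · exact h t (ht.trans_le (min_le_left _ _)) x y hxy
      · exact h' t (ht.trans_le (min_le_right _ _)) x y hxy
  · intro x₀ _
    have h1 := ((C.flow x₀).isOpen_lowEnds μ).mem_nhds (C.zero_mem_lowEnds hV hμ0 hμ x₀)
    rw [nhds_prod_eq, Filter.mem_prod_iff] at h1
    obtain ⟨I, hI, R, hR, hIR⟩ := h1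
    obtain ⟨t₀, ht₀, hI⟩ := Metric.mem_nhds_iff.1 hI
    obtain ⟨N, hNR, hN, hxN⟩ := mem_nhds_iff.1 hR
    have hdc : Continuous fun y : M => (y, y) := by fun_prop
    refine ⟨_, mem_nhdsWithin_of_mem_nhds ((hN.preimage hdc).mem_nhds hxN), t₀, ht₀, N, hN,
      fun y hy => hy, fun t ht x y hxy => ⟨_, (C.flow x₀).path_mem_lowPaths hV
        (hIR ⟨hI (by simpa using ht), hNR hxy⟩)⟩⟩

theorem exists_isAdmissible [CompactSpace M] (hV : ContMDiff (𝓡 n) 𝓘(ℝ, ℝ) ∞ V) {μ : ℝ}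
    (hμ0 : 0 < μ) (hμ : μ ≤ C.radius) :
    ∃ t₀ ∈ Ioc 0 C.radius, ∃ N : Set (M × M), IsAdmissible g V μ t₀ N := by
  obtain ⟨t₀, ht₀, N, hN, hd, h⟩ := C.exists_uniform hV hμ0 hμ
  have h1 : ∀ t : ℝ, |t| < min t₀ C.radius → ∀ x y, (x, y) ∈ N →
      HasUniqueLowPath g (scaledHamiltonian g V t) 1 x y μ := fun t ht x y hxy => by
    obtain ⟨c, hc⟩ := h t (ht.trans_le (min_le_left _ _)) x y hxy
    exact C.hasUniqueLowPath hV hμ (ht.trans_le (min_le_right _ _)) hc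
  refine ⟨min t₀ C.radius, ⟨lt_min ht₀ C.radius_pos, min_le_right _ _⟩, N, hN, ?_, ?_, ?_⟩
  · rintro ⟨x, y⟩ hxy
    obtain rfl : x = y := hxy
    exact hd x
  · intro t ht x y hxy
    exact (h1 t (by rw [abs_of_pos ht.1]; exact ht.2) x y hxy).of_scaled g hV ht.1
  · intro t ht x y hxy
    exact h1 t (abs_lt.2 ht) x y hxy

theorem timeOne_eq (hV : ContMDiff (𝓡 n) 𝓘(ℝ, ℝ) ∞ V) {μ t : ℝ} (hμ : μ ≤ C.radius)
    (ht : |t| < C.radius) {c : ℝ → CotangentBundle n M}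
    (hc : IsClassicalPath (scaledHamiltonian g V t) 1 c) (h : c 0 ∈ lowMomentum g μ) :
    C.timeOne t (c 0) = c 1 :=
  ((C.flow (c 0).proj).eqOn_path hV hc (C.mem_flow_dom hμ ht h)
    (right_mem_Icc.2 zero_le_one)).symm

theorem timeOne_eq_path (hV : ContMDiff (𝓡 n) 𝓘(ℝ, ℝ) ∞ V) {μ t : ℝ} (hμ : μ ≤ C.radius)
    (ht : |t| < C.radius) {p : CotangentBundle n M} (hp : p ∈ lowMomentum g μ) {x₀ : M}
    (F : ChartFlow g V x₀) (h : (t, p) ∈ F.dom) : C.timeOne t p = F.path (t, p) 1 := by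
  have h0 : F.path (t, p) 0 = p := F.path_zero (z := (t, p)) h
  have h1 : IsClassicalPath (scaledHamiltonian g V t) 1 (F.path (t, p)) :=
    F.isClassicalPath_path hV (z := (t, p)) h
  have h2 : F.path (t, p) 0 ∈ lowMomentum g μ := by rwa [h0]
  have h3 := C.timeOne_eq hV hμ ht h1 h2
  rwa [h0] at h3

theorem contMDiffOn_timeOne (hV : ContMDiff (𝓡 n) 𝓘(ℝ, ℝ) ∞ V) {μ t₀ : ℝ} (hμ : μ ≤ C.radius)
    (ht₀ : t₀ ≤ C.radius) :
    ContMDiffOn (𝓘(ℝ, ℝ).prod (cotangentModel n)) (cotangentModel n) ∞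
      (fun z : ℝ × CotangentBundle n M => C.timeOne z.1 z.2) (Ioo (-t₀) t₀ ×ˢ lowMomentum g μ) := by
  have ho : IsOpen (Ioo (-t₀) t₀ ×ˢ lowMomentum g μ) := isOpen_Ioo.prod (isOpen_lowMomentum g μ)
  intro z hz
  have hd := C.mem_flow_dom hμ ((abs_lt.2 hz.1).trans_le ht₀) hz.2
  have hn := (C.flow z.2.proj).isOpen_dom.mem_nhds hd
  refine (((C.flow z.2.proj).contMDiffOn_path_one.contMDiffAt hn).congr_of_eventuallyEq
    ?_).contMDiffWithinAt
  filter_upwards [hn, ho.mem_nhds hz] with w hw hw'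
  exact C.timeOne_eq_path hV hμ ((abs_lt.2 hw'.1).trans_le ht₀) hw'.2 _ hw

/-- Two paths with the same endpoint at time one coincide on [0, 1], by uniqueness applied at s = 1.
-/
theorem injOn_timeOne (hV : ContMDiff (𝓡 n) 𝓘(ℝ, ℝ) ∞ V) {μ t : ℝ} (hμ : μ ≤ C.radius)
    (ht : |t| < C.radius) : InjOn (C.timeOne t) (lowMomentum g μ) := by
  intro p hp p' hp' h
  obtain ⟨c, hc, rfl, hc1⟩ := C.exists_isClassicalPath hV hμ ht hp
  obtain ⟨c', hc', rfl, hc1'⟩ := C.exists_isClassicalPath hV hμ ht hp'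
  exact hc.eqOn (contMDiff_scaledHamiltonian g hV t) hc' (right_mem_Icc.2 zero_le_one)
    (hc1.trans (h.trans hc1'.symm)) (left_mem_Icc.2 zero_le_one)

theorem contMDiffOn_timeOne_apply (hV : ContMDiff (𝓡 n) 𝓘(ℝ, ℝ) ∞ V) {μ t : ℝ}
    (hμ : μ ≤ C.radius) (ht : |t| < C.radius) :
    ContMDiffOn (cotangentModel n) (cotangentModel n) ∞ (C.timeOne t) (lowMomentum g μ) := by
  have hsec : ContMDiff (cotangentModel n) (𝓘(ℝ, ℝ).prod (cotangentModel n)) ∞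
      (fun p : CotangentBundle n M => (t, p)) := contMDiff_const.prodMk contMDiff_id
  have hm : MapsTo (fun p : CotangentBundle n M => (t, p)) (lowMomentum g μ)
      (Ioo (-C.radius) C.radius ×ˢ lowMomentum g μ) := fun p hp => mk_mem_prod (abs_lt.1 ht) hp
  have h := (C.contMDiffOn_timeOne hV hμ le_rfl).comp (hsec.contMDiffOn (s := lowMomentum g μ)) hm
  exact h

theorem timeOne_start (hV : ContMDiff (𝓡 n) 𝓘(ℝ, ℝ) ∞ V) {μ t : ℝ} (hμ : μ ≤ C.radius)
    (ht : |t| < C.radius) {x₀ : M} (F : ChartFlow g V x₀) {q : CotangentBundle n M}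
    (hq : (t, q) ∈ F.codom) (hs : F.start (t, q) ∈ lowMomentum g μ) :
    C.timeOne t (F.start (t, q)) = q := by
  obtain ⟨h1, h2⟩ := F.start_mem_dom (z := (t, q)) hq
  rw [C.timeOne_eq_path hV hμ ht hs F h1]
  exact h2

theorem exists_localInverse_timeOne (hV : ContMDiff (𝓡 n) 𝓘(ℝ, ℝ) ∞ V) {μ t : ℝ}
    (hμ : μ ≤ C.radius) (ht : |t| < C.radius) {p : CotangentBundle n M}
    (hp : p ∈ lowMomentum g μ) {x₀ : M} (F : ChartFlow g V x₀) (hd : (t, p) ∈ F.dom) :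
    ∃ u : Set (CotangentBundle n M), IsOpen u ∧ C.timeOne t p ∈ u ∧
      ∃ h : CotangentBundle n M → CotangentBundle n M,
        ContMDiffOn (cotangentModel n) (cotangentModel n) ∞ h u ∧
        ∀ q ∈ u, h q ∈ lowMomentum g μ ∧ C.timeOne t (h q) = q := by
  have hsec : ContMDiff (cotangentModel n) (𝓘(ℝ, ℝ).prod (cotangentModel n)) ∞
      (fun p : CotangentBundle n M => (t, p)) := contMDiff_const.prodMk contMDiff_id
  obtain ⟨h1, h2⟩ := F.path_one_mem_codom (z := (t, p)) hd
  have hs : ContMDiffOn (cotangentModel n) (cotangentModel n) ∞ (fun q => F.start (t, q))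
      ((fun q => (t, q)) ⁻¹' F.codom) :=
    F.contMDiffOn_start.comp hsec.contMDiffOn fun q hq => hq
  -- The second condition makes the local inverse land in the low-momentum set, where the global
  -- time-one map is controlled.
  refine ⟨(fun q => (t, q)) ⁻¹' F.codom ∩ (fun q => F.start (t, q)) ⁻¹' lowMomentum g μ,
    hs.continuousOn.isOpen_inter_preimage (F.isOpen_codom.preimage hsec.continuous)
      (isOpen_lowMomentum g μ), ?_, _, hs.mono inter_subset_left,
      fun q hq => ⟨hq.2, C.timeOne_start hV hμ ht F hq.1 hq.2⟩⟩
  rw [C.timeOne_eq_path hV hμ ht hp F hd]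
  refine ⟨h1, ?_⟩
  rw [mem_preimage]
  change F.start ((t, p).1, F.path (t, p) 1) ∈ lowMomentum g μ
  rw [h2]
  exact hp

theorem exists_partialDiffeomorph_timeOne (hV : ContMDiff (𝓡 n) 𝓘(ℝ, ℝ) ∞ V) {μ t : ℝ}
    (hμ : μ ≤ C.radius) (ht : |t| < C.radius) :
    ∃ Ψ : PartialDiffeomorph (cotangentModel n) (cotangentModel n) (CotangentBundle n M)
      (CotangentBundle n M) ∞, Ψ.source = lowMomentum g μ ∧
        EqOn Ψ (C.timeOne t) (lowMomentum g μ) :=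
  exists_partialDiffeomorph (isOpen_lowMomentum g μ) (C.contMDiffOn_timeOne_apply hV hμ ht)
    (C.injOn_timeOne hV hμ ht) fun _ hp =>
      C.exists_localInverse_timeOne hV hμ ht hp _ (C.mem_flow_dom hμ ht hp)

section Admissible

variable (hV : ContMDiff (𝓡 n) 𝓘(ℝ, ℝ) ∞ V) {μ t₀ : ℝ} (hμ : μ ≤ C.radius)
  (ht₀ : t₀ ≤ C.radius) {N : Set (M × M)} (hN : IsAdmissible g V μ t₀ N)

include hV hμ ht₀ hN

/-- Admissibility of any N supplies a low path, and below the radius such a path must come from the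
local flow at y. -/
theorem mem_lowEnds_of_isAdmissible {t : ℝ} (ht : t ∈ Ioo (-t₀) t₀) {x y : M}
    (hxy : (x, y) ∈ N) : (t, x, y) ∈ (C.flow y).lowEnds μ := by
  obtain ⟨c, hc, -⟩ := hN.unique_scaled t ht x y hxy
  exact (C.mem_lowEnds hV hμ ((abs_lt.2 ht).trans_le ht₀) hc).1

/-- Uniqueness identifies the chosen path with the local one. The local flow is fixed at y while (t,
x, y) varies, so smoothness and differentials transfer. -/
theorem scaledAction_eventuallyEq {t : ℝ} (ht : t ∈ Ioo (-t₀) t₀) {x y : M}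
    (hxy : (x, y) ∈ N) : ∀ᶠ z : ℝ × M × M in 𝓝 (t, x, y),
      scaledAction g V μ z.1 z.2.1 z.2.2 = (C.flow y).endAction z := by
  filter_upwards [((C.flow y).isOpen_lowEnds μ).mem_nhds
    (C.mem_lowEnds_of_isAdmissible hV hμ ht₀ hN ht hxy),
    (isOpen_Ioo.prod hN.isOpen).mem_nhds (⟨ht, hxy⟩ : (t, x, y) ∈ Ioo (-t₀) t₀ ×ˢ N)] with z hz hz'
  exact (C.flow y).scaledAction_eq hV (hN.unique_scaled _ hz'.1 _ _ hz'.2) hz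

theorem contMDiffOn_scaledAction : ContMDiffOn (𝓘(ℝ, ℝ).prod ((𝓡 n).prod (𝓡 n))) 𝓘(ℝ, ℝ) ∞
    (fun z : ℝ × M × M => scaledAction g V μ z.1 z.2.1 z.2.2) (Ioo (-t₀) t₀ ×ˢ N) := by
  rintro ⟨t, x, y⟩ ⟨ht, hxy⟩
  have h := C.mem_lowEnds_of_isAdmissible hV hμ ht₀ hN ht hxy
  exact (((C.flow y).contMDiffOn_endAction.contMDiffAt ((C.flow y).isOpen_ends.mem_nhds
    h.1)).congr_of_eventuallyEq
      (C.scaledAction_eventuallyEq hV hμ ht₀ hN ht hxy)).contMDiffWithinAt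

theorem differential_scaledAction_source {t : ℝ} (ht : t ∈ Ioo (-t₀) t₀) {x y : M}
    (hxy : (x, y) ∈ N) : differential (fun y' => -scaledAction g V μ t x y') y =
      (C.flow y).initial (t, x, y) := by
  rw [← (C.flow y).differential_source (C.mem_lowEnds_of_isAdmissible hV hμ ht₀ hN ht hxy).1]
  refine differential_congr ?_
  have hc : Continuous fun b : M => (t, x, b) := by fun_prop
  filter_upwards [(hc.tendsto y).eventually
    (C.scaledAction_eventuallyEq hV hμ ht₀ hN ht hxy)] with b hb
  exact congrArg (fun r => -r) hb

theorem differential_scaledAction_target {t : ℝ} (ht : t ∈ Ioo (-t₀) t₀) {x y : M}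
    (hxy : (x, y) ∈ N) : differential (fun x' => scaledAction g V μ t x' y) x =
      (C.flow y).path (t, (C.flow y).initial (t, x, y)) 1 := by
  rw [← (C.flow y).differential_target (C.mem_lowEnds_of_isAdmissible hV hμ ht₀ hN ht hxy).1]
  refine differential_congr ?_
  have hc : Continuous fun a : M => (t, a, y) := by fun_prop
  exact (hc.tendsto x).eventually (C.scaledAction_eventuallyEq hV hμ ht₀ hN ht hxy)

theorem isPhaseFunctionWith : IsPhaseFunctionWith (Ioo (-t₀) t₀) N (scaledAction g V μ)
    (lowMomentum g μ) C.timeOne where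
  isOpen_domain := hN.isOpen
  smooth_phase := C.contMDiffOn_scaledAction hV hμ ht₀ hN
  isOpen_source := isOpen_lowMomentum g μ
  smooth_family := C.contMDiffOn_timeOne hV hμ ht₀
  diffeo t ht := C.exists_partialDiffeomorph_timeOne hV hμ ((abs_lt.2 ht).trans_le ht₀)
  mem_source t ht x y hxy := by
    rw [C.differential_scaledAction_source hV hμ ht₀ hN ht hxy]
    exact (C.mem_lowEnds_of_isAdmissible hV hμ ht₀ hN ht hxy).2
  generates t ht x y hxy := by
    have h := C.mem_lowEnds_of_isAdmissible hV hμ ht₀ hN ht hxy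
    rw [C.differential_scaledAction_source hV hμ ht₀ hN ht hxy,
      C.differential_scaledAction_target hV hμ ht₀ hN ht hxy]
    exact C.timeOne_eq_path hV hμ ((abs_lt.2 ht).trans_le ht₀) h.2 _
      ((C.flow y).initial_mem_dom h.1)

end Admissible

end FlowCover

end Global

end CotangentDynamics

end

theorem theorem4p8 {n : ℕ} {M : Type*} [TopologicalSpace M] [T2Space M] [CompactSpace M]
    [ChartedSpace (EuclideanSpace ℝ (Fin n)) M] [IsManifold (𝓡 n) ∞ M]
    (g : CotangentDynamics.SmoothMetric n M) (V : M → ℝ) (hV : ContMDiff (𝓡 n) 𝓘(ℝ, ℝ) ∞ V) :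
    ∃ μ₀ > (0 : ℝ), ∃ t₂ > (0 : ℝ),
      (∀ μ ∈ Ioc 0 μ₀, ∃ t₀ ∈ Ioc 0 t₂, ∃ N : Set (M × M),
        CotangentDynamics.IsAdmissible g V μ t₀ N) ∧
      ∀ μ ∈ Ioc 0 μ₀, ∀ t₀ ∈ Ioc 0 t₂, ∀ N : Set (M × M),
        CotangentDynamics.IsAdmissible g V μ t₀ N →
        ∃ φ₁ : ℝ → CotangentDynamics.CotangentBundle n M → CotangentDynamics.CotangentBundle n M,
          (∀ t ∈ Ioo (-t₀) t₀, ∀ p ∈ CotangentDynamics.lowMomentum g μ,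
            ∃ c : ℝ → CotangentDynamics.CotangentBundle n M,
              CotangentDynamics.IsClassicalPath
                (CotangentDynamics.scaledHamiltonian g V t) 1 c ∧ c 0 = p ∧ c 1 = φ₁ t p) ∧
          CotangentDynamics.IsPhaseFunctionWith (Ioo (-t₀) t₀) N
            (CotangentDynamics.scaledAction g V μ) (CotangentDynamics.lowMomentum g μ) φ₁ := by
  obtain ⟨C⟩ := CotangentDynamics.nonempty_flowCover g hV
  -- One radius of uniformity serves as the bound for both momentum and time.
  refine ⟨C.radius, C.radius_pos, C.radius, C.radius_pos,
    fun μ hμ => C.exists_isAdmissible hV hμ.1 hμ.2, fun μ hμ t₀ ht₀ N hN =>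
      ⟨C.timeOne, fun t ht p hp => C.exists_isClassicalPath hV hμ.2
        ((abs_lt.2 ht).trans_le ht₀.2) hp, C.isPhaseFunctionWith hV hμ.2 ht₀.2 hN⟩⟩
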